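/- Fix an integer $n\ge 0$. Permutations are bijections $w$ of $\{i\in\mathbb Z: i\le n\}$ with $w(i)=i$ for all sufficiently negative $i$; $\ell(w)$ is the least number of simple transpositions $s_i=(i,i+1)$, $i<n$, whose product is $w$; $s_{c,d}$ is the transposition of $c$ and $d$. *RC-graphs.* Let $R$ be a finite set of pairs $(i,k)$ of integers $i,k\le n$. Place $(i,k)$ is in column $i$ and row $k$ of a table whose top row and leftmost column have number $n$ (numbers decrease downwards and to the right). A strand labeled $a$ starts at the left end of each row $a\le n$. At places of $R$ the two strands passing through intersect (left to right, bottom to top); at all other places they do not (left to top, bottom to right). $R$ is an rc-graph if no two strands intersect twice; $w_R(a)$ is the column at whose top the strand labeled $a$ ends. Put $x^R=\prod_{(i,k)\in R}x_k$ and $S_w=\sum_{w_R=w}x^R$, the sum being over rc-graphs $R$. *Tableaux.* For a partition $\mu$, $S_\mu=\sum_Y x^Y$ is the Schur polynomial, the sum being over the semistandard Young tableaux $Y$ of shape $\mu$ with entries in $\{1,\dots,n\}$, where $x^Y$ is the product of the $x_j$ over the entries $j$ of $Y$. Let $\nu_m$ be one row of $m\ge 0$ boxes. *Insertion.* A place $(i,k)\notin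 R$ is an open space of $R$ if the strand entering it from the left has a positive label and the strand entering it from the bottom has a nonpositive label. To insert $k\in\{1,\dots,n\}$ into $R$, put into $R$ the open space $(i,k)$ of row $k$ with smallest $i$. If the result is an rc-graph, stop. Otherwise the two strands which now intersect at $(i,k)$ also intersect at another place $(l,k')$ with $k'>k$; remove $(l,k')$, put in the place $(i',k')$ with the smallest $i'>l$ which is an open space of the set so obtained, and continue in the same way until an rc-graph results. The result is $R\leftarrow k$. For a tableau $Y$, $R\leftarrow Y$ is obtained by inserting one by one the entries of $Y$, read from left to right in each row, from the bottom row to the top row. **Lemma.** Let $w$ be a permutation with $w(i)>w(i-1)$ for all $i\le 0$, and let $m\ge 0$. Then $S_wS_{\nu_m}$ has a unique expansion as a finite integer linear combination $\sum_u c^u_{w,\nu_m}S_u$ over permutations $u$, and for every rc-graph $U$, with $u=w_U$, the coefficient $c^u_{w,\nu_m}$ is equal to the (finite) number of pairs $(R,Y)$ of an rc-graph $R$ with $w_R=w$ and a Young tableau $Y$ of shape $\nu_m$ such that $R\leftarrow Y=U$. Moreover $$S_wS_{\nu_m}=\sum S_{w s_{c_1,d_1}\cdots s_{c_m,d_m}},$$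 where the sum is over the (finitely many) sequences $(c_1,d_1),\dots,(c_m,d_m)$ with $n\ge c_j>0\ge d_j$ for all $j$, $d_1>d_2>\dots>d_m$, and $\ell(ws_{c_1,d_1}\cdots s_{c_{m'},d_{m'}})=\ell(w)+m'$ for every $m'\le m$. -/

import Mathlib

namespace RCGraph

/-- Permutations of the integers that are at most `n`, fixing all sufficiently negative integers.
They are represented as permutations of `ℤ` fixing every `i > n`. -/
def FinPerm (n : ℕ) : Type :=
  {w : Equiv.Perm ℤ // (∀ i : ℤ, (n : ℤ) < i → w i = i) ∧ ∃ N : ℤ, ∀ i : ℤ, i < N → w i = i}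

/-- The length: the least number of simple transpositions `s_i = (i, i+1)` (with `i + 1 ≤ n`)
whose product is `w`. -/
noncomputable def length (n : ℕ) (w : Equiv.Perm ℤ) : ℕ :=
  sInf {r : ℕ | ∃ l : List ℤ, (∀ i ∈ l, i < (n : ℤ)) ∧ l.length = r ∧
    (l.map fun i => Equiv.swap i (i + 1)).prod = w}

/-! ### Tables of strands

The place `(i, k)` lies in column `i` and row `k`, for `i, k ≤ n`. Row `n` is the top row and
column `n` is the leftmost column, so that the place to the right of `(i, k)` is `(i - 1, k)`, and
the place above it is `(i, k + 1)`. -/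

/-- The side through which a strand enters a place. -/
inductive Side : Type
  | left
  | bottom

/-- `Strand n R a s i k`: the strand labeled `a` enters the place `(i, k)` of the table of `R`
through its side `s`. The strand labeled `a` starts at the left end of row `a`. At a place of `R`
the two strands intersect (left to right, and bottom to top); at any other place they do not
(left to top, and bottom to right). A strand ends when it leaves the top row, which is expressed as
entering row `n + 1` through the bottom. -/
inductive Strand (n : ℕ) (R : Finset (ℤ × ℤ)) (a : ℤ) : Side → ℤ → ℤ → Prop
  | start : a ≤ n → Strand n R a Side.left n a
  | leftTop {i k : ℤ} : Strand n R a Side.left i k → (i, k) ∉ R →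
      Strand n R a Side.bottom i (k + 1)
  | bottomRight {i k : ℤ} : Strand n R a Side.bottom i k → k ≤ n → (i, k) ∉ R →
      Strand n R a Side.left (i - 1) k
  | leftRight {i k : ℤ} : Strand n R a Side.left i k → (i, k) ∈ R →
      Strand n R a Side.left (i - 1) k
  | bottomTop {i k : ℤ} : Strand n R a Side.bottom i k → k ≤ n → (i, k) ∈ R →
      Strand n R a Side.bottom i (k + 1)

/-- The strands labeled `a` and `b` intersect at the place `p`. -/
def Intersect (n : ℕ) (R : Finset (ℤ × ℤ)) (a b : ℤ) (p : ℤ × ℤ) : Prop :=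
  p ∈ R ∧
    ((Strand n R a Side.left p.1 p.2 ∧ Strand n R b Side.bottom p.1 p.2) ∨
      (Strand n R b Side.left p.1 p.2 ∧ Strand n R a Side.bottom p.1 p.2))

/-- `R` is an rc-graph: a finite set of places such that no two strands intersect twice. -/
def IsRC (n : ℕ) (R : Finset (ℤ × ℤ)) : Prop :=
  (∀ p ∈ R, p.1 ≤ (n : ℤ) ∧ p.2 ≤ (n : ℤ)) ∧
    ∀ (a b : ℤ) (p q : ℤ × ℤ), Intersect n R a b p → Intersect n R a b q → p = q

/-- `w_R = w`: for every `a ≤ n`, the strand labeled `a` ends at the top of column `w a`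
(and `w` fixes the integers greater than `n`). -/
def HasPerm (n : ℕ) (R : Finset (ℤ × ℤ)) (w : Equiv.Perm ℤ) : Prop :=
  (∀ a : ℤ, a ≤ n → Strand n R a Side.bottom (w a) (n + 1)) ∧ ∀ a : ℤ, (n : ℤ) < a → w a = a

/-- The set of rc-graphs `R` with `w_R = w`. -/
def graphs (n : ℕ) (w : Equiv.Perm ℤ) : Set (Finset (ℤ × ℤ)) :=
  {R | IsRC n R ∧ HasPerm n R w}

/-- The Schubert polynomial `S_w`, the sum of the monomials `x^R = ∏_{(i,k) ∈ R} x_k` over all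
rc-graphs `R` with `w_R = w` (a finite set for every `w` in `FinPerm n`). -/
noncomputable def schubert (n : ℕ) (w : Equiv.Perm ℤ) : MvPolynomial ℤ ℤ :=
  ∑ᶠ R ∈ graphs n w, ∏ p ∈ R, MvPolynomial.X p.2

/-! ### Young tableaux -/

/-- The Young tableaux of shape `μ` with entries in `1, …, n`. -/
def tableaux (n : ℕ) (μ : YoungDiagram) : Set (SemistandardYoungTableau μ) :=
  {Y | ∀ c ∈ μ.cells, 1 ≤ Y c.1 c.2 ∧ Y c.1 c.2 ≤ n}

/-- The Schur polynomial `S_μ` in `x_1, …, x_n`. -/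
noncomputable def schur (n : ℕ) (μ : YoungDiagram) : MvPolynomial ℤ ℤ :=
  ∑ᶠ Y ∈ tableaux n μ, ∏ c ∈ μ.cells, MvPolynomial.X (Y c.1 c.2 : ℤ)

/-- The word of a tableau: each row is read from left to right, starting from the bottom row and
going to the top one. -/
def word {μ : YoungDiagram} (Y : SemistandardYoungTableau μ) : List ℕ :=
  (List.range (μ.colLen 0)).reverse.flatMap fun i => (List.range (μ.rowLen i)).map fun j => Y i j

/-- The Young diagram `ν_m`: one row of `m` boxes. -/
def oneRow (m : ℕ) : YoungDiagram :=
  YoungDiagram.ofRowLens [m] (List.pairwise_singleton _ m |>.sortedGE)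

/-! ### The insertion algorithm -/

/-- `(i, k)` is an open space of `R`: the strands do not intersect there, the top one (which goes
from the left to the top) has a positive label and the bottom one (which goes from the bottom to
the right) a nonpositive label. -/
def IsOpenSpace (n : ℕ) (R : Finset (ℤ × ℤ)) (i k : ℤ) : Prop :=
  k ≤ n ∧ (i, k) ∉ R ∧
    ∃ a b : ℤ, 0 < a ∧ b ≤ 0 ∧ Strand n R a Side.left i k ∧ Strand n R b Side.bottom i k

/-- `InsertFrom n R k J U`: the insertion algorithm, about to insert an intersection into row `k` of
`R` at the smallest open space whose column lies in `J`, ends with `U`.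
It inserts that place `(i, k)`, and stops if this gives an rc-graph. Otherwise the two strands which
now intersect at `(i, k)` intersect at another place `(l, k')` with `k' > k`; this place is removed,
and the algorithm continues in row `k'` with the open spaces whose column is greater than `l`. -/
inductive InsertFrom (n : ℕ) :
    Finset (ℤ × ℤ) → ℤ → Set ℤ → Finset (ℤ × ℤ) → Prop
  | last {R : Finset (ℤ × ℤ)} {k i : ℤ} {J : Set ℤ} :
      IsLeast {j | j ∈ J ∧ IsOpenSpace n R j k} i →
      IsRC n (insert (i, k) R) →
      InsertFrom n R k J (insert (i, k) R)
  | next {R U : Finset (ℤ × ℤ)} {k i k' l a b : ℤ} {J : Set ℤ} :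
      IsLeast {j | j ∈ J ∧ IsOpenSpace n R j k} i →
      ¬ IsRC n (insert (i, k) R) →
      Intersect n (insert (i, k) R) a b (i, k) →
      Intersect n (insert (i, k) R) a b (l, k') →
      k < k' →
      InsertFrom n ((insert (i, k) R).erase (l, k')) k' (Set.Ioi l) U →
      InsertFrom n R k J U

/-- `R ← k = U`, the insertion of the number `k` into `R`. -/
def Insert (n : ℕ) (R : Finset (ℤ × ℤ)) (k : ℕ) (U : Finset (ℤ × ℤ)) : Prop :=
  InsertFrom n R k Set.univ U

/-- `R ← v = U`, where the letters of the word `v` are inserted one by one. -/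
def InsertWord (n : ℕ) : Finset (ℤ × ℤ) → List ℕ → Finset (ℤ × ℤ) → Prop
  | R, [], U => R = U
  | R, k :: v, U => ∃ R', Insert n R k R' ∧ InsertWord n R' v U

/-- The pairs `(R, Y)` of an rc-graph `R` with `w_R = w` and a Young tableau `Y` of shape `μ` such
that `R ← Y = U`. -/
def insertionPairs (n : ℕ) (w : Equiv.Perm ℤ) (μ : YoungDiagram) (U : Finset (ℤ × ℤ)) :
    Set (Finset (ℤ × ℤ) × SemistandardYoungTableau μ) :=
  {P | P.1 ∈ graphs n w ∧ P.2 ∈ tableaux n μ ∧ InsertWord n P.1 (word P.2) U}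

/-! ### Expansions and chains -/

/-- `S_w S_μ = ∑_u c^u S_u`, a (finite) expansion in Schubert polynomials. -/
def IsExpansion (n : ℕ) (w : Equiv.Perm ℤ) (μ : YoungDiagram) (c : FinPerm n →₀ ℤ) : Prop :=
  schubert n w * schur n μ = c.sum fun u a => MvPolynomial.C a * schubert n u.1

/-- `w s_{c_1,d_1} ⋯ s_{c_r,d_r}`, the product of `w` with the first `r` transpositions. -/
def chainPerm {m : ℕ} (w : Equiv.Perm ℤ) (c d : Fin m → ℤ) (r : ℕ) : Equiv.Perm ℤ :=
  w * ((List.ofFn fun j => Equiv.swap (c j) (d j)).take r).prod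

/-- The sequences `(c_1, d_1), …, (c_m, d_m)` with `n ≥ c_j > 0 ≥ d_j` and `d_1 > ⋯ > d_m` for which
each of the transpositions increases the length by one. -/
def chains (n m : ℕ) (w : Equiv.Perm ℤ) : Set ((Fin m → ℤ) × (Fin m → ℤ)) :=
  {s | (∀ j, 0 < s.1 j ∧ s.1 j ≤ n ∧ s.2 j ≤ 0) ∧ StrictAnti s.2 ∧
    ∀ r ≤ m, length n (chainPerm w s.1 s.2 r) = length n w + r}

end RCGraph

namespace RCGraph

/-! ### Passing through a row -/

/-! Each strand is recorded by the column in which it enters each row (`col`). Far below all places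
the strands are ordered by their labels, and two of them exchange order exactly where they
intersect. So a set of places is an rc-graph iff a pair that has crossed never uncrosses
(`isRC_iff`). Every inversion of `w_R` needs a place of its own, so `R` has at least as many places
as inversions, with equality iff `R` is an rc-graph. Since inversions count the length, reducedness
can be tested by counting.

Putting in a place where strands `a` and `b` meet exchanges their continuations above it, i.e.
multiplies the permutation by `s_{a,b}` on the right (`Toggle.col_gt`). In an insertion `a > 0 ≥ b`.
If `a` and `b` never cross, the result is an rc-graph of a cover `w s_{a,b}` (`Meet.red_insert`,
`final_cover`). Otherwise they cross in a higher row. Removing that crossing restores both the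
permutation and the number of places, so the set stays reduced (`Bump.red_iff`) and the process goes
on in a higher row until it stops. The states determine their predecessors (`Reach.unique`), and
from every open space one can go back to a start (`exists_reach`). Hence inserting one number is a
bijection from the pairs `(R, k)` with `w_R = w` onto the rc-graphs of all covers `w s_{c,d}`, taken
together with the cover. Iteration matches words with chains of covers.

When `w` increases on the nonpositive integers, strands with nonpositive labels never cross.
Comparing a second insertion with the trail left by the first gives the row bumping lemma
(`Insertion.le_iff`): `k ≤ k'` iff `d' < d`. Thus weakly increasing words, the one-row tableaux,
match chains with decreasing `d_j`. Insertion multiplies monomials, which gives Pieri's formula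
(`schubert_mul_schur`); fixing the resulting rc-graph `U` identifies the coefficient
(`ncard_insertionPairs`).

Uniqueness of the expansion is a triangularity argument (`schubert_independent`): the left-justified
rc-graph of `u` has the largest possible number of places below every row. -/

theorem exists_notMem_row (R : Finset (ℤ × ℤ)) (k c : ℤ) : ∃ m : ℕ, (c - 1 - m, k) ∉ R := by
  by_contra! h
  exact Set.infinite_of_injective_forall_mem (f := fun m : ℕ => ((c - 1 - m, k) : ℤ × ℤ))
    (fun a b hab => by simpa using hab) h R.finite_toSet

theorem exists_notMem_row_left (R : Finset (ℤ × ℤ)) (k c : ℤ) : ∃ m : ℕ, (c + 1 + m, k) ∉ R := by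
  by_contra! h
  exact Set.infinite_of_injective_forall_mem (f := fun m : ℕ => ((c + 1 + m, k) : ℤ × ℤ))
    (fun a b hab => by simpa using hab) h R.finite_toSet

/-- The column in which a strand entering row `k` through the bottom of column `c` leaves it. -/
noncomputable def exitCol (R : Finset (ℤ × ℤ)) (k c : ℤ) : ℤ :=
  open Classical in if (c, k) ∈ R then c else c - 1 - Nat.find (exists_notMem_row R k c)

theorem exitCol_of_mem {R : Finset (ℤ × ℤ)} {k c : ℤ} (h : (c, k) ∈ R) : exitCol R k c = c := by
  simp [exitCol, h]

theorem exitCol_lt {R : Finset (ℤ × ℤ)} {k c : ℤ} (h : (c, k) ∉ R) : exitCol R k c < c := by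
  simp only [exitCol, h, if_false]
  omega

theorem exitCol_notMem {R : Finset (ℤ × ℤ)} {k c : ℤ} (h : (c, k) ∉ R) :
    (exitCol R k c, k) ∉ R := by
  classical
  simp only [exitCol, h, if_false]
  convert Nat.find_spec (exists_notMem_row R k c)

theorem exitCol_between {R : Finset (ℤ × ℤ)} {k c x : ℤ} (h : exitCol R k c < x) (hx : x < c) :
    (x, k) ∈ R := by
  classical
  by_cases hc : (c, k) ∈ R
  · rw [exitCol_of_mem hc] at h
    omega
  · simp only [exitCol, hc, if_false] at h
    have := Nat.find_min (exists_notMem_row R k c) (m := (c - 1 - x).toNat) (by omega)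
    rw [not_not] at this
    convert this using 2
    omega

theorem exitCol_le (R : Finset (ℤ × ℤ)) (k c : ℤ) : exitCol R k c ≤ c := by
  by_cases h : (c, k) ∈ R
  · exact (exitCol_of_mem h).le
  · exact (exitCol_lt h).le

theorem exitCol_eq_of {R : Finset (ℤ × ℤ)} {k c d : ℤ} (hc : (c, k) ∉ R) (hd : (d, k) ∉ R)
    (hdc : d < c) (h : ∀ x, d < x → x < c → (x, k) ∈ R) : exitCol R k c = d := by
  rcases lt_trichotomy (exitCol R k c) d with h1 | h1 | h1
  · exact absurd (exitCol_between h1 hdc) hd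
  · exact h1
  · exact absurd (h _ h1 (exitCol_lt hc)) (exitCol_notMem hc)

theorem mem_of_exitCol_eq {R : Finset (ℤ × ℤ)} {k c : ℤ} (h : exitCol R k c = c) : (c, k) ∈ R := by
  by_contra hc
  exact absurd (exitCol_lt hc) (by omega)

theorem exitCol_injective (R : Finset (ℤ × ℤ)) (k : ℤ) : Function.Injective (exitCol R k) := by
  have key : ∀ c d, c < d → exitCol R k c ≠ exitCol R k d := by
    intro c d hcd h
    have h1 := exitCol_le R k c
    rcases h1.lt_or_eq with h2 | h2
    · have hc : (c, k) ∈ R := exitCol_between (h ▸ h2) hcd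
      rw [exitCol_of_mem hc] at h2
      omega
    · have hc := mem_of_exitCol_eq h2
      by_cases hd : (d, k) ∈ R
      · rw [exitCol_of_mem hd] at h
        omega
      · have := exitCol_notMem hd
        rw [← h, h2] at this
        exact this hc
  intro c d h
  rcases lt_trichotomy c d with h1 | h1 | h1
  · exact absurd h (key _ _ h1)
  · exact h1
  · exact absurd h.symm (key _ _ h1)

/-- The witness is the nearest empty place to the left of `c`. The strand entering below it turns
right and can turn up only at an empty place, hence not before reaching `c`. -/
theorem exists_left_source (R : Finset (ℤ × ℤ)) (k c : ℤ) :
    ∃ d, c < d ∧ exitCol R k d ≤ c ∧ (d, k) ∉ R := by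
  classical
  let m := Nat.find (exists_notMem_row_left R k c)
  have hm : (c + 1 + m, k) ∉ R := Nat.find_spec (exists_notMem_row_left R k c)
  refine ⟨c + 1 + m, by omega, ?_, hm⟩
  by_contra! hlt
  have h1 := exitCol_lt hm
  have := Nat.find_min (exists_notMem_row_left R k c)
    (m := (exitCol R k (c + 1 + m) - c - 1).toNat) (by omega)
  rw [not_not] at this
  apply exitCol_notMem hm
  convert this using 2
  omega

theorem exitCol_surjective (R : Finset (ℤ × ℤ)) (k : ℤ) : Function.Surjective (exitCol R k) := by
  intro c
  by_cases hc : (c, k) ∈ R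
  · exact ⟨c, exitCol_of_mem hc⟩
  · obtain ⟨d, h1, h2, h3⟩ := exists_left_source R k c
    refine ⟨d, ?_⟩
    rcases h2.lt_or_eq with h4 | h4
    · exact absurd (exitCol_between h4 h1) hc
    · exact h4

/-! ### The columns of a strand -/

/-- All places of `R` lie in the table. -/
def InTable (n : ℕ) (R : Finset (ℤ × ℤ)) : Prop :=
  ∀ p ∈ R, p.1 ≤ (n : ℤ) ∧ p.2 ≤ (n : ℤ)

/-- The column after `t` rows of the strand labeled `a`. -/
noncomputable def colAux (n : ℕ) (R : Finset (ℤ × ℤ)) (a : ℤ) : ℕ → ℤ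
  | 0 => n + 1
  | t + 1 => exitCol R (a + t) (colAux n R a t)

/-- The column in which the strand labeled `a` enters row `k` through the bottom. Strands which
have not yet started are continued to the left of the table without intersections. -/
noncomputable def col (n : ℕ) (R : Finset (ℤ × ℤ)) (k a : ℤ) : ℤ :=
  if a ≤ k then colAux n R a (k - a).toNat else n + 1 + a - k

variable {n : ℕ} {R : Finset (ℤ × ℤ)}

theorem col_of_le {k a : ℤ} (h : k ≤ a) : col n R k a = n + 1 + a - k := by
  rcases h.lt_or_eq with h | rfl
  · simp [col, h.not_ge]
  · simp [col, colAux]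

theorem exitCol_of_gt (hR : InTable n R) {k c : ℤ} (h : (n : ℤ) + 1 < c) :
    exitCol R k c = c - 1 := by
  apply exitCol_eq_of
  · intro h1
    have := (hR _ h1).1
    simp only at this
    omega
  · intro h1
    have := (hR _ h1).1
    simp only at this
    omega
  · omega
  · omega

theorem col_succ (hR : InTable n R) (k a : ℤ) : col n R (k + 1) a = exitCol R k (col n R k a) := by
  by_cases h : a ≤ k
  · have h1 : (k + 1 - a).toNat = (k - a).toNat + 1 := by omega
    have h2 : a + ((k - a).toNat : ℤ) = k := by omega
    simp only [col, h, if_true, show a ≤ k + 1 by omega, h1, colAux, h2]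
  · rw [col_of_le (show k + 1 ≤ a by omega), col_of_le (show k ≤ a by omega), exitCol_of_gt hR]
    · omega
    · omega

theorem col_succ_le (hR : InTable n R) (k a : ℤ) : col n R (k + 1) a ≤ col n R k a := by
  rw [col_succ hR]
  exact exitCol_le _ _ _

theorem col_antitone (hR : InTable n R) (a : ℤ) {k l : ℤ} (h : k ≤ l) :
    col n R l a ≤ col n R k a := by
  induction l, h using Int.leInduction with
  | base => exact le_rfl
  | succ l hl ih => exact (col_succ_le hR l a).trans ih

theorem col_succ_eq_iff (hR : InTable n R) {k a : ℤ} :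
    col n R (k + 1) a = col n R k a ↔ (col n R k a, k) ∈ R := by
  rw [col_succ hR]
  exact ⟨mem_of_exitCol_eq, exitCol_of_mem⟩

theorem col_between (hR : InTable n R) {k a x : ℤ} (h : col n R (k + 1) a < x)
    (hx : x < col n R k a) : (x, k) ∈ R := by
  rw [col_succ hR] at h
  exact exitCol_between h hx

theorem col_succ_notMem (hR : InTable n R) {k a : ℤ} (h : col n R (k + 1) a < col n R k a) :
    (col n R (k + 1) a, k) ∉ R := by
  rw [col_succ hR] at h ⊢
  apply exitCol_notMem
  intro h1
  rw [exitCol_of_mem h1] at h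
  omega

/-- This separates the strands inside the table from those still on the artificial diagonal to its
left, whose columns exceed `n`. -/
theorem col_le_iff (hR : InTable n R) {k a : ℤ} : col n R k a ≤ n ↔ a < k := by
  constructor
  · intro h
    by_contra! h1
    rw [col_of_le h1] at h
    omega
  · intro h
    have h1 : (col n R a a, a) ∉ R := by
      intro h2
      have := (hR _ h2).1
      rw [col_of_le le_rfl] at this
      simp only at this
      omega
    have h2 : col n R (a + 1) a < n + 1 := by
      rw [col_succ hR]
      refine (exitCol_lt h1).trans_le ?_
      rw [col_of_le le_rfl]
      omega
    have := col_antitone (n := n) hR a (show a + 1 ≤ k by omega)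
    omega

theorem exists_row_bound (R : Finset (ℤ × ℤ)) : ∃ K : ℤ, ∀ p ∈ R, K ≤ p.2 := by
  obtain ⟨K, hK⟩ := (R.image Prod.snd).bddBelow
  exact ⟨K, fun p hp => hK (by simpa using ⟨p.1, hp⟩)⟩

theorem exists_col_bound (R : Finset (ℤ × ℤ)) : ∃ K : ℤ, ∀ p ∈ R, K ≤ p.1 := by
  obtain ⟨K, hK⟩ := (R.image Prod.fst).bddBelow
  exact ⟨K, fun p hp => hK (by simpa using ⟨p.2, hp⟩)⟩

theorem exitCol_of_no_row {k c : ℤ} (h : ∀ x ≤ c, (x, k) ∉ R) : exitCol R k c = c - 1 :=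
  exitCol_eq_of (h _ le_rfl) (h _ (by omega)) (by omega) (by omega)

theorem col_low (hR : InTable n R) {K : ℤ} (hK : ∀ p ∈ R, K ≤ p.2) {k : ℤ} (hk : k ≤ K) (a : ℤ) :
    col n R k a = n + 1 + a - k := by
  by_cases h : k ≤ a
  · exact col_of_le h
  · push Not at h
    obtain ⟨l, hl⟩ : ∃ l, l = k := ⟨k, rfl⟩
    rw [← hl] at h hk ⊢
    clear hl
    replace h := h.le
    induction l, h using Int.leInduction with
    | base => exact col_of_le le_rfl
    | succ l hl ih =>
      rw [col_succ hR, exitCol_of_no_row, ih (by omega)]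
      · omega
      · intro x hx h2
        have := hK _ h2
        simp only at this
        omega

/-- Below all places the column is an affine function of the label, and each further row composes it
with the bijection `exitCol`. Continuing the strands outside the table is what makes this a
bijection of all of `ℤ`. -/
theorem col_bijective (hR : InTable n R) (k : ℤ) : Function.Bijective (col n R k) := by
  obtain ⟨K, hK⟩ := exists_row_bound R
  have low : ∀ l ≤ K, Function.Bijective (col n R l) := by
    intro l hl
    have : col n R l = fun a => n + 1 + a - l := funext fun a => col_low hR hK hl a
    rw [this]
    exact ⟨fun a b h => by simpa using h, fun c => ⟨c - n - 1 + l, by ring⟩⟩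
  rcases le_total k K with h | h
  · exact low k h
  · induction k, h using Int.leInduction with
    | base => exact low K le_rfl
    | succ k hk ih =>
      have : col n R (k + 1) = exitCol R k ∘ col n R k := funext fun a => col_succ hR k a
      rw [this]
      exact Function.Bijective.comp ⟨exitCol_injective R k, exitCol_surjective R k⟩ ih

theorem col_inj (hR : InTable n R) {k a b : ℤ} : col n R k a = col n R k b ↔ a = b :=
  (col_bijective hR k).1.eq_iff

theorem exists_left (hR : InTable n R) (k c : ℤ) :
    ∃ a, col n R (k + 1) a ≤ c ∧ c < col n R k a := by
  obtain ⟨d, h1, h2, -⟩ := exists_left_source R k c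
  obtain ⟨a, rfl⟩ := (col_bijective hR k).2 d
  exact ⟨a, by rwa [col_succ hR], h1⟩

/-- If one of the two strands entered further to the right, it would enter below a place that the
other passes from left to right. That place is in `R`, so the first strand would go straight up
instead of right. -/
theorem left_unique (hR : InTable n R) {k c a b : ℤ} (ha : col n R (k + 1) a ≤ c)
    (ha' : c < col n R k a) (hb : col n R (k + 1) b ≤ c) (hb' : c < col n R k b) : a = b := by
  have key : ∀ a b, col n R (k + 1) a ≤ c → c < col n R k a → col n R (k + 1) b ≤ c →
      ¬ col n R k a < col n R k b := by
    intro a b ha ha' hb h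
    have := (col_succ_eq_iff hR).2 (col_between hR (show col n R (k + 1) b < col n R k a by omega) h)
    omega
  have h1 := key a b ha ha' hb
  have h2 := key b a hb hb' ha
  exact (col_inj hR).1 (by omega : col n R k a = col n R k b)

/-! ### Strands in terms of their columns -/

theorem Strand.bounds {a : ℤ} {s : Side} {i k : ℤ} (h : Strand n R a s i k) :
    i ≤ n ∧ a ≤ k ∧ (s = Side.left → k ≤ n) ∧ (s = Side.bottom → a < k ∧ k ≤ n + 1) := by
  induction h with
  | start h => simp [h]
  | leftTop h _ ih => simp at ih ⊢; omega
  | bottomRight h _ _ ih => simp at ih ⊢; omega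
  | leftRight h _ ih => simp at ih ⊢; omega
  | bottomTop h _ _ ih => simp at ih ⊢; omega

theorem Strand.col (hR : InTable n R) {a : ℤ} {s : Side} {i k : ℤ} (h : Strand n R a s i k) :
    (s = Side.left → RCGraph.col n R (k + 1) a ≤ i ∧ i < RCGraph.col n R k a) ∧
      (s = Side.bottom → RCGraph.col n R k a = i) := by
  induction h with
  | start h =>
    refine ⟨fun _ => ⟨(col_le_iff hR).2 (by omega), ?_⟩, by simp⟩
    rw [col_of_le le_rfl]
    omega
  | leftTop h hi ih =>
    refine ⟨by simp, fun _ => ?_⟩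
    obtain ⟨h1, h2⟩ := ih.1 rfl
    rcases h1.lt_or_eq with h3 | h3
    · exact absurd (col_between hR h3 h2) hi
    · exact h3
  | bottomRight h _ hi ih =>
    refine ⟨fun _ => ?_, by simp⟩
    have h1 := ih.2 rfl
    subst h1
    rw [col_succ hR]
    have := exitCol_lt hi
    omega
  | @leftRight i k h hi ih =>
    refine ⟨fun _ => ?_, by simp⟩
    obtain ⟨h1, h2⟩ := ih.1 rfl
    have : RCGraph.col n R (k + 1) a ≠ i := by
      intro h3
      exact col_succ_notMem hR (show _ < RCGraph.col n R k a by omega) (h3 ▸ hi)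
    omega
  | bottomTop h _ hi ih =>
    refine ⟨by simp, fun _ => ?_⟩
    have h1 := ih.2 rfl
    subst h1
    exact (col_succ_eq_iff hR).2 hi

theorem strand_left_of_row {a k c d : ℤ} (h : Strand n R a Side.left c k) (hdc : d ≤ c)
    (hd : ∀ x, d < x → x ≤ c → (x, k) ∈ R) : Strand n R a Side.left d k := by
  obtain ⟨m, hm⟩ : ∃ m : ℕ, m = (c - d).toNat := ⟨_, rfl⟩
  induction m generalizing c with
  | zero =>
    obtain rfl : c = d := by omega
    exact h
  | succ m ih =>
    exact ih (h.leftRight (hd c (by omega) le_rfl)) (by omega)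
      (fun x h1 h2 => hd x h1 (by omega)) (by omega)

theorem strand_row (hR : InTable n R) {a k c : ℤ} (hk : k ≤ n) (hak : a ≤ k)
    (h : a < k → Strand n R a Side.bottom (col n R k a) k)
    (h1 : col n R (k + 1) a ≤ c) (h2 : c < col n R k a) : Strand n R a Side.left c k := by
  have hn : (col n R k a, k) ∉ R := by
    intro h3
    have := (col_succ_eq_iff hR).2 h3
    omega
  have hst : Strand n R a Side.left (col n R k a - 1) k := by
    rcases hak.lt_or_eq with h3 | rfl
    · exact (h h3).bottomRight hk hn
    · rw [col_of_le le_rfl]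
      simpa using Strand.start hk
  exact strand_left_of_row hst (by omega) fun x h3 h4 =>
    col_between hR (a := a) (by omega) (by omega)

theorem strand_bottom_col (hR : InTable n R) {a k : ℤ} (h : a < k) (hk : k ≤ n + 1) :
    Strand n R a Side.bottom (col n R k a) k := by
  have h' : a + 1 ≤ k := h
  clear h
  have key : ∀ k, a ≤ k → k ≤ n → (a < k → Strand n R a Side.bottom (col n R k a) k) →
      Strand n R a Side.bottom (col n R (k + 1) a) (k + 1) := by
    intro k hak hk h
    rcases (col_succ_le hR k a).lt_or_eq with h1 | h1
    · exact (strand_row hR hk hak h le_rfl h1).leftTop (col_succ_notMem hR h1)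
    · have h2 := (col_succ_eq_iff hR).1 h1
      have h3 := (hR _ h2).1
      rw [h1]
      exact (h ((col_le_iff hR).1 h3)).bottomTop hk h2
  induction k, h' using Int.leInduction with
  | base => exact key a le_rfl (by omega) (by omega)
  | succ k hk' ih => exact key k (by omega) (by omega) fun _ => ih (by omega)

theorem strand_bottom_iff (hR : InTable n R) {a i k : ℤ} :
    Strand n R a Side.bottom i k ↔ i ≤ n ∧ k ≤ n + 1 ∧ col n R k a = i := by
  constructor
  · intro h
    exact ⟨h.bounds.1, (h.bounds.2.2.2 rfl).2, (h.col hR).2 rfl⟩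
  · rintro ⟨h1, h2, rfl⟩
    exact strand_bottom_col hR ((col_le_iff hR).1 h1) h2

theorem strand_left_iff (hR : InTable n R) {a i k : ℤ} :
    Strand n R a Side.left i k ↔ i ≤ n ∧ k ≤ n ∧ col n R (k + 1) a ≤ i ∧ i < col n R k a := by
  constructor
  · intro h
    exact ⟨h.bounds.1, h.bounds.2.2.1 rfl, (h.col hR).1 rfl⟩
  · rintro ⟨h1, h2, h3, h4⟩
    have : a < k + 1 := (col_le_iff hR).1 (by omega : col n R (k + 1) a ≤ n)
    exact strand_row hR h2 (by omega) (fun h => strand_bottom_col hR h (by omega)) h3 h4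

end RCGraph
namespace RCGraph
variable {n : ℕ} {R : Finset (ℤ × ℤ)}

/-! ### Intersections and reducedness -/

/-- In row `k`, the strand labeled `a`, coming from the left, intersects the strand labeled `b`. -/
def Crosses (n : ℕ) (R : Finset (ℤ × ℤ)) (k a b : ℤ) : Prop :=
  col n R k b < col n R k a ∧ col n R (k + 1) a < col n R (k + 1) b

theorem crosses_iff (hR : InTable n R) {k a b : ℤ} :
    Crosses n R k a b ↔
      (col n R k b, k) ∈ R ∧ col n R (k + 1) a ≤ col n R k b ∧ col n R k b < col n R k a := by
  constructor
  · rintro ⟨h1, h2⟩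
    have hb := col_succ_le hR k b
    refine ⟨?_, by omega, h1⟩
    by_contra hn
    have h3 : col n R (k + 1) b ≠ col n R k b := fun h => hn ((col_succ_eq_iff hR).1 h)
    exact col_succ_notMem hR (by omega) (col_between hR h2 (by omega))
  · rintro ⟨h1, h2, h3⟩
    have hb := (col_succ_eq_iff hR).2 h1
    have : col n R (k + 1) a ≠ col n R (k + 1) b := by
      rw [Ne, col_inj hR]
      rintro rfl
      omega
    exact ⟨h3, by omega⟩

theorem intersect_iff (hR : InTable n R) {a b : ℤ} {p : ℤ × ℤ} :
    Intersect n R a b p ↔ (Crosses n R p.2 a b ∧ col n R p.2 b = p.1) ∨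
      (Crosses n R p.2 b a ∧ col n R p.2 a = p.1) := by
  have key : ∀ a b, (p ∈ R ∧ Strand n R a Side.left p.1 p.2 ∧ Strand n R b Side.bottom p.1 p.2) ↔
      (Crosses n R p.2 a b ∧ col n R p.2 b = p.1) := by
    intro a b
    rw [strand_left_iff hR, strand_bottom_iff hR, crosses_iff hR]
    constructor
    · rintro ⟨h, ⟨h1, h2, h3, h4⟩, -, -, h5⟩
      exact ⟨⟨by rw [h5]; exact h, by omega, by omega⟩, h5⟩
    · rintro ⟨⟨h1, h2, h3⟩, h4⟩
      rw [h4] at h1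
      have := hR _ h1
      exact ⟨h1, ⟨this.1, this.2, by omega, by omega⟩, this.1, by have := this.2; omega, h4⟩
  rw [Intersect, and_or_left, key, key]

/-- A discrete intermediate value argument: the order of the two strands must change in some single
row. -/
theorem exists_crosses (hR : InTable n R) {k l a b : ℤ} (hkl : k ≤ l)
    (h : col n R k b < col n R k a) (h' : col n R l a < col n R l b) :
    ∃ y, k ≤ y ∧ y < l ∧ Crosses n R y a b := by
  induction l, hkl using Int.leInduction with
  | base => omega
  | succ l hl ih =>
    rcases lt_trichotomy (col n R l a) (col n R l b) with h1 | h1 | h1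
    · obtain ⟨y, h2, h3, h4⟩ := ih h1
      exact ⟨y, h2, by omega, h4⟩
    · rw [col_inj hR] at h1
      subst h1
      omega
    · exact ⟨l, hl, by omega, h1, h'⟩

theorem exists_crosses_of_lt (hR : InTable n R) {l a b : ℤ} (hab : b < a)
    (h' : col n R l a < col n R l b) : ∃ y, y < l ∧ Crosses n R y a b := by
  obtain ⟨K, hK⟩ := exists_row_bound R
  obtain ⟨y, -, h⟩ := exists_crosses hR (k := min K l) (min_le_right _ _)
    (by rw [col_low hR hK (min_le_left _ _), col_low hR hK (min_le_left _ _)]; omega) h'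
  exact ⟨y, h⟩

/-- Two strands which have intersected stay on their sides. -/
structure Red (n : ℕ) (R : Finset (ℤ × ℤ)) : Prop where
  inTable : InTable n R
  step : ∀ {k a b : ℤ}, b < a → col n R k a < col n R k b → col n R (k + 1) a < col n R (k + 1) b

theorem Red.persist (h : Red n R) {k l a b : ℤ} (hab : b < a) (hkl : k ≤ l)
    (h1 : col n R k a < col n R k b) : col n R l a < col n R l b := by
  induction l, hkl using Int.leInduction with
  | base => exact h1
  | succ l hl ih => exact h.step hab ih

theorem Red.persist' (h : Red n R) {k l a b : ℤ} (hab : b < a) (hkl : k ≤ l)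
    (h1 : col n R l b < col n R l a) : col n R k b < col n R k a := by
  by_contra h2
  have : col n R k a ≠ col n R k b := by
    rw [Ne, col_inj h.inTable]
    omega
  have := h.persist hab hkl (by omega)
  omega

theorem Red.lt_of_crosses (h : Red n R) {k a b : ℤ} (hc : Crosses n R k a b) : b < a := by
  rcases lt_trichotomy a b with h1 | rfl | h1
  · have := h.step h1 hc.1
    have := hc.2
    omega
  · exact absurd hc.1 (lt_irrefl _)
  · exact h1

theorem Red.crosses_row_unique (h : Red n R) {k l a b : ℤ} (hk : Crosses n R k a b)
    (hl : Crosses n R l a b) : k = l := by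
  have key : ∀ k l, Crosses n R k a b → Crosses n R l a b → ¬ k < l := by
    intro k l hk hl hkl
    have := h.persist (h.lt_of_crosses hk) (show k + 1 ≤ l by omega) hk.2
    have := hl.1
    omega
  have h1 := key k l hk hl
  have h2 := key l k hl hk
  omega

/-- Strands start in the order of their labels, so a pair that uncrosses must have crossed before
and intersects twice. Conversely, if no pair uncrosses, the larger label always comes from the left,
and a second crossing would need an uncrossing in between. -/
theorem isRC_iff : IsRC n R ↔ Red n R := by
  constructor
  · rintro ⟨hR, h⟩
    replace hR : InTable n R := hR
    refine ⟨hR, fun {k a b} hab h1 => ?_⟩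
    by_contra h2
    have h3 : col n R (k + 1) a ≠ col n R (k + 1) b := by
      rw [Ne, col_inj hR]
      omega
    obtain ⟨y, hy, hc⟩ := exists_crosses_of_lt hR hab h1
    have := h a b (col n R k a, k) (col n R y b, y)
      ((intersect_iff hR).2 (Or.inr ⟨⟨h1, by simp only; omega⟩, rfl⟩))
      ((intersect_iff hR).2 (Or.inl ⟨hc, rfl⟩))
    simp only [Prod.mk.injEq] at this
    omega
  · intro h
    refine ⟨h.inTable, fun a b p q hp hq => ?_⟩
    rw [intersect_iff h.inTable] at hp hq
    rcases hp with ⟨hp, hp'⟩ | ⟨hp, hp'⟩ <;> rcases hq with ⟨hq, hq'⟩ | ⟨hq, hq'⟩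
    · have := h.crosses_row_unique hp hq
      exact Prod.ext (by rw [← hp', ← hq', this]) this
    · have h1 := h.lt_of_crosses hp
      have h2 := h.lt_of_crosses hq
      omega
    · have h1 := h.lt_of_crosses hp
      have h2 := h.lt_of_crosses hq
      omega
    · have := h.crosses_row_unique hp hq
      exact Prod.ext (by rw [← hp', ← hq', this]) this

/-! ### The permutation of a set of places -/

theorem hasPerm_iff (hR : InTable n R) {w : Equiv.Perm ℤ} :
    HasPerm n R w ↔ ∀ a, col n R (n + 1) a = w a := by
  constructor
  · rintro ⟨h1, h2⟩ a
    rcases le_or_gt a n with h | h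
    · exact ((strand_bottom_iff hR).1 (h1 a h)).2.2
    · rw [h2 a h, col_of_le (by omega)]
      ring
  · intro h
    refine ⟨fun a ha => ?_, fun a ha => ?_⟩
    · rw [← h a]
      exact strand_bottom_col hR (by omega) (by omega)
    · rw [← h a, col_of_le (by omega)]
      ring

theorem exists_hasPerm (hR : InTable n R) : ∃ w : Equiv.Perm ℤ, HasPerm n R w :=
  ⟨Equiv.ofBijective _ (col_bijective hR (n + 1)), (hasPerm_iff hR).2 fun _ => rfl⟩

theorem HasPerm.unique (hR : InTable n R) {w w' : Equiv.Perm ℤ} (h : HasPerm n R w)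
    (h' : HasPerm n R w') : w = w' := by
  rw [hasPerm_iff hR] at h h'
  ext a
  rw [← h, ← h']

/-- `w` fixes the integers greater than `n` and all sufficiently negative integers. -/
def IsFinPerm (n : ℕ) (w : Equiv.Perm ℤ) : Prop :=
  (∀ i : ℤ, (n : ℤ) < i → w i = i) ∧ ∃ N : ℤ, ∀ i : ℤ, i < N → w i = i

theorem HasPerm.isFinPerm (hR : InTable n R) {w : Equiv.Perm ℤ} (h : HasPerm n R w) :
    IsFinPerm n w := by
  refine ⟨h.2, ?_⟩
  rw [hasPerm_iff hR] at h
  obtain ⟨K, hK⟩ := exists_row_bound R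
  obtain ⟨C, hC⟩ := exists_col_bound R
  -- With this bound a strand is already to the right of all places when it reaches row `min K 0`.
  -- It then moves one column to the right in every row.
  refine ⟨C - n - 1 + min K 0, fun a ha => ?_⟩
  rw [← h]
  have key : ∀ k, min K 0 ≤ k → col n R k a = n + 1 + a - k := by
    intro k hk
    induction k, hk using Int.leInduction with
    | base => exact col_low hR hK (by omega) a
    | succ k hk ih =>
      rw [col_succ hR, exitCol_of_no_row, ih]
      · omega
      · intro x hx h1
        have := hC _ h1
        simp only at this
        omega
  rw [key _ (by omega)]
  ring

/-! ### Inversions -/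

/-- The inversions of `w`. -/
def invSet (w : Equiv.Perm ℤ) : Set (ℤ × ℤ) :=
  {p | p.2 < p.1 ∧ w p.1 < w p.2}

theorem apply_le_iff {w : Equiv.Perm ℤ} (hw : IsFinPerm n w) {i : ℤ} : w i ≤ n ↔ i ≤ n := by
  constructor
  · intro h
    by_contra! h1
    rw [hw.1 i h1] at h
    omega
  · intro h
    by_contra! h1
    have := w.injective (hw.1 _ h1)
    omega

theorem le_apply_iff {w : Equiv.Perm ℤ} {N i : ℤ} (hN : ∀ i < N, w i = i) : N ≤ w i ↔ N ≤ i := by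
  constructor
  · intro h
    by_contra! h1
    rw [hN i h1] at h
    omega
  · intro h
    by_contra! h1
    have := w.injective (hN _ h1)
    omega

theorem invSet_subset {w : Equiv.Perm ℤ} (hw : IsFinPerm n w) {N : ℤ} (hN : ∀ i < N, w i = i) :
    invSet w ⊆ Set.Icc N n ×ˢ Set.Icc N n := by
  rintro ⟨a, b⟩ ⟨h1, h2⟩
  simp only at h1 h2
  have ha := apply_le_iff hw (i := a)
  have hb := apply_le_iff hw (i := b)
  have ha' := le_apply_iff hN (i := a)
  have hb' := le_apply_iff hN (i := b)
  have h3 := hN b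
  have h5 := hN a
  have h6 := hw.1 b
  have h4 := hw.1 a
  simp only [Set.mem_prod, Set.mem_Icc]
  omega

theorem invSet_finite {w : Equiv.Perm ℤ} (hw : IsFinPerm n w) : (invSet w).Finite := by
  obtain ⟨N, hN⟩ := hw.2
  exact ((Set.finite_Icc N n).prod (Set.finite_Icc N n)).subset (invSet_subset hw hN)

theorem exists_crosses_of_inv (hR : InTable n R) {w : Equiv.Perm ℤ} (hw : HasPerm n R w)
    {p : ℤ × ℤ} (hp : p ∈ invSet w) : ∃ k, Crosses n R k p.1 p.2 := by
  rw [hasPerm_iff hR] at hw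
  obtain ⟨h1, h2⟩ := hp
  rw [← hw, ← hw] at h2
  obtain ⟨y, -, h⟩ := exists_crosses_of_lt hR h1 h2
  exact ⟨y, h⟩

theorem crosses_eq_of_place (hR : InTable n R) {k a b a' b' : ℤ} (h : Crosses n R k a b)
    (h' : Crosses n R k a' b') (hb : col n R k b = col n R k b') : a = a' ∧ b = b' := by
  rw [crosses_iff hR] at h h'
  exact ⟨left_unique hR h.2.1 h.2.2 (hb ▸ h'.2.1) (hb ▸ h'.2.2), (col_inj hR).1 hb⟩

theorem exists_crosses_of_mem (hR : InTable n R) {p : ℤ × ℤ} (hp : p ∈ R) :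
    ∃ a b, Crosses n R p.2 a b ∧ col n R p.2 b = p.1 := by
  obtain ⟨b, hb⟩ := (col_bijective hR p.2).2 p.1
  obtain ⟨a, ha, ha'⟩ := exists_left hR p.2 p.1
  exact ⟨a, b, (crosses_iff hR).2 ⟨by rw [hb]; exact hp, by rwa [hb], by rwa [hb]⟩, hb⟩

/-- An inverted pair must cross somewhere, and a place determines the two strands which intersect
there, so choosing one crossing for each inversion is injective. -/
theorem exists_inv_injection (hR : InTable n R) {w : Equiv.Perm ℤ} (hw : HasPerm n R w) :
    ∃ f : ℤ × ℤ → ℤ × ℤ, Set.MapsTo f (invSet w) R ∧ Set.InjOn f (invSet w) ∧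
      ∀ p ∈ invSet w, Crosses n R (f p).2 p.1 p.2 ∧ col n R (f p).2 p.2 = (f p).1 := by
  classical
  have h : ∀ p : ℤ × ℤ, ∃ k, p ∈ invSet w → Crosses n R k p.1 p.2 := by
    intro p
    by_cases hp : p ∈ invSet w
    · obtain ⟨k, hk⟩ := exists_crosses_of_inv hR hw hp
      exact ⟨k, fun _ => hk⟩
    · exact ⟨0, fun h => absurd h hp⟩
  choose k hk using h
  refine ⟨fun p => (col n R (k p) p.2, k p), ?_, ?_, fun p hp => ⟨hk p hp, rfl⟩⟩
  · intro p hp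
    exact ((crosses_iff hR).1 (hk p hp)).1
  · intro p hp q hq hpq
    simp only [Prod.mk.injEq] at hpq
    obtain ⟨h1, h2⟩ := hpq
    have h3 := hk p hp
    have h4 := hk q hq
    rw [h2] at h3 h1
    obtain ⟨h5, h6⟩ := crosses_eq_of_place hR h3 h4 h1
    exact Prod.ext h5 h6

/-! ### Reducedness by counting places against inversions -/

theorem inv_le_card (hR : InTable n R) {w : Equiv.Perm ℤ} (hw : HasPerm n R w) :
    (invSet w).ncard ≤ R.card := by
  obtain ⟨f, h1, h2, -⟩ := exists_inv_injection hR hw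
  rw [← Set.ncard_coe_finset]
  exact Set.ncard_le_ncard_of_injOn f h1 h2 R.finite_toSet

/-- By the count, every place is the chosen crossing of some inversion, in which the larger label
comes from the left. At an uncrossing the smaller label comes from the left, so there is none. -/
theorem red_of_card_le (hR : InTable n R) {w : Equiv.Perm ℤ} (hw : HasPerm n R w)
    (h : R.card ≤ (invSet w).ncard) : Red n R := by
  obtain ⟨f, h1, h2, h3⟩ := exists_inv_injection hR hw
  refine ⟨hR, fun {k a b} hab hlt => ?_⟩
  by_contra hn
  have hne : col n R (k + 1) a ≠ col n R (k + 1) b := by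
    rw [Ne, col_inj hR]
    omega
  have hc : Crosses n R k b a := ⟨hlt, by omega⟩
  have hmem := ((crosses_iff hR).1 hc).1
  have hsurj : f '' invSet w = R := by
    apply Set.eq_of_subset_of_ncard_le h1.image_subset _ R.finite_toSet
    rwa [h2.ncard_image, Set.ncard_coe_finset]
  obtain ⟨p, hp, hfp⟩ : (col n R k a, k) ∈ f '' invSet w := by
    rw [hsurj]
    exact hmem
  obtain ⟨h4, h5⟩ := h3 p hp
  rw [hfp] at h4 h5
  obtain ⟨h6, h7⟩ := crosses_eq_of_place hR h4 hc h5
  have := hp.1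
  omega

theorem Red.card_eq (h : Red n R) {w : Equiv.Perm ℤ} (hw : HasPerm n R w) :
    R.card = (invSet w).ncard := by
  apply le_antisymm _ (inv_le_card h.inTable hw)
  have hx := fun p : R => exists_crosses_of_mem h.inTable p.2
  choose f g hfg hg using hx
  classical
  have hw' := (hasPerm_iff h.inTable).1 hw
  rw [← Set.ncard_coe_finset]
  refine Set.ncard_le_ncard_of_injOn
    (fun p => if hp : p ∈ R then (f ⟨p, hp⟩, g ⟨p, hp⟩) else p) ?_ ?_
    (invSet_finite (hw.isFinPerm h.inTable))
  · intro p hp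
    replace hp : p ∈ R := hp
    simp only [hp, dif_pos]
    have h1 := hfg ⟨p, hp⟩
    have h2 := h.lt_of_crosses h1
    refine ⟨h2, ?_⟩
    simp only
    rw [← hw', ← hw']
    exact h.persist h2 (by have := (h.inTable p hp).2; simp only; omega) h1.2
  · intro p hp q hq hpq
    replace hp : p ∈ R := hp
    replace hq : q ∈ R := hq
    simp only [hp, hq, dif_pos, Prod.mk.injEq] at hpq
    have h1 := hfg ⟨p, hp⟩
    have h2 := hfg ⟨q, hq⟩
    rw [hpq.1, hpq.2] at h1
    have h3 := h.crosses_row_unique h1 h2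
    have h4 := hg ⟨p, hp⟩
    have h5 := hg ⟨q, hq⟩
    simp only at h3 h4 h5
    exact Prod.ext (by rw [← h4, ← h5, hpq.2, h3]) h3

end RCGraph
namespace RCGraph
variable {n : ℕ} {R R' : Finset (ℤ × ℤ)}

/-! ### Length -/

theorem isFinPerm_one : IsFinPerm n 1 := ⟨fun _ _ => rfl, 0, fun _ _ => rfl⟩

theorem IsFinPerm.mul {w v : Equiv.Perm ℤ} (hw : IsFinPerm n w) (hv : IsFinPerm n v) :
    IsFinPerm n (w * v) := by
  obtain ⟨hw1, N, hN⟩ := hw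
  obtain ⟨hv1, M, hM⟩ := hv
  refine ⟨fun i hi => ?_, min N M, fun i hi => ?_⟩
  · rw [Equiv.Perm.mul_apply, hv1 i hi, hw1 i hi]
  · rw [Equiv.Perm.mul_apply, hM i (by omega), hN i (by omega)]

theorem isFinPerm_swap {c d : ℤ} (hc : c ≤ n) (hd : d ≤ n) : IsFinPerm n (Equiv.swap c d) :=
  ⟨fun i hi => Equiv.swap_apply_of_ne_of_ne (by omega) (by omega), min c d,
    fun i hi => Equiv.swap_apply_of_ne_of_ne (by omega) (by omega)⟩

theorem swap_succ_lt {i x y : ℤ} (h : x < y) (hn : ¬ (x = i ∧ y = i + 1)) :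
    Equiv.swap i (i + 1) x < Equiv.swap i (i + 1) y := by
  simp only [Equiv.swap_apply_def]
  split_ifs <;> omega

/-- Exchanging the values `i` and `i + 1` changes the relative order of no other pair of values. -/
theorem invSet_swap_mul_subset (w : Equiv.Perm ℤ) (i : ℤ) :
    invSet (Equiv.swap i (i + 1) * w) ⊆ insert (w.symm (i + 1), w.symm i) (invSet w) := by
  rintro ⟨a, b⟩ ⟨h1, h2⟩
  simp only [Equiv.Perm.mul_apply] at h1 h2
  by_cases h : w a < w b
  · exact Or.inr ⟨h1, h⟩
  · left
    have hne : w a ≠ w b := w.injective.ne h1.ne'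
    by_contra h3
    have := swap_succ_lt (i := i) (show w b < w a by omega) (by
      rintro ⟨h4, h5⟩
      apply h3
      rw [← h5, ← h4]
      simp)
    omega

theorem inv_prod_le (l : List ℤ) (hl : ∀ i ∈ l, i < (n : ℤ)) :
    IsFinPerm n (l.map fun i => Equiv.swap i (i + 1)).prod ∧
      (invSet (l.map fun i => Equiv.swap i (i + 1)).prod).ncard ≤ l.length := by
  induction l with
  | nil =>
    refine ⟨isFinPerm_one, ?_⟩
    have : invSet (1 : Equiv.Perm ℤ) = ∅ := by
      ext p
      simp only [invSet, Equiv.Perm.one_apply, Set.mem_ofPred_eq, Set.mem_empty_iff_false, iff_false]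
      omega
    simp [this]
  | cons i l ih =>
    obtain ⟨h1, h2⟩ := ih fun j hj => hl j (by simp [hj])
    have hi := hl i (by simp)
    simp only [List.map_cons, List.prod_cons, List.length_cons]
    refine ⟨(isFinPerm_swap (by omega) (by omega)).mul h1, ?_⟩
    refine (Set.ncard_le_ncard (invSet_swap_mul_subset _ i)
      ((invSet_finite h1).insert _)).trans ((Set.ncard_insert_le _ _).trans (by omega))

theorem IsFinPerm.symm {w : Equiv.Perm ℤ} (hw : IsFinPerm n w) : IsFinPerm n w.symm := by
  obtain ⟨hw1, N, hN⟩ := hw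
  exact ⟨fun i hi => by rw [Equiv.symm_apply_eq, hw1 i hi],
    N, fun i hi => by rw [Equiv.symm_apply_eq, hN i hi]⟩

theorem eq_one_of_increasing {w : Equiv.Perm ℤ} (hw : IsFinPerm n w)
    (h : ∀ i < (n : ℤ), w i < w (i + 1)) : w = 1 := by
  obtain ⟨hw1, N, hN⟩ := hw
  have lower : ∀ i, min N n - 1 ≤ i → i ≤ n → i ≤ w i := by
    intro i hi
    induction i, hi using Int.leInduction with
    | base => intro _; rw [hN _ (by omega)]
    | succ i hi ih =>
      intro hin
      have := h i (by omega)
      have := ih (by omega)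
      omega
  have upper : ∀ i, i ≤ (n : ℤ) → w i ≤ i := by
    intro i hi
    induction i, hi using Int.leInductionDown with
    | base => exact (apply_le_iff ⟨hw1, N, hN⟩).2 le_rfl
    | pred i hi ih =>
      have := h (i - 1) (by omega)
      rw [sub_add_cancel] at this
      omega
  ext i
  rw [Equiv.Perm.one_apply]
  rcases lt_or_ge (n : ℤ) i with h1 | h1
  · exact hw1 i h1
  · rcases lt_or_ge i (min N n) with h2 | h2
    · exact hN i (by omega)
    · have := lower i (by omega) h1
      have := upper i h1
      omega

/-- Bubble sort: at a descent `i` of the inverse, multiplying by `s_i` on the left removes an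
inversion, and without descents the permutation is the identity. -/
theorem exists_word {w : Equiv.Perm ℤ} (hw : IsFinPerm n w) :
    ∃ l : List ℤ, (∀ i ∈ l, i < (n : ℤ)) ∧ l.length ≤ (invSet w).ncard ∧
      (l.map fun i => Equiv.swap i (i + 1)).prod = w := by
  obtain ⟨m, hm⟩ : ∃ m, m = (invSet w).ncard := ⟨_, rfl⟩
  induction m using Nat.strong_induction_on generalizing w with
  | _ m ih =>
    by_cases h1 : ∀ i < (n : ℤ), w.symm i < w.symm (i + 1)
    · have := eq_one_of_increasing hw.symm h1
      refine ⟨[], by simp, by simp, ?_⟩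
      rw [List.map_nil, List.prod_nil, ← Equiv.symm_symm w, this]
      rfl
    · push Not at h1
      obtain ⟨i, hi, h2⟩ := h1
      have hne : w.symm (i + 1) ≠ w.symm i := w.symm.injective.ne (by omega)
      have hfin : IsFinPerm n (Equiv.swap i (i + 1) * w) :=
        (isFinPerm_swap (by omega) (by omega)).mul hw
      have hlt : (invSet (Equiv.swap i (i + 1) * w)).ncard < (invSet w).ncard := by
        apply Set.ncard_lt_ncard _ (invSet_finite hw)
        refine ⟨fun p hp => ?_, fun hsub => ?_⟩
        · rcases invSet_swap_mul_subset w i hp with rfl | h3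
          · exact absurd hp.1 (by simp only; omega)
          · exact h3
        · have : (w.symm i, w.symm (i + 1)) ∈ invSet w := ⟨by simp only; omega, by simp⟩
          have := (hsub this).2
          simp at this
      obtain ⟨l, h3, h4, h5⟩ := ih _ (hm ▸ hlt) hfin rfl
      refine ⟨i :: l, ?_, ?_, ?_⟩
      · intro j hj
        rcases List.mem_cons.1 hj with rfl | hj
        · exact hi
        · exact h3 j hj
      · rw [List.length_cons]
        omega
      · rw [List.map_cons, List.prod_cons, h5, ← mul_assoc, Equiv.swap_mul_self, one_mul]

theorem length_eq {w : Equiv.Perm ℤ} (hw : IsFinPerm n w) : length n w = (invSet w).ncard := by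
  obtain ⟨l, h1, h2, h3⟩ := exists_word hw
  have hmem : l.length ∈ {r : ℕ | ∃ l : List ℤ, (∀ i ∈ l, i < (n : ℤ)) ∧ l.length = r ∧
      (l.map fun i => Equiv.swap i (i + 1)).prod = w} := ⟨l, h1, rfl, h3⟩
  apply le_antisymm
  · exact (Nat.sInf_le hmem).trans h2
  · obtain ⟨l', h4, h6, h5⟩ := Nat.sInf_mem ⟨_, hmem⟩
    rw [length, ← h6, ← h5]
    exact (inv_prod_le l' h4).2

theorem Red.card_eq_length (h : Red n R) {w : Equiv.Perm ℤ} (hw : HasPerm n R w) :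
    R.card = length n w := by
  rw [length_eq (hw.isFinPerm h.inTable), h.card_eq hw]

theorem red_of_card_le_length (hR : InTable n R) {w : Equiv.Perm ℤ} (hw : HasPerm n R w)
    (h : R.card ≤ length n w) : Red n R := by
  rw [length_eq (hw.isFinPerm hR)] at h
  exact red_of_card_le hR hw h

/-! ### Changing a set of places -/

theorem exitCol_congr {k : ℤ} (h : ∀ c, (c, k) ∈ R ↔ (c, k) ∈ R') (c : ℤ) :
    exitCol R k c = exitCol R' k c := by
  by_cases hc : (c, k) ∈ R
  · rw [exitCol_of_mem hc, exitCol_of_mem ((h c).1 hc)]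
  · have hc' : (c, k) ∉ R' := fun h1 => hc ((h c).2 h1)
    refine exitCol_eq_of hc (fun h1 => exitCol_notMem hc' ((h _).1 h1)) (exitCol_lt hc') ?_
    exact fun x h1 h2 => (h x).2 (exitCol_between h1 h2)

theorem col_congr (hR : InTable n R) (hR' : InTable n R') {k : ℤ}
    (h : ∀ c y, y < k → ((c, y) ∈ R ↔ (c, y) ∈ R')) {y : ℤ} (hy : y ≤ k) (a : ℤ) :
    col n R y a = col n R' y a := by
  obtain ⟨K, hK⟩ := exists_row_bound R
  obtain ⟨K', hK'⟩ := exists_row_bound R'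
  have low : ∀ l ≤ min K K', col n R l a = col n R' l a := fun l hl => by
    rw [col_low hR hK (by omega), col_low hR' hK' (by omega)]
  rcases le_total y (min K K') with h1 | h1
  · exact low y h1
  · induction y, h1 using Int.leInduction with
    | base => exact low _ le_rfl
    | succ y h1 ih =>
      rw [col_succ hR, col_succ hR', ih (by omega)]
      exact exitCol_congr (fun c => h c y (by omega)) _

/-- The paths above row `k` depend only on the places there, so a relabelling `f` of the strands at
row `k` persists upwards. -/
theorem col_congr_above (hR : InTable n R) (hR' : InTable n R') {k : ℤ} {f : ℤ → ℤ}
    (h : ∀ c y, k ≤ y → ((c, y) ∈ R ↔ (c, y) ∈ R')) (hk : ∀ a, col n R' k a = col n R k (f a))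
    {y : ℤ} (hy : k ≤ y) (a : ℤ) : col n R' y a = col n R y (f a) := by
  induction y, hy using Int.leInduction with
  | base => exact hk a
  | succ y hy ih => rw [col_succ hR, col_succ hR', ih, exitCol_congr fun c => h c y hy]

/-- `R'` is obtained from `R` by putting in the place `(i, k)`, at which the strand labeled `a`
enters from the left and the strand labeled `b` enters from the bottom. -/
structure Toggle (n : ℕ) (R R' : Finset (ℤ × ℤ)) (i k a b : ℤ) : Prop where
  left : InTable n R
  right : InTable n R'
  notMem : (i, k) ∉ R
  mem : (i, k) ∈ R'
  iff : ∀ c y, (c, y) ≠ (i, k) → ((c, y) ∈ R ↔ (c, y) ∈ R')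
  col_left : col n R (k + 1) a = i
  col_bottom : col n R k b = i

namespace Toggle
variable {i k a b : ℤ}

theorem col_le (h : Toggle n R R' i k a b) {y : ℤ} (hy : y ≤ k) (x : ℤ) :
    col n R' y x = col n R y x :=
  (col_congr h.left h.right (fun c y hy => h.iff c y (by
    rw [Ne, Prod.mk.injEq]
    omega)) hy x).symm

theorem col_bottom_lt (h : Toggle n R R' i k a b) : col n R (k + 1) b < i := by
  rw [col_succ h.left, h.col_bottom]
  exact exitCol_lt h.notMem

theorem ne (h : Toggle n R R' i k a b) : a ≠ b := by
  rintro rfl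
  have := h.col_bottom_lt
  have := h.col_left
  omega

theorem lt_col_left (h : Toggle n R R' i k a b) : i < col n R k a := by
  have h1 := col_succ_le h.left k a
  have h2 : col n R k a ≠ col n R k b := by
    rw [Ne, col_inj h.left]
    exact h.ne
  have := h.col_left
  have := h.col_bottom
  omega

theorem exitCol_of_ne (h : Toggle n R R' i k a b) {c : ℤ} (hc : c ≠ i)
    (hc' : exitCol R k c ≠ i) : exitCol R' k c = exitCol R k c := by
  have hiff : ∀ x, x ≠ i → ((x, k) ∈ R ↔ (x, k) ∈ R') := fun x hx =>
    h.iff x k (by simpa using hx)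
  by_cases h1 : (c, k) ∈ R
  · rw [exitCol_of_mem h1, exitCol_of_mem ((hiff c hc).1 h1)]
  · refine exitCol_eq_of (fun h2 => h1 ((hiff c hc).2 h2))
      (fun h2 => exitCol_notMem h1 ((hiff _ hc').2 h2)) (exitCol_lt h1) fun x h2 h3 => ?_
    rcases eq_or_ne x i with rfl | hx
    · exact h.mem
    · exact (hiff x hx).1 (exitCol_between h2 h3)

theorem exitCol_left (h : Toggle n R R' i k a b) :
    exitCol R' k (col n R k a) = exitCol R k i := by
  have hiff : ∀ x, x ≠ i → ((x, k) ∈ R ↔ (x, k) ∈ R') := fun x hx =>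
    h.iff x k (by simpa using hx)
  have hlt := h.lt_col_left
  have hl := h.col_left
  have h1 := exitCol_lt h.notMem
  have h2 : (col n R k a, k) ∉ R := by
    intro h2
    have := (col_succ_eq_iff h.left).2 h2
    omega
  refine exitCol_eq_of (fun h3 => h2 ((hiff _ hlt.ne').2 h3))
    (fun h3 => exitCol_notMem h.notMem ((hiff _ h1.ne).2 h3)) (by omega) fun x h3 h4 => ?_
  rcases lt_trichotomy x i with h5 | rfl | h5
  · exact (hiff x h5.ne).1 (exitCol_between h3 h5)
  · exact h.mem
  · exact (hiff x h5.ne').1 (col_between h.left (by omega) h4)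

/-- Instead of touching at the new place, the strands `a` and `b` now intersect, so each follows the
former path of the other above it; all other strands leave the row where they did. -/
theorem col_gt (h : Toggle n R R' i k a b) {y : ℤ} (hy : k < y) (x : ℤ) :
    col n R' y x = col n R y (Equiv.swap a b x) := by
  refine col_congr_above h.left h.right (fun c y hy => h.iff c y (by
    rw [Ne, Prod.mk.injEq]
    omega)) ?_ (show k + 1 ≤ y from hy) x
  intro x
  rw [col_succ h.right, h.col_le le_rfl]
  rcases eq_or_ne x a with rfl | hxa
  · rw [h.exitCol_left, Equiv.swap_apply_left, col_succ h.left, h.col_bottom]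
  · rcases eq_or_ne x b with rfl | hxb
    · rw [h.col_bottom, exitCol_of_mem h.mem, Equiv.swap_apply_right, h.col_left]
    · rw [Equiv.swap_apply_of_ne_of_ne hxa hxb, col_succ h.left]
      apply h.exitCol_of_ne
      · rw [← h.col_bottom, Ne, col_inj h.left]
        exact hxb
      · rw [← col_succ h.left, ← h.col_left, Ne, col_inj h.left]
        exact hxa

theorem hasPerm_iff (h : Toggle n R R' i k a b) {w : Equiv.Perm ℤ} :
    HasPerm n R w ↔ HasPerm n R' (w * Equiv.swap a b) := by
  have hk := (h.right _ h.mem).2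
  simp only at hk
  rw [RCGraph.hasPerm_iff h.left, RCGraph.hasPerm_iff h.right]
  simp only [h.col_gt (show k < n + 1 by omega), Equiv.Perm.mul_apply]
  constructor
  · exact fun h1 x => h1 _
  · intro h1 x
    simpa using h1 (Equiv.swap a b x)

end Toggle

theorem InTable.insert (hR : InTable n R) {i k : ℤ} (hi : i ≤ n) (hk : k ≤ n) :
    InTable n (insert (i, k) R) := by
  intro p hp
  rcases Finset.mem_insert.1 hp with rfl | hp
  · exact ⟨hi, hk⟩
  · exact hR p hp

theorem InTable.erase (hR : InTable n R) (p : ℤ × ℤ) : InTable n (R.erase p) :=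
  fun q hq => hR q (Finset.mem_of_mem_erase hq)

theorem toggle_insert (hR : InTable n R) {i k a b : ℤ} (hi : i ≤ n) (hk : k ≤ n)
    (hp : (i, k) ∉ R) (ha : col n R (k + 1) a = i) (hb : col n R k b = i) :
    Toggle n R (insert (i, k) R) i k a b where
  left := hR
  right := hR.insert hi hk
  notMem := hp
  mem := Finset.mem_insert_self _ _
  iff c y h := by simp [Finset.mem_insert, h]
  col_left := ha
  col_bottom := hb

/-- Removing an intersection. Note that `a` comes from the left at `(i, k)`. -/
theorem toggle_erase (hR : InTable n R) {k a b : ℤ} (h : Crosses n R k a b) :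
    Toggle n (R.erase (col n R k b, k)) R (col n R k b) k a b := by
  have hm := ((crosses_iff hR).1 h).1
  have hR' := hR.erase (col n R k b, k)
  obtain ⟨b', hb'⟩ := (col_bijective hR' k).2 (col n R k b)
  have hlow : ∀ x, col n (R.erase (col n R k b, k)) k x = col n R k x := fun x => by
    refine col_congr hR' hR (k := k) (fun c y hy => ?_) le_rfl x
    rw [Finset.mem_erase, Ne, Prod.mk.injEq]
    exact ⟨fun h => h.2, fun h => ⟨by omega, h⟩⟩
  have hbb : b' = b := by
    rw [hlow, col_inj hR] at hb'
    exact hb'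
  have h1 := (crosses_iff hR).1 h
  have hn : (col n R k b, k) ∉ R.erase (col n R k b, k) := Finset.notMem_erase _ _
  refine ⟨hR', hR, hn, hm, ?_, ?_, hlow b⟩
  · intro c y hcy
    simp [Finset.mem_erase, hcy]
  · rw [col_succ hR', hlow]
    have h2 : (col n R k a, k) ∉ R := by
      intro h2
      have := (col_succ_eq_iff hR).2 h2
      omega
    refine exitCol_eq_of (fun h3 => h2 (Finset.mem_of_mem_erase h3)) hn h1.2.2 ?_
    intro x h3 h4
    rw [Finset.mem_erase, Ne, Prod.mk.injEq]
    exact ⟨by omega, col_between hR (a := a) (by omega) h4⟩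

end RCGraph
namespace RCGraph
variable {n : ℕ} {R V U : Finset (ℤ × ℤ)} {i k l k' a b : ℤ}

/-! ### Putting in an intersection -/

/-- At the place `(i, k)`, the strand labeled `a` goes from the left to the top and the strand
labeled `b` goes from the bottom to the right. -/
structure Meet (n : ℕ) (R : Finset (ℤ × ℤ)) (i k a b : ℤ) : Prop where
  col_le : i ≤ n
  row_le : k ≤ n
  notMem : (i, k) ∉ R
  left : col n R (k + 1) a = i
  bottom : col n R k b = i

theorem Meet.toggle (hR : InTable n R) (h : Meet n R i k a b) :
    Toggle n R (insert (i, k) R) i k a b :=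
  toggle_insert hR h.col_le h.row_le h.notMem h.left h.bottom

theorem Meet.lt_col (hR : InTable n R) (h : Meet n R i k a b) : i < col n R k a :=
  (h.toggle hR).lt_col_left

theorem Meet.col_lt (hR : InTable n R) (h : Meet n R i k a b) : col n R (k + 1) b < i :=
  (h.toggle hR).col_bottom_lt

theorem Meet.crosses_between (hR : InTable n R) (h : Meet n R i k a b) {x : ℤ}
    (h1 : i < col n R k x) (h2 : col n R k x < col n R k a) : Crosses n R k a x := by
  have hl := h.left
  exact (crosses_iff hR).2 ⟨col_between hR (a := a) (by omega) h2, by omega, h2⟩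

/-- The hypothesis on the top row says that `a` and `b` never cross in `R`. A new pair that
uncrosses would have to involve one of the exchanged continuations. It then forces a third strand
between `b` and `a` in row `k`, but all places from `i` to the entry of `a` are occupied, so `a`
already crosses that strand in row `k`. -/
theorem Meet.red_insert (hR : Red n R) (h : Meet n R i k a b) (hab : b < a)
    (hfin : col n R (n + 1) b < col n R (n + 1) a) : Red n (insert (i, k) R) := by
  have hT := hR.inTable
  have ht := h.toggle hT
  have hkn := h.row_le
  have hli := h.left
  have hbi := h.bottom
  have hlt := h.lt_col hT
  refine ⟨ht.right, fun {y u v} huv hlt' => ?_⟩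
  by_contra hcon
  have hne : col n (insert (i, k) R) (y + 1) u ≠ col n (insert (i, k) R) (y + 1) v := by
    rw [Ne, col_inj ht.right]
    exact huv.ne'
  have hc : Crosses n (insert (i, k) R) y v u := ⟨hlt', by omega⟩
  have hyn : y ≤ n := (ht.right _ ((crosses_iff ht.right).1 hc).1).2
  have lt_of := fun {y c d} (hc : Crosses n R y c d) => hR.lt_of_crosses hc
  rcases lt_trichotomy y k with hy | rfl | hy
  · have h1 : Crosses n R y v u := by
      simpa only [Crosses, ht.col_le hy.le, ht.col_le (show y + 1 ≤ k by omega)] using hc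
    have := lt_of h1
    omega
  · obtain ⟨h1, h2⟩ := hc
    rw [ht.col_le le_rfl, ht.col_le le_rfl] at h1
    rw [ht.col_gt (by omega), ht.col_gt (by omega)] at h2
    rcases eq_or_ne u b with rfl | hub
    · rcases eq_or_ne v a with rfl | hva
      · omega
      · rw [Equiv.swap_apply_right, Equiv.swap_apply_of_ne_of_ne hva (by omega)] at h2
        have := left_unique hT (k := y) (c := i) (a := a) (b := v) (by omega) (by omega) (by omega)
          (by omega)
        omega
    · rcases eq_or_ne v b with rfl | hvb
      · have hua : u ≠ a := by rintro rfl; omega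
        rw [Equiv.swap_apply_right, Equiv.swap_apply_of_ne_of_ne hua hub] at h2
        have := col_succ_le hT y u
        omega
      · rcases eq_or_ne v a with rfl | hva
        · rw [Equiv.swap_apply_left, Equiv.swap_apply_of_ne_of_ne (by omega) hub] at h2
          rcases lt_trichotomy (col n R y u) i with h3 | h3 | h3
          · have := lt_of (show Crosses n R y b u from ⟨by omega, h2⟩)
            omega
          · rw [← hbi, col_inj hT] at h3
            exact hub h3
          · have := lt_of (h.crosses_between hT h3 h1)
            omega
        · rcases eq_or_ne u a with rfl | hua
          · rw [Equiv.swap_apply_left, Equiv.swap_apply_of_ne_of_ne hva hvb] at h2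
            have h3 : Crosses n R y v b := ⟨by omega, h2⟩
            have h4 := ((crosses_iff hT).1 h3).1
            rw [hbi] at h4
            exact h.notMem h4
          · rw [Equiv.swap_apply_of_ne_of_ne hva hvb, Equiv.swap_apply_of_ne_of_ne hua hub] at h2
            have := lt_of (show Crosses n R y v u from ⟨h1, h2⟩)
            omega
  · obtain ⟨h1, h2⟩ := hc
    rw [ht.col_gt (by omega), ht.col_gt (by omega)] at h1 h2
    have h3 : Crosses n R y (Equiv.swap a b v) (Equiv.swap a b u) := ⟨h1, h2⟩
    have h4 := lt_of h3
    rcases eq_or_ne u a with rfl | hua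
    · rcases eq_or_ne v b with rfl | hvb
      · rw [Equiv.swap_apply_left, Equiv.swap_apply_right] at h3
        have := hR.persist hab (show y + 1 ≤ (n : ℤ) + 1 by omega) h3.2
        omega
      · rw [Equiv.swap_apply_left, Equiv.swap_apply_of_ne_of_ne huv.ne hvb] at h3 h4
        have h5 := hR.persist h4 (show y + 1 ≤ (n : ℤ) + 1 by omega) h3.2
        have h6 := hR.persist' huv (show k ≤ (n : ℤ) + 1 by omega) (by omega)
        have h7 := hR.persist' h4 hy.le h3.1
        -- The strand `v` lies between `b` and `a` in row `k`, so `a` crosses it there. Yet `v` ends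
        -- to the right of `b`, which ends to the right of `a`, so `a` and `v` would have to
        -- uncross.
        have h8 := h.crosses_between hT (by omega) h6
        have := hR.persist huv (show k + 1 ≤ (n : ℤ) + 1 by omega) h8.2
        omega
    · rcases eq_or_ne v a with rfl | hva
      · rw [Equiv.swap_apply_left] at h4
        rcases eq_or_ne u b with rfl | hub
        · omega
        · rw [Equiv.swap_apply_of_ne_of_ne hua hub] at h4
          omega
      · rcases eq_or_ne u b with rfl | hub
        · rw [Equiv.swap_apply_right, Equiv.swap_apply_of_ne_of_ne hva (by omega)] at h4
          omega
        · rcases eq_or_ne v b with rfl | hvb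
          · rw [Equiv.swap_apply_right, Equiv.swap_apply_of_ne_of_ne hua hub] at h3 h4
            have h5 := hR.persist h4 (show y + 1 ≤ (n : ℤ) + 1 by omega) h3.2
            have h6 := hR.persist' h4 hy.le h3.1
            have h7 := hR.persist' huv (show k ≤ (n : ℤ) + 1 by omega) (by omega)
            -- Here `a` crosses `u` both in row `k` and in the higher row `y`.
            have h8 := h.crosses_between hT (by omega) h6
            have := hR.crosses_row_unique h8 h3
            omega
          · rw [Equiv.swap_apply_of_ne_of_ne hua hub, Equiv.swap_apply_of_ne_of_ne hva hvb] at h4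
            omega

theorem Meet.exists_crosses (hR : Red n R) (h : Meet n R i k a b)
    (hfin : col n R (n + 1) a < col n R (n + 1) b) :
    ∃ y, k < y ∧ Crosses n R y a b := by
  have hlt := h.lt_col hR.inTable
  have hbi := h.bottom
  have hkn := h.row_le
  obtain ⟨y, h1, -, h3⟩ := RCGraph.exists_crosses hR.inTable (k := k) (l := n + 1)
    (a := a) (b := b) (by omega) (by omega) hfin
  refine ⟨y, ?_, h3⟩
  rcases h1.lt_or_eq with h1 | rfl
  · exact h1
  · have := ((crosses_iff hR.inTable).1 h3).1
    rw [hbi] at this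
    exact absurd this h.notMem

theorem Meet.not_red_insert (hR : Red n R) (h : Meet n R i k a b) (hab : b < a)
    (hfin : col n R (n + 1) a < col n R (n + 1) b) : ¬ Red n (insert (i, k) R) := by
  intro hred
  have hT := hR.inTable
  have ht := h.toggle hT
  have hkn := h.row_le
  have h1 := h.col_lt hT
  have h2 := h.left
  have := hred.persist hab (show k + 1 ≤ (n : ℤ) + 1 by omega) (by
    rw [ht.col_gt (by omega), ht.col_gt (by omega), Equiv.swap_apply_left, Equiv.swap_apply_right]
    omega)
  rw [ht.col_gt (by omega), ht.col_gt (by omega), Equiv.swap_apply_left,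
    Equiv.swap_apply_right] at this
  omega

/-- One step of the insertion algorithm which is not the last one: the intersection `(i, k)` is put
into `R`, and the later intersection `(l, k')` of the same strands is removed. -/
structure Bump (n : ℕ) (R V : Finset (ℤ × ℤ)) (i k l k' a b : ℤ) : Prop where
  meet : Meet n R i k a b
  lt : k < k'
  crosses : Crosses n R k' a b
  col_eq : col n R k' b = l
  eq : V = (insert (i, k) R).erase (l, k')

namespace Bump

theorem crosses_insert (hR : InTable n R) (h : Bump n R V i k l k' a b) :
    Crosses n (insert (i, k) R) k' b a ∧ col n (insert (i, k) R) k' a = l := by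
  have ht := h.meet.toggle hR
  have hlt := h.lt
  rw [Crosses, ht.col_gt (by omega), ht.col_gt (by omega), ht.col_gt (by omega),
    ht.col_gt (by omega), Equiv.swap_apply_left, Equiv.swap_apply_right]
  exact ⟨h.crosses, h.col_eq⟩

theorem toggle_right (hR : InTable n R) (h : Bump n R V i k l k' a b) :
    Toggle n V (insert (i, k) R) l k' b a := by
  have h1 := h.crosses_insert hR
  have := toggle_erase (h.meet.toggle hR).right h1.1
  rwa [h1.2, ← h.eq] at this

theorem inTable (hR : InTable n R) (h : Bump n R V i k l k' a b) : InTable n V :=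
  (h.toggle_right hR).left

theorem col_low (hR : InTable n R) (h : Bump n R V i k l k' a b) {y : ℤ} (hy : y ≤ k) (x : ℤ) :
    col n V y x = col n R y x := by
  have hlt := h.lt
  rw [← (h.toggle_right hR).col_le (by omega), (h.meet.toggle hR).col_le hy]

theorem col_mid (hR : InTable n R) (h : Bump n R V i k l k' a b) {y : ℤ} (hy : k < y)
    (hy' : y ≤ k') (x : ℤ) : col n V y x = col n R y (Equiv.swap a b x) := by
  rw [← (h.toggle_right hR).col_le hy', (h.meet.toggle hR).col_gt hy]

theorem col_high (hR : InTable n R) (h : Bump n R V i k l k' a b) {y : ℤ} (hy : k' < y) (x : ℤ) :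
    col n V y x = col n R y x := by
  have hlt := h.lt
  have h1 := (h.toggle_right hR).col_gt hy (Equiv.swap a b x)
  rw [Equiv.swap_comm b a, Equiv.swap_apply_self] at h1
  rw [← h1, (h.meet.toggle hR).col_gt (by omega), Equiv.swap_apply_self]

theorem row_le (hR : InTable n R) (h : Bump n R V i k l k' a b) : k' ≤ n :=
  (hR _ ((crosses_iff hR).1 h.crosses).1).2

theorem col_le (hR : InTable n R) (h : Bump n R V i k l k' a b) : l ≤ n := by
  have := (hR _ ((crosses_iff hR).1 h.crosses).1).1
  rwa [h.col_eq] at this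

theorem mem (hR : InTable n R) (h : Bump n R V i k l k' a b) : (l, k') ∈ R := by
  have := ((crosses_iff hR).1 h.crosses).1
  rwa [h.col_eq] at this

/-- The strands after the step. -/
theorem meet_right (hR : InTable n R) (h : Bump n R V i k l k' a b) : Meet n V l k' b a where
  col_le := h.col_le hR
  row_le := h.row_le hR
  notMem := (h.toggle_right hR).notMem
  left := (h.toggle_right hR).col_left
  bottom := (h.toggle_right hR).col_bottom

theorem hasPerm (hR : InTable n R) (h : Bump n R V i k l k' a b) {w : Equiv.Perm ℤ} :
    HasPerm n V w ↔ HasPerm n R w := by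
  have h1 := h.row_le hR
  rw [hasPerm_iff hR, hasPerm_iff (h.inTable hR)]
  simp only [h.col_high hR (show k' < (n : ℤ) + 1 by omega)]

theorem card_eq (hR : InTable n R) (h : Bump n R V i k l k' a b) : V.card = R.card := by
  rw [h.eq, Finset.card_erase_of_mem (Finset.mem_insert_of_mem (h.mem hR)),
    Finset.card_insert_of_notMem h.meet.notMem]
  rfl

/-- A step changes neither the permutation nor the number of places, and these two decide
reducedness. -/
theorem red_iff (hR : InTable n R) (h : Bump n R V i k l k' a b) : Red n V ↔ Red n R := by
  obtain ⟨w, hw⟩ := exists_hasPerm hR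
  have hw' := (h.hasPerm hR).2 hw
  have hV := h.inTable hR
  constructor
  · intro h1
    refine red_of_card_le hR hw ?_
    rw [← h.card_eq hR, h1.card_eq hw']
  · intro h1
    refine red_of_card_le hV hw' ?_
    rw [h.card_eq hR, h1.card_eq hw]

theorem mem_iff (h : Bump n R V i k l k' a b) {p : ℤ × ℤ} (hp : k' < p.2) : p ∈ V ↔ p ∈ R := by
  have hlt := h.lt
  obtain ⟨c, y⟩ := p
  simp only at hp
  rw [h.eq, Finset.mem_erase, Finset.mem_insert, Ne, Prod.mk.injEq, Prod.mk.injEq]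
  constructor
  · rintro ⟨-, h1 | h1⟩
    · omega
    · exact h1
  · exact fun h1 => ⟨by omega, Or.inr h1⟩

/-- Undoing a step. -/
theorem exists_of_meet (hV : Red n V) (h : Meet n V l k' b a) (hab : b < a) :
    ∃ R i k, Bump n R V i k l k' a b ∧ Red n R := by
  have hT := hV.inTable
  have hlb := h.lt_col hT
  have hla := h.bottom
  obtain ⟨k, hk, hc⟩ := exists_crosses_of_lt hT hab (l := k') (by omega)
  have ht := h.toggle hT
  have hc' : Crosses n (insert (l, k') V) k a b := by
    rw [Crosses, ht.col_le hk.le, ht.col_le hk.le, ht.col_le (by omega), ht.col_le (by omega)]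
    exact hc
  have ht' := toggle_erase ht.right hc'
  have hm := ((crosses_iff hT).1 hc).1
  rw [ht.col_le hk.le] at ht'
  have hb : Bump n ((insert (l, k') V).erase (col n V k b, k)) V (col n V k b) k l k' a b := by
    have ha1 := ht'.col_gt hk b
    have hb1 := ht'.col_gt hk a
    have ha2 := ht'.col_gt (show k < k' + 1 by omega) b
    have hb2 := ht'.col_gt (show k < k' + 1 by omega) a
    rw [ht.col_le le_rfl, Equiv.swap_apply_right] at ha1
    rw [ht.col_le le_rfl, Equiv.swap_apply_left] at hb1
    rw [ht.col_gt (by omega), Equiv.swap_apply_left, Equiv.swap_apply_right] at ha2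
    rw [ht.col_gt (by omega), Equiv.swap_apply_right, Equiv.swap_apply_left] at hb2
    refine ⟨⟨(hT _ hm).1, (hT _ hm).2, ht'.notMem, ht'.col_left, ht'.col_bottom⟩, hk, ?_,
      by omega, ?_⟩
    · have h1 := h.col_lt hT
      have h2 := h.left
      exact ⟨by omega, by omega⟩
    · rw [Finset.insert_erase ht'.mem, Finset.erase_insert h.notMem]
  exact ⟨_, _, _, hb, (hb.red_iff ht'.left).1 hV⟩

end Bump

/-! ### The insertion algorithm in terms of steps -/

theorem isOpenSpace_iff (hR : InTable n R) :
    IsOpenSpace n R i k ↔ ∃ a b, 0 < a ∧ b ≤ 0 ∧ Meet n R i k a b := by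
  constructor
  · rintro ⟨h1, h2, a, b, ha, hb, h3, h4⟩
    rw [strand_left_iff hR] at h3
    rw [strand_bottom_iff hR] at h4
    refine ⟨a, b, ha, hb, h3.1, h1, h2, ?_, h4.2.2⟩
    rcases h3.2.2.1.lt_or_eq with h5 | h5
    · exact absurd (col_between hR h5 h3.2.2.2) h2
    · exact h5
  · rintro ⟨a, b, ha, hb, h⟩
    refine ⟨h.row_le, h.notMem, a, b, ha, hb, ?_, ?_⟩
    · rw [strand_left_iff hR]
      exact ⟨h.col_le, h.row_le, h.left.le, h.lt_col hR⟩
    · rw [strand_bottom_iff hR]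
      exact ⟨h.col_le, by have := h.row_le; omega, h.bottom⟩

theorem Meet.unique (hR : InTable n R) {a' b' : ℤ} (h : Meet n R i k a b)
    (h' : Meet n R i k a' b') : a = a' ∧ b = b' :=
  ⟨(col_inj hR).1 (h.left.trans h'.left.symm), (col_inj hR).1 (h.bottom.trans h'.bottom.symm)⟩

theorem InsertFrom.of_bump {J : Set ℤ} (hR : Red n R) (hab : b < a)
    (hi : IsLeast {j | j ∈ J ∧ IsOpenSpace n R j k} i) (h : Bump n R V i k l k' a b)
    (hU : InsertFrom n V k' (Set.Ioi l) U) : InsertFrom n R k J U := by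
  have hT := hR.inTable
  have ht := h.meet.toggle hT
  have hlt := h.lt
  have hrow := h.row_le hT
  rw [h.eq] at hU
  refine InsertFrom.next (a := a) (b := b) hi ?_ ?_ ?_ hlt hU
  · rw [isRC_iff]
    exact h.meet.not_red_insert hR hab
      (hR.persist hab (show k' + 1 ≤ (n : ℤ) + 1 by omega) h.crosses.2)
  · rw [intersect_iff ht.right]
    refine Or.inl ⟨(crosses_iff ht.right).2 ?_, ?_⟩
    · simp only
      rw [ht.col_le le_rfl, ht.col_le le_rfl, ht.col_gt (by omega), Equiv.swap_apply_left,
        h.meet.bottom]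
      exact ⟨ht.mem, (h.meet.col_lt hT).le, h.meet.lt_col hT⟩
    · rw [ht.col_le le_rfl]
      exact h.meet.bottom
  · rw [intersect_iff ht.right]
    exact Or.inr (h.crosses_insert hT)

/-- The algorithm may name its two strands in either order; the place `(i, k)` determines them, so
they are the positive and the nonpositive strand of the open space. -/
theorem insertFrom_cases {J : Set ℤ} (hR : Red n R) (h : InsertFrom n R k J U) :
    ∃ i a b, IsLeast {j | j ∈ J ∧ IsOpenSpace n R j k} i ∧ 0 < a ∧ b ≤ 0 ∧ Meet n R i k a b ∧
      ((U = insert (i, k) R ∧ Red n (insert (i, k) R)) ∨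
        ∃ V l k', Bump n R V i k l k' a b ∧ InsertFrom n V k' (Set.Ioi l) U) := by
  have hT := hR.inTable
  cases h with
  | @last _ _ i _ hi hrc =>
    obtain ⟨a, b, ha, hb, hm⟩ := (isOpenSpace_iff hT).1 hi.1.2
    exact ⟨i, a, b, hi, ha, hb, hm, Or.inl ⟨rfl, isRC_iff.1 hrc⟩⟩
  | @next _ _ _ i k' l a' b' _ hi hrc h1 h2 hk hU =>
    obtain ⟨a, b, ha, hb, hm⟩ := (isOpenSpace_iff hT).1 hi.1.2
    have ht := hm.toggle hT
    refine ⟨i, a, b, hi, ha, hb, hm, Or.inr ⟨_, l, k', ?_, hU⟩⟩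
    have hcr : Crosses n (insert (i, k) R) k a b ∧ col n (insert (i, k) R) k b = i := by
      rw [crosses_iff ht.right, ht.col_le le_rfl, ht.col_le le_rfl, ht.col_gt (by omega),
        Equiv.swap_apply_left, hm.bottom]
      exact ⟨⟨ht.mem, (hm.col_lt hT).le, hm.lt_col hT⟩, rfl⟩
    have h3 : Intersect n (insert (i, k) R) a b (l, k') := by
      rw [intersect_iff ht.right] at h1
      rcases h1 with ⟨h1, h1'⟩ | ⟨h1, h1'⟩
      · obtain ⟨rfl, rfl⟩ := crosses_eq_of_place ht.right h1 hcr.1 (h1'.trans hcr.2.symm)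
        exact h2
      · obtain ⟨rfl, rfl⟩ := crosses_eq_of_place ht.right h1 hcr.1 (h1'.trans hcr.2.symm)
        rw [intersect_iff ht.right] at h2 ⊢
        exact h2.symm
    rw [intersect_iff ht.right] at h3
    simp only [Crosses, ht.col_gt hk, ht.col_gt (show k < k' + 1 by omega),
      Equiv.swap_apply_left, Equiv.swap_apply_right] at h3
    -- In the first case `b` would cross `a` from the left in the reduced set `R`, although `b < a`.
    rcases h3 with ⟨h3, -⟩ | ⟨h3, h4⟩
    · have := hR.lt_of_crosses h3
      omega
    · exact ⟨hm, hk, h3, h4, rfl⟩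

end RCGraph
namespace RCGraph
variable {n : ℕ} {R V W U : Finset (ℤ × ℤ)} {i k l k' a b : ℤ}

/-! ### Open spaces in a row -/

/-- The strand which enters the place `(c, k)` from the left has a positive label. -/
def PosAt (n : ℕ) (R : Finset (ℤ × ℤ)) (k c : ℤ) : Prop :=
  ∃ a, 0 < a ∧ col n R (k + 1) a ≤ c ∧ c < col n R k a

theorem posAt_iff (hR : InTable n R) {c : ℤ} (h1 : col n R (k + 1) a ≤ c) (h2 : c < col n R k a) :
    PosAt n R k c ↔ 0 < a := by
  constructor
  · rintro ⟨x, hx, h3, h4⟩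
    rwa [left_unique hR h1 h2 h3 h4]
  · exact fun h => ⟨a, h, h1, h2⟩

/-- The right-moving strand changes only at places where the strands do not intersect. -/
theorem exists_meet_of_change (hR : InTable n R) {c : ℤ} (hc : c ≤ n) (hk : k ≤ n)
    (h : ¬ (PosAt n R k c ↔ PosAt n R k (c - 1))) :
    ∃ a b, Meet n R c k a b ∧ (PosAt n R k c ↔ 0 < a) ∧ (PosAt n R k (c - 1) ↔ 0 < b) := by
  obtain ⟨a, h1, h2⟩ := exists_left hR k c
  obtain ⟨b, hb⟩ := (col_bijective hR k).2 c
  have hca := posAt_iff hR h1 h2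
  have hmem : (c, k) ∉ R := by
    intro hm
    have h3 : col n R (k + 1) a ≠ c := by
      intro h3
      have := col_succ_notMem hR (k := k) (a := a) (by omega)
      rw [h3] at this
      exact this hm
    exact h (hca.trans (posAt_iff hR (by omega) (by omega)).symm)
  refine ⟨a, b, ⟨hc, hk, hmem, ?_, hb⟩, hca, ?_⟩
  · rcases h1.lt_or_eq with h3 | h3
    · exact absurd (col_between hR h3 h2) hmem
    · exact h3
  · have h3 : col n R (k + 1) b < c := by
      rw [col_succ hR, hb]
      exact exitCol_lt hmem
    exact posAt_iff hR (by omega) (by omega)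

theorem Meet.posAt (hR : InTable n R) (h : Meet n R i k a b) : PosAt n R k i ↔ 0 < a :=
  posAt_iff hR h.left.le (h.lt_col hR)

theorem Meet.posAt_pred (hR : InTable n R) (h : Meet n R i k a b) :
    PosAt n R k (i - 1) ↔ 0 < b := by
  have h1 := h.col_lt hR
  have h2 := h.bottom
  exact posAt_iff hR (by omega) (by omega)

/-- Going to the right along a row, open spaces are the places where the label of the right-moving
strand changes from positive to nonpositive. The search for an open space becomes a search for such
a change. -/
theorem isOpenSpace_iff_posAt (hR : InTable n R) :
    IsOpenSpace n R i k ↔ i ≤ n ∧ k ≤ n ∧ PosAt n R k i ∧ ¬ PosAt n R k (i - 1) := by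
  rw [isOpenSpace_iff hR]
  constructor
  · rintro ⟨a, b, ha, hb, h⟩
    rw [h.posAt hR, h.posAt_pred hR]
    exact ⟨h.col_le, h.row_le, ha, by omega⟩
  · rintro ⟨hi, hk, h1, h2⟩
    obtain ⟨a, b, h3, h4, h5⟩ := exists_meet_of_change hR hi hk (by tauto)
    exact ⟨a, b, h4.1 h1, by have := h5.not.1 h2; omega, h3⟩

theorem posAt_left (hR : InTable n R) (hk : 0 < k) : PosAt n R k n := by
  refine ⟨k, hk, (col_le_iff hR).2 (by omega), ?_⟩
  rw [col_of_le le_rfl]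
  omega

/-- Only the finitely many labels from `1` to `k` are positive and have started by row `k`, so they
all leave the row left of some column. -/
theorem exists_not_posAt (hR : InTable n R) (k : ℤ) : ∃ c₀ ≤ (n : ℤ), ∀ c ≤ c₀, ¬ PosAt n R k c := by
  obtain ⟨C, hC⟩ := ((Set.finite_Icc 1 k).image (col n R (k + 1))).bddBelow
  refine ⟨min n (C - 1), min_le_left _ _, ?_⟩
  rintro c hc ⟨a, ha, h1, h2⟩
  have h3 : a < k + 1 := (col_le_iff hR).1 (by omega)
  have := hC (Set.mem_image_of_mem _ (show a ∈ Set.Icc 1 k from ⟨by omega, by omega⟩))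
  omega

theorem isLeast_Ioi_iff (hR : InTable n R) (hl : ¬ PosAt n R k l) :
    IsLeast {j | j ∈ Set.Ioi l ∧ IsOpenSpace n R j k} i ↔
      IsOpenSpace n R i k ∧ l < i ∧ ∀ c, l ≤ c → c < i → ¬ PosAt n R k c := by
  constructor
  · rintro ⟨⟨h1, h2⟩, h3⟩
    refine ⟨h2, h1, fun c hlc => ?_⟩
    rw [isOpenSpace_iff_posAt hR] at h2
    induction c, hlc using Int.leInduction with
    | base => exact fun _ => hl
    | succ c hlc ih =>
      intro hci hpos
      have h4 : IsOpenSpace n R (c + 1) k := by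
        rw [isOpenSpace_iff_posAt hR]
        refine ⟨by omega, by omega, hpos, ?_⟩
        rw [add_sub_cancel_right]
        exact ih (by omega)
      have := h3 ⟨show l < c + 1 by omega, h4⟩
      omega
  · rintro ⟨h1, h2, h3⟩
    refine ⟨⟨h2, h1⟩, ?_⟩
    rintro j ⟨h4, h5⟩
    by_contra h6
    rw [isOpenSpace_iff_posAt hR] at h5
    replace h4 : l < j := h4
    exact h3 j (by omega) (by omega) h5.2.2.1

theorem isLeast_univ_iff (hR : InTable n R) :
    IsLeast {j | j ∈ Set.univ ∧ IsOpenSpace n R j k} i ↔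
      IsOpenSpace n R i k ∧ ∀ c, c < i → ¬ PosAt n R k c := by
  constructor
  · rintro ⟨⟨h1, h2⟩, h3⟩
    refine ⟨h2, fun c hc => ?_⟩
    obtain ⟨c₀, -, h4⟩ := exists_not_posAt hR k
    refine ((isLeast_Ioi_iff hR (h4 (min c₀ c) (min_le_left _ _))).1 ⟨⟨?_, h2⟩, ?_⟩).2.2 c
      (min_le_right _ _) hc
    · exact show min c₀ c < i by omega
    · exact fun j hj => h3 ⟨trivial, hj.2⟩
  · rintro ⟨h1, h2⟩
    refine ⟨⟨trivial, h1⟩, ?_⟩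
    rintro j ⟨-, h5⟩
    by_contra h6
    rw [isOpenSpace_iff_posAt hR] at h5
    exact h2 j (by omega) h5.2.2.1

theorem exists_open_right (hR : InTable n R) (hk : 0 < k) (hkn : k ≤ n) (hln : l ≤ n)
    (hl : ¬ PosAt n R k l) :
    ∃ i, IsOpenSpace n R i k ∧ l < i ∧ ∀ c, l ≤ c → c < i → ¬ PosAt n R k c := by
  simp only [← isLeast_Ioi_iff hR hl]
  have hne : ∃ j, j ∈ Set.Ioi l ∧ IsOpenSpace n R j k := by
    by_contra! h
    have key : ∀ c, l ≤ c → c ≤ n → ¬ PosAt n R k c := by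
      intro c hlc
      induction c, hlc using Int.leInduction with
      | base => exact fun _ => hl
      | succ c hlc ih =>
        intro hcn hpos
        refine h (c + 1) (show l < c + 1 by omega) ((isOpenSpace_iff_posAt hR).2
          ⟨hcn, hkn, hpos, ?_⟩)
        rw [add_sub_cancel_right]
        exact ih (by omega)
    exact key n hln le_rfl (posAt_left hR hk)
  obtain ⟨i, hi, h⟩ := Int.exists_least_of_bdd
    (P := fun j => j ∈ Set.Ioi l ∧ IsOpenSpace n R j k) ⟨l, fun j hj => le_of_lt hj.1⟩ hne
  exact ⟨i, hi, fun j hj => h j hj⟩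

theorem exists_open (hR : InTable n R) (hk : 0 < k) (hkn : k ≤ n) :
    ∃ i, IsOpenSpace n R i k ∧ ∀ c, c < i → ¬ PosAt n R k c := by
  obtain ⟨c₀, h1, h2⟩ := exists_not_posAt hR k
  obtain ⟨i, h3, h4, h5⟩ := exists_open_right hR hk hkn h1 (h2 _ le_rfl)
  refine ⟨i, h3, fun c hc => ?_⟩
  rcases le_total c c₀ with h6 | h6
  · exact h2 c h6
  · exact h5 c h6 hc

/-! ### The states of the insertion algorithm -/

/-- The insertion of `k₀` into `R₀` comes to put `(i, k)` into the set `V`. -/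
inductive Reach (n : ℕ) (R₀ : Finset (ℤ × ℤ)) (k₀ : ℤ) : Finset (ℤ × ℤ) → ℤ → ℤ → Prop
  | start {i : ℤ} : IsOpenSpace n R₀ i k₀ → (∀ c, c < i → ¬ PosAt n R₀ k₀ c) →
      Reach n R₀ k₀ R₀ i k₀
  | step {V W : Finset (ℤ × ℤ)} {i k l k' a b i' : ℤ} : Reach n R₀ k₀ V i k → 0 < a → b ≤ 0 →
      Bump n V W i k l k' a b → IsOpenSpace n W i' k' → l < i' →
      (∀ c, l ≤ c → c < i' → ¬ PosAt n W k' c) → Reach n R₀ k₀ W i' k'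

variable {R₀ : Finset (ℤ × ℤ)} {k₀ : ℤ}

theorem Reach.red (hR : Red n R₀) (h : Reach n R₀ k₀ V i k) : Red n V := by
  induction h with
  | start => exact hR
  | step _ _ _ hb _ _ _ ih => exact (hb.red_iff ih.inTable).2 ih

theorem Reach.hasPerm (hR : Red n R₀) {w : Equiv.Perm ℤ} (h : Reach n R₀ k₀ V i k) :
    HasPerm n V w ↔ HasPerm n R₀ w := by
  induction h with
  | start => rfl
  | step h _ _ hb _ _ _ ih => rw [hb.hasPerm (h.red hR).inTable, ih]

theorem Reach.isOpenSpace (h : Reach n R₀ k₀ V i k) : IsOpenSpace n V i k := by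
  cases h with
  | start h _ => exact h
  | step _ _ _ _ h _ _ => exact h

theorem Reach.le (h : Reach n R₀ k₀ V i k) : k₀ ≤ k := by
  induction h with
  | start => exact le_rfl
  | step _ _ _ hb _ _ _ ih => exact ih.trans hb.lt.le

theorem Bump.posAt_right (hR : InTable n R) (h : Bump n R V i k l k' a b) (hb : b ≤ 0) :
    ¬ PosAt n V k' l := by
  rw [(h.meet_right hR).posAt (h.inTable hR)]
  omega

theorem Bump.posAt_right_pred (hR : InTable n R) (h : Bump n R V i k l k' a b) (ha : 0 < a) :
    PosAt n V k' (l - 1) :=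
  ((h.meet_right hR).posAt_pred (h.inTable hR)).2 ha

theorem reach_of_insertFrom {J : Set ℤ} (hV : Red n V)
    (hreach : ∀ i, IsLeast {j | j ∈ J ∧ IsOpenSpace n V j k} i → Reach n R₀ k₀ V i k)
    (h : InsertFrom n V k J U) :
    ∃ W i y, Reach n R₀ k₀ W i y ∧ Red n (insert (i, y) W) ∧ U = insert (i, y) W := by
  obtain ⟨m, hm⟩ : ∃ m : ℕ, m = ((n : ℤ) - k).toNat := ⟨_, rfl⟩
  induction m using Nat.strong_induction_on generalizing V k J with
  | _ m ih =>
    obtain ⟨i, a, b, hi, ha, hb, hmeet, ⟨hU, hred⟩ | ⟨W, l, k', hbump, hins⟩⟩ :=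
      insertFrom_cases hV h
    · exact ⟨V, i, k, hreach i hi, hred, hU⟩
    · have hlt := hbump.lt
      have hle := hbump.row_le hV.inTable
      refine ih _ (by omega) (k := k') ((hbump.red_iff hV.inTable).2 hV) (fun i' hi' => ?_) hins rfl
      rw [isLeast_Ioi_iff (hbump.inTable hV.inTable) (hbump.posAt_right hV.inTable hb)] at hi'
      exact .step (hreach i hi) ha hb hbump hi'.1 hi'.2.1 hi'.2.2

theorem Reach.insertFrom (hR : Red n R₀) (h : Reach n R₀ k₀ V i k)
    (hU : ∀ J, IsLeast {j | j ∈ J ∧ IsOpenSpace n V j k} i → InsertFrom n V k J U) :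
    InsertFrom n R₀ k₀ Set.univ U := by
  induction h with
  | start h1 h2 => exact hU _ ((isLeast_univ_iff hR.inTable).2 ⟨h1, h2⟩)
  | step h ha hb hbump h1 h2 h3 ih =>
    have hV := h.red hR
    refine ih fun J hJ => InsertFrom.of_bump hV (by omega) hJ hbump (hU _ ?_)
    rw [isLeast_Ioi_iff (hbump.inTable hV.inTable) (hbump.posAt_right hV.inTable hb)]
    exact ⟨h1, h2, h3⟩

theorem insertFrom_univ_iff (hR : Red n R) :
    InsertFrom n R k Set.univ U ↔
      ∃ V i y, Reach n R k V i y ∧ Red n (insert (i, y) V) ∧ U = insert (i, y) V := by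
  constructor
  · intro h
    refine reach_of_insertFrom hR (fun i hi => ?_) h
    rw [isLeast_univ_iff hR.inTable] at hi
    exact .start hi.1 hi.2
  · rintro ⟨V, i, y, h1, h2, rfl⟩
    exact h1.insertFrom hR fun J hJ => .last hJ (isRC_iff.2 h2)

/-- Each step moves to a strictly higher row, and no crossing lies above row `n`. -/
theorem Reach.exists_final (hR : Red n R₀) (hk : 0 < k₀) (h : Reach n R₀ k₀ V i k) :
    ∃ W i y, Reach n R₀ k₀ W i y ∧ Red n (insert (i, y) W) := by
  obtain ⟨m, hm⟩ : ∃ m : ℕ, m = ((n : ℤ) - k).toNat := ⟨_, rfl⟩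
  induction m using Nat.strong_induction_on generalizing V i k with
  | _ m ih =>
    have hV := h.red hR
    have hT := hV.inTable
    have hle := h.le
    obtain ⟨a, b, ha, hb, hmeet⟩ := (isOpenSpace_iff hT).1 h.isOpenSpace
    rcases lt_trichotomy (col n V (n + 1) b) (col n V (n + 1) a) with h1 | h1 | h1
    · exact ⟨V, i, k, h, hmeet.red_insert hV (by omega) h1⟩
    · rw [col_inj hT] at h1
      omega
    · obtain ⟨k', hk', hc⟩ := hmeet.exists_crosses hV h1
      have hbump : Bump n V _ i k (col n V k' b) k' a b := ⟨hmeet, hk', hc, rfl, rfl⟩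
      have hkn := hbump.row_le hT
      obtain ⟨i', h2, h3, h4⟩ := exists_open_right (hbump.inTable hT) (by omega) hkn
        (hbump.col_le hT) (hbump.posAt_right hT hb)
      exact ih _ (by omega) (h.step ha hb hbump h2 h3 h4) rfl

theorem exists_insertFrom (hR : Red n R) (hk : 0 < k) (hkn : k ≤ n) :
    ∃ U, InsertFrom n R k Set.univ U := by
  obtain ⟨i, h1, h2⟩ := exists_open hR.inTable hk hkn
  obtain ⟨V, i, y, h3, h4⟩ := (Reach.start h1 h2).exists_final hR hk
  exact ⟨_, (insertFrom_univ_iff hR).2 ⟨V, i, y, h3, h4, rfl⟩⟩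

theorem InsertFrom.unique {J : Set ℤ} {U' : Finset (ℤ × ℤ)} (hR : Red n R)
    (h : InsertFrom n R k J U) (h' : InsertFrom n R k J U') : U = U' := by
  obtain ⟨m, hm⟩ : ∃ m : ℕ, m = ((n : ℤ) - k).toNat := ⟨_, rfl⟩
  induction m using Nat.strong_induction_on generalizing R k J with
  | _ m ih =>
    have hT := hR.inTable
    have notred : ∀ {V i a b l k'}, 0 < a → b ≤ 0 → Bump n R V i k l k' a b →
        ¬ Red n (insert (i, k) R) := fun {V i a b l k'} ha hb hbump => by
      have hlt := hbump.row_le hT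
      exact hbump.meet.not_red_insert hR (by omega)
        (hR.persist (by omega) (show k' + 1 ≤ (n : ℤ) + 1 by omega) hbump.crosses.2)
    obtain ⟨i, a, b, hi, ha, hb, hmeet, hh⟩ := insertFrom_cases hR h
    obtain ⟨i', a', b', hi', ha', hb', hmeet', hh'⟩ := insertFrom_cases hR h'
    obtain rfl := hi.unique hi'
    obtain ⟨rfl, rfl⟩ := hmeet.unique hT hmeet'
    rcases hh with ⟨hU, hred⟩ | ⟨W, l, k', hbump, hins⟩
    · rcases hh' with ⟨hU', -⟩ | ⟨W', l', k'', hbump', hins'⟩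
      · rw [hU, hU']
      · exact absurd hred (notred ha hb hbump')
    · rcases hh' with ⟨hU', hred⟩ | ⟨W', l', k'', hbump', hins'⟩
      · exact absurd hred (notred ha hb hbump)
      · obtain rfl := hR.crosses_row_unique hbump.crosses hbump'.crosses
        obtain rfl := hbump.col_eq.symm.trans hbump'.col_eq
        obtain rfl := hbump.eq.trans hbump'.eq.symm
        have hlt := hbump.lt
        have hle := hbump.row_le hT
        exact ih _ (by omega) ((hbump.red_iff hT).2 hR) hins hins' rfl

/-! ### Running the algorithm backwards -/

theorem Bump.crosses_right (hR : InTable n R) (h : Bump n R V i k l k' a b) :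
    Crosses n V k a b ∧ col n V k b = i := by
  have hlt := h.lt
  rw [Crosses, h.col_low hR le_rfl, h.col_low hR le_rfl, h.col_mid hR (by omega) (by omega),
    h.col_mid hR (by omega) (by omega), Equiv.swap_apply_left, Equiv.swap_apply_right,
    h.meet.bottom, h.meet.left]
  exact ⟨⟨h.meet.lt_col hR, h.meet.col_lt hR⟩, rfl⟩

theorem Bump.eq_left (h : Bump n R V i k l k' a b) (hR : InTable n R) :
    R = (insert (l, k') V).erase (i, k) := by
  rw [h.eq, Finset.insert_erase (Finset.mem_insert_of_mem (h.mem hR)),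
    Finset.erase_insert h.meet.notMem]

/-- In row `k` of a state, the rightward search for a positive strand from `i` recovers the last
step. If there is none, the state is a start. Otherwise the first such strand is at `l - 1`, where
`l` is the column of the removed crossing. Its two strands cross in exactly one row of the current
set, and that is the place put in before. -/
theorem Reach.unique {R₁ : Finset (ℤ × ℤ)} {k₁ : ℤ} (hR₀ : Red n R₀) (hR₁ : Red n R₁)
    (h : Reach n R₀ k₀ V i k) (h' : Reach n R₁ k₁ V i k) : R₀ = R₁ ∧ k₀ = k₁ := by
  induction h with
  | start h1 h2 =>
    cases h' with
    | start h3 h4 => exact ⟨rfl, rfl⟩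
    | step h3 ha hb hbump h4 h5 h6 =>
      exact absurd (hbump.posAt_right_pred (h3.red hR₁).inTable ha) (h2 _ (by omega))
  | @step V W i k l k' a b i' h ha hb hbump h4 h5 h6 ih =>
    have hT := (h.red hR₀).inTable
    cases h' with
    | start h7 h8 => exact absurd (hbump.posAt_right_pred hT ha) (h8 _ (by omega))
    | @step V₁ _ i₁ y₁ l₁ _ a₁ b₁ _ h₁ ha₁ hb₁ hbump₁ h7 h8 h9 =>
      have hT₁ := (h₁.red hR₁).inTable
      have hp := hbump.posAt_right_pred hT ha
      have hp₁ := hbump₁.posAt_right_pred hT₁ ha₁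
      obtain rfl : l = l₁ := by
        rcases lt_trichotomy l l₁ with h10 | h10 | h10
        · exact absurd hp₁ (h6 _ (by omega) (by omega))
        · exact h10
        · exact absurd hp (h9 _ (by omega) (by omega))
      obtain ⟨rfl, rfl⟩ := (hbump.meet_right hT).unique (hbump.inTable hT) (hbump₁.meet_right hT₁)
      have hc := hbump.crosses_right hT
      have hc₁ := hbump₁.crosses_right hT₁
      have hW := (hbump.red_iff hT).2 (h.red hR₀)
      obtain rfl := hW.crosses_row_unique hc.1 hc₁.1
      obtain rfl := hc.2.symm.trans hc₁.2
      obtain rfl := (hbump.eq_left hT).trans (hbump₁.eq_left hT₁).symm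
      exact ih h₁

theorem exists_reach (hV : Red n V) (hk : 0 < k) (h : IsOpenSpace n V i k) :
    ∃ R k₀, Red n R ∧ 0 < k₀ ∧ Reach n R k₀ V i k := by
  obtain ⟨m, hm⟩ : ∃ m : ℕ, m = k.toNat := ⟨_, rfl⟩
  induction m using Nat.strong_induction_on generalizing V i k with
  | _ m ih =>
    have hT := hV.inTable
    have hopen := (isOpenSpace_iff_posAt hT).1 h
    by_cases hstart : ∀ c, c < i → ¬ PosAt n V k c
    · exact ⟨V, k, hV, hk, .start h hstart⟩
    · push Not at hstart
      -- The first positive strand to the right of the open space; the crossing to be restored is at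
      -- column `c + 1`, where the label changes from nonpositive to positive.
      obtain ⟨c, ⟨hci, hc⟩, hmax⟩ := Int.exists_greatest_of_bdd
        (P := fun c => c < i ∧ PosAt n V k c) ⟨i, fun c hc => hc.1.le⟩ hstart
      have hne : c ≠ i - 1 := by
        rintro rfl
        exact hopen.2.2.2 hc
      have hnot : ∀ x, c + 1 ≤ x → x < i → ¬ PosAt n V k x := by
        intro x h1 h2 h3
        have := hmax x ⟨h2, h3⟩
        omega
      have hc' := hnot (c + 1) le_rfl (by omega)
      obtain ⟨b, a, hmeet, hb, ha⟩ := exists_meet_of_change hT (c := c + 1) (k := k) (by omega)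
        hopen.2.1 (by rw [add_sub_cancel_right]; tauto)
      rw [add_sub_cancel_right] at ha
      replace ha := ha.1 hc
      replace hb : b ≤ 0 := by
        have := hb.not.1 hc'
        omega
      obtain ⟨R, i₁, k₁, hbump, hR⟩ := Bump.exists_of_meet hV hmeet (by omega)
      -- The positive strand `a` starts in row `a`, so going backwards never leaves the positive
      -- rows.
      have hk₁ : a < k₁ + 1 := (col_le_iff hR.inTable).1 (by
        rw [hbump.meet.left]
        exact hbump.meet.col_le)
      have hlt := hbump.lt
      obtain ⟨R', k₀, h1, h2, h3⟩ := ih k₁.toNat (by omega) hR (by omega)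
        ((isOpenSpace_iff hR.inTable).2 ⟨a, b, ha, hb, hbump.meet⟩) rfl
      exact ⟨R', k₀, h1, h2, h3.step ha hb hbump h (by omega) hnot⟩

end RCGraph
namespace RCGraph
variable {n : ℕ} {R U : Finset (ℤ × ℤ)} {w : Equiv.Perm ℤ}

/-! ### The bottom rc-graph of a permutation -/

/-- The number of labels less than `k` whose value exceeds the value of `a`. -/
noncomputable def rank (w : Equiv.Perm ℤ) (k a : ℤ) : ℕ :=
  {b | b < k ∧ w a < w b}.ncard

theorem rank_finite (hw : IsFinPerm n w) (k a : ℤ) : {b | b < k ∧ w a < w b}.Finite := by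
  obtain ⟨N, hN⟩ := hw.2
  refine (Set.finite_Icc (min N (w a)) k).subset ?_
  rintro b ⟨h1, h2⟩
  refine ⟨?_, h1.le⟩
  by_contra h3
  rw [hN b (by omega)] at h2
  omega

theorem rank_lt_rank (hw : IsFinPerm n w) {k a b : ℤ} (hb : b < k) (hab : w a < w b) :
    rank w k b < rank w k a := by
  refine Set.ncard_lt_ncard ⟨fun x hx => ⟨hx.1, hab.trans hx.2⟩, fun h => ?_⟩ (rank_finite hw k a)
  exact absurd (h (show b ∈ _ from ⟨hb, hab⟩)).2 (lt_irrefl _)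

theorem rank_le_rank (hw : IsFinPerm n w) {k a b : ℤ} (hab : w a ≤ w b) :
    rank w k b ≤ rank w k a :=
  Set.ncard_le_ncard (fun _ hx => ⟨hx.1, hab.trans_lt hx.2⟩) (rank_finite hw k a)

theorem rank_lt_iff (hw : IsFinPerm n w) {k a b : ℤ} (hb : b < k) :
    rank w k b < rank w k a ↔ w a < w b := by
  refine ⟨fun h => ?_, rank_lt_rank hw hb⟩
  by_contra! h1
  have := rank_le_rank hw (k := k) h1
  omega

theorem rank_succ_of_lt (hw : IsFinPerm n w) {k a : ℤ} (h : w a < w k) :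
    rank w (k + 1) a = rank w k a + 1 := by
  have : {b | b < k + 1 ∧ w a < w b} = insert k {b | b < k ∧ w a < w b} := by
    ext b
    simp only [Set.mem_ofPred_eq, Set.mem_insert_iff]
    constructor
    · rintro ⟨h1, h2⟩
      rcases eq_or_ne b k with h3 | h3
      · exact Or.inl h3
      · exact Or.inr ⟨by omega, h2⟩
    · rintro (rfl | ⟨h1, h2⟩)
      · exact ⟨by omega, h⟩
      · exact ⟨by omega, h2⟩
  rw [rank, this, Set.ncard_insert_of_notMem (by simp) (rank_finite hw k a)]
  rfl

theorem rank_succ_of_le {k a : ℤ} (h : w k ≤ w a) : rank w (k + 1) a = rank w k a := by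
  have : {b | b < k + 1 ∧ w a < w b} = {b | b < k ∧ w a < w b} := by
    ext b
    simp only [Set.mem_ofPred_eq]
    constructor
    · rintro ⟨h1, h2⟩
      refine ⟨?_, h2⟩
      by_contra h3
      obtain rfl : b = k := by omega
      omega
    · rintro ⟨h1, h2⟩
      exact ⟨by omega, h2⟩
  rw [rank, this, rank]

theorem rank_self_eq_zero {N : ℤ} (hN : ∀ i < N, w i = i) {k : ℤ} (hk : k < N) :
    rank w k k = 0 := by
  have : {b | b < k ∧ w k < w b} = ∅ := by
    ext b
    simp only [Set.mem_ofPred_eq, Set.mem_empty_iff_false, iff_false]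
    rintro ⟨h1, h2⟩
    rw [hN k hk, hN b (by omega)] at h2
    omega
  rw [rank, this, Set.ncard_empty]

theorem rank_top (hw : IsFinPerm n w) {a : ℤ} (ha : a ≤ n) :
    (rank w (n + 1) a : ℤ) = n - w a := by
  have h1 : w '' {b | b < (n : ℤ) + 1 ∧ w a < w b} = (Finset.Ioc (w a) n : Set ℤ) := by
    ext y
    simp only [Set.mem_image, Set.mem_ofPred_eq, Finset.coe_Ioc, Set.mem_Ioc]
    constructor
    · rintro ⟨b, ⟨h1, h2⟩, rfl⟩
      exact ⟨h2, (apply_le_iff hw).2 (by omega)⟩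
    · rintro ⟨h1, h2⟩
      refine ⟨w.symm y, ⟨?_, by simpa using h1⟩, by simp⟩
      have := (apply_le_iff hw.symm).2 h2
      omega
  have h2 := w.injective.injOn.ncard_image (s := {b | b < (n : ℤ) + 1 ∧ w a < w b})
  rw [h1, Set.ncard_coe_finset, Int.card_Ioc] at h2
  have := (apply_le_iff hw).2 ha
  rw [rank, ← h2]
  omega

theorem rank_of_gt (hw : IsFinPerm n w) {k : ℤ} (hk : (n : ℤ) < k) : rank w k k = 0 := by
  have : {b | b < k ∧ w k < w b} = ∅ := by
    ext b
    simp only [Set.mem_ofPred_eq, Set.mem_empty_iff_false, iff_false]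
    rintro ⟨h1, h2⟩
    rw [hw.1 k hk] at h2
    rcases le_or_gt b n with h3 | h3
    · have := (apply_le_iff hw).2 h3
      omega
    · rw [hw.1 b h3] at h2
      omega
  rw [rank, this, Set.ncard_empty]

/-- The left-justified rc-graph of `w`. -/
def IsBottom (n : ℕ) (w : Equiv.Perm ℤ) (R : Finset (ℤ × ℤ)) : Prop :=
  ∀ i k, (i, k) ∈ R ↔ i ≤ n ∧ (n : ℤ) - i < rank w k k

theorem exists_isBottom (hw : IsFinPerm n w) : ∃ R, IsBottom n w R := by
  obtain ⟨N, hN⟩ := hw.2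
  refine ⟨(Finset.Icc N n).biUnion fun k =>
    (Finset.Ioc ((n : ℤ) - rank w k k) n).image fun i => (i, k), fun i k => ?_⟩
  simp only [Finset.mem_biUnion, Finset.mem_Icc, Finset.mem_image, Finset.mem_Ioc, Prod.mk.injEq]
  constructor
  · rintro ⟨k', -, i', h, rfl, rfl⟩
    omega
  · rintro ⟨h1, h2⟩
    refine ⟨k, ⟨?_, ?_⟩, i, ⟨by omega, h1⟩, rfl, rfl⟩
    · by_contra h3
      rw [rank_self_eq_zero hN (by omega)] at h2
      omega
    · by_contra h3
      rw [rank_of_gt hw (by omega)] at h2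
      omega

namespace IsBottom

theorem inTable (hw : IsFinPerm n w) (h : IsBottom n w R) : InTable n R := by
  rintro ⟨i, k⟩ hp
  rw [h] at hp
  refine ⟨hp.1, ?_⟩
  by_contra h1
  rw [rank_of_gt hw (by simpa using h1)] at hp
  omega

/-- The strands already started by row `k` fill the columns from `n` rightwards in the order of
their values. In row `k` the new strand crosses exactly the strands with larger values and pushes
each of the others one column to the right. -/
theorem col_eq (hw : IsFinPerm n w) (h : IsBottom n w R) {k a : ℤ} (hak : a < k) :
    col n R k a = n - rank w k a := by
  have hT := h.inTable hw
  replace hak : a + 1 ≤ k := hak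
  induction k, hak using Int.leInduction with
  | base =>
    rw [col_succ hT, col_of_le le_rfl, rank_succ_of_le le_rfl]
    apply exitCol_eq_of
    · rw [h]; omega
    · rw [h]; omega
    · omega
    · intro x h1 h2
      rw [h]; omega
  | succ k hak ih =>
    rw [col_succ hT, ih]
    rcases lt_or_gt_of_ne (w.injective.ne (show a ≠ k by omega)) with h1 | h1
    · rw [rank_succ_of_lt hw h1]
      have := rank_le_rank hw (k := k) h1.le
      rw [exitCol_eq_of (d := (n : ℤ) - ((rank w k a + 1 : ℕ) : ℤ))]
      · rw [h]; omega
      · rw [h]; omega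
      · omega
      · omega
    · rw [rank_succ_of_le h1.le, exitCol_of_mem]
      have := rank_lt_rank hw (show a < k by omega) h1
      rw [h]; omega

theorem col_lt_iff (hw : IsFinPerm n w) (h : IsBottom n w R) {k a b : ℤ} (hba : b < a)
    (hak : a < k) : col n R k a < col n R k b ↔ w a < w b := by
  rw [h.col_eq hw hak, h.col_eq hw (by omega), ← rank_lt_iff hw (k := k) (by omega)]
  omega

theorem red (hw : IsFinPerm n w) (h : IsBottom n w R) : Red n R := by
  refine ⟨h.inTable hw, fun {k a b} hba h1 => ?_⟩
  have hak : a < k := by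
    by_contra! hak
    rw [col_of_le hak] at h1
    rcases lt_or_ge b k with h2 | h2
    · have := (col_le_iff (h.inTable hw)).2 h2
      omega
    · rw [col_of_le h2] at h1
      omega
  rw [h.col_lt_iff hw hba hak] at h1
  rwa [h.col_lt_iff hw hba (by omega)]

theorem hasPerm (hw : IsFinPerm n w) (h : IsBottom n w R) : HasPerm n R w := by
  rw [hasPerm_iff (h.inTable hw)]
  intro a
  rcases le_or_gt a n with ha | ha
  · rw [h.col_eq hw (by omega), rank_top hw ha]
    ring
  · rw [col_of_le (by omega), hw.1 a ha]
    ring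

end IsBottom

theorem exists_red (hw : IsFinPerm n w) : ∃ R, Red n R ∧ HasPerm n R w := by
  obtain ⟨R, hR⟩ := exists_isBottom hw
  exact ⟨R, hR.red hw, hR.hasPerm hw⟩

theorem mem_graphs_iff : R ∈ graphs n w ↔ Red n R ∧ HasPerm n R w := by
  rw [graphs, Set.mem_ofPred_eq, isRC_iff]

theorem graphs_nonempty (hw : IsFinPerm n w) : (graphs n w).Nonempty := by
  obtain ⟨R, hR⟩ := exists_red hw
  exact ⟨R, mem_graphs_iff.2 hR⟩

/-- The bound holds because strand `a` starts in row `a`. It gives both the finiteness of `graphs`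
and the triangularity of the Schubert polynomials. -/
theorem Red.inv_of_crosses (h : Red n R) (hw : HasPerm n R w) {k a b : ℤ}
    (hc : Crosses n R k a b) : (a, b) ∈ invSet w ∧ a ≤ k := by
  have h1 := (crosses_iff h.inTable).1 hc
  have h2 := h.inTable _ h1.1
  simp only at h2
  have h3 : a < k + 1 := (col_le_iff h.inTable).1 (by omega)
  have h4 := h.lt_of_crosses hc
  refine ⟨⟨h4, ?_⟩, by omega⟩
  simp only
  rw [← (hasPerm_iff h.inTable).1 hw, ← (hasPerm_iff h.inTable).1 hw]
  exact h.persist h4 (by omega) hc.2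

/-- All places lie in one square. Their rows are at least the larger label of an inversion; columns
only decrease upwards, so they are at least the final column of the strand entering from below. -/
theorem graphs_finite (hw : IsFinPerm n w) : (graphs n w).Finite := by
  obtain ⟨N, hN⟩ := hw.2
  refine ((Finset.Icc N (n : ℤ) ×ˢ Finset.Icc N (n : ℤ)).powerset).finite_toSet.subset ?_
  intro R hR
  rw [mem_graphs_iff] at hR
  obtain ⟨h, hR⟩ := hR
  rw [Finset.mem_coe, Finset.mem_powerset]
  rintro ⟨i, k⟩ hp
  obtain ⟨a, b, hc, hb⟩ := exists_crosses_of_mem h.inTable hp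
  simp only at hc hb
  obtain ⟨h1, h2⟩ := h.inv_of_crosses hR hc
  have h3 := invSet_subset hw hN h1
  have h4 := h.inTable _ hp
  have h5 := col_antitone (n := n) h.inTable b (show k ≤ n + 1 by omega)
  rw [(hasPerm_iff h.inTable).1 hR] at h5
  simp only [Set.mem_prod, Set.mem_Icc] at h3
  have h6 := (le_apply_iff hN).2 h3.2.1
  simp only [Finset.mem_product, Finset.mem_Icc]
  omega

/-! ### Inserting one number -/

/-- `w` is increasing on the nonpositive integers. -/
def IncNonpos (w : Equiv.Perm ℤ) : Prop := ∀ i ≤ 0, w (i - 1) < w i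

theorem IncNonpos.lt (hw : IncNonpos w) {x y : ℤ} (hxy : x < y) (hy : y ≤ 0) : w x < w y := by
  replace hxy : x + 1 ≤ y := hxy
  induction y, hxy using Int.leInduction with
  | base => simpa using hw (x + 1) hy
  | succ y hxy ih =>
    refine (ih (by omega)).trans ?_
    simpa using hw (y + 1) hy

/-- The data of a cover `w < w s_{c,d}`. -/
structure Cover (n : ℕ) (w : Equiv.Perm ℤ) (c d : ℤ) : Prop where
  pos : 0 < c
  le : c ≤ n
  nonpos : d ≤ 0
  length_eq : length n (w * Equiv.swap c d) = length n w + 1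

theorem Cover.isFinPerm (hw : IsFinPerm n w) {c d : ℤ} (h : Cover n w c d) :
    IsFinPerm n (w * Equiv.swap c d) :=
  hw.mul (isFinPerm_swap h.le (by have := h.nonpos; omega))

/-- The end of the insertion. -/
theorem final_cover (hR : Red n R) (hw : HasPerm n R w) {i k a b : ℤ} (ha : 0 < a) (hb : b ≤ 0)
    (h : Meet n R i k a b) (hred : Red n (insert (i, k) R)) :
    HasPerm n (insert (i, k) R) (w * Equiv.swap a b) ∧ Cover n w a b := by
  have hu := (h.toggle hR.inTable).hasPerm_iff.1 hw
  have hak : a < k + 1 := (col_le_iff hR.inTable).1 (by rw [h.left]; exact h.col_le)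
  have := h.row_le
  refine ⟨hu, ha, by omega, hb, ?_⟩
  rw [← hred.card_eq_length hu, ← hR.card_eq_length hw, Finset.card_insert_of_notMem h.notMem]

/-- Removing the intersection which corresponds to a cover. -/
theorem exists_meet_of_cover (hU : Red n U) (hw : IsFinPerm n w) {c d : ℤ} (h : Cover n w c d)
    (hu : HasPerm n U (w * Equiv.swap c d)) :
    ∃ V i k, Red n V ∧ HasPerm n V w ∧ Meet n V i k c d ∧ U = insert (i, k) V := by
  have hc := h.pos
  have hd := h.nonpos
  have hT := hU.inTable
  have hlen := h.length_eq
  -- If `(c, d)` were an inversion of `w`, removing its crossing from an rc-graph of `w` would leave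
  -- too few places for the longer permutation `w s_{c,d}`.
  have hinv : w d < w c := by
    by_contra! hle
    have hlt : w c < w d := lt_of_le_of_ne hle (w.injective.ne (by omega))
    obtain ⟨R, hR, hRw⟩ := exists_red hw
    obtain ⟨k, hk⟩ := exists_crosses_of_inv hR.inTable hRw
      (show (c, d) ∈ invSet w from ⟨by simp only; omega, hlt⟩)
    simp only at hk
    have ht := toggle_erase hR.inTable hk
    have hp : HasPerm n (R.erase (col n R k d, k)) (w * Equiv.swap c d) := by
      rw [ht.hasPerm_iff, mul_assoc, Equiv.swap_mul_self, mul_one]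
      exact hRw
    have h1 := inv_le_card ht.left hp
    rw [Finset.card_erase_of_mem ht.mem, hR.card_eq_length hRw,
      ← RCGraph.length_eq (h.isFinPerm hw)] at h1
    omega
  obtain ⟨k, hk⟩ := exists_crosses_of_inv hT hu
    (show (c, d) ∈ invSet (w * Equiv.swap c d) from ⟨by simp only; omega, by simpa using hinv⟩)
  simp only at hk
  have ht := toggle_erase hT hk
  have hm := hT _ ht.mem
  have hp : HasPerm n (U.erase (col n U k d, k)) w := ht.hasPerm_iff.2 hu
  -- Exactly `length n w` places remain and the permutation is `w`, so the count gives reducedness.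
  refine ⟨_, col n U k d, k, red_of_card_le_length ht.left hp ?_, hp,
    ⟨hm.1, hm.2, ht.notMem, ht.col_left, ht.col_bottom⟩, (Finset.insert_erase ht.mem).symm⟩
  rw [Finset.card_erase_of_mem ht.mem, hU.card_eq_length hu, hlen]
  omega

theorem swap_eq_swap {a b c d : ℤ} (h : Equiv.swap a b = Equiv.swap c d) (ha : 0 < a) (hb : b ≤ 0)
    (hd : d ≤ 0) : a = c ∧ b = d := by
  have h1 := Equiv.congr_fun h a
  have h2 := Equiv.congr_fun h b
  rw [Equiv.swap_apply_left] at h1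
  rw [Equiv.swap_apply_right] at h2
  simp only [Equiv.swap_apply_def] at h1 h2
  split_ifs at h1 h2 <;> omega

/-- For nonpositive `x > d` one has `w x > w c`. Otherwise the strand `x` would be between `d` and
`c` where they meet, so `c` would cross it there, although `c` and `x` are not inverted by `w`. -/
theorem Cover.incNonpos (hw : IsFinPerm n w) (hinc : IncNonpos w) {c d : ℤ} (h : Cover n w c d) :
    IncNonpos (w * Equiv.swap c d) := by
  have hc := h.pos
  have hd := h.nonpos
  obtain ⟨U, hU, hu⟩ := exists_red (h.isFinPerm hw)
  obtain ⟨V, i, k, hV, hVw, hm, rfl⟩ := exists_meet_of_cover hU hw h hu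
  have hT := hV.inTable
  have hwV := (hasPerm_iff hT).1 hVw
  have hinv : w d < w c := by
    have h1 := hm.lt_col hT
    have h2 := hm.bottom
    by_contra! h3
    have h4 : w c < w d := lt_of_le_of_ne h3 (w.injective.ne (by omega))
    exact hm.not_red_insert hV (by omega) (by rwa [hwV, hwV]) hU
  have key : ∀ x ≤ 0, d < x → w c < w x := by
    intro x hx hdx
    have hdx' := hinc.lt hdx hx
    by_contra! h3
    have h4 : w x < w c := lt_of_le_of_ne h3 (w.injective.ne (by omega))
    have hkn := hm.row_le
    have h5 := hV.persist' (k := k) (l := n + 1) (a := x) (b := d) (by omega) (by omega)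
      (by rwa [hwV, hwV])
    have h6 := hV.persist' (k := k) (l := n + 1) (a := c) (b := x) (by omega) (by omega)
      (by rwa [hwV, hwV])
    have h7 := hm.crosses_between hT (by rwa [hm.bottom] at h5) h6
    have h8 := hV.persist (l := n + 1) (by omega) (by omega) h7.2
    rw [hwV, hwV] at h8
    omega
  intro x hx
  have h1 := hinc x hx
  rw [Equiv.Perm.mul_apply, Equiv.Perm.mul_apply]
  rcases eq_or_ne x d with rfl | h2
  · rw [Equiv.swap_apply_right, Equiv.swap_apply_of_ne_of_ne (by omega) (by omega)]
    omega
  · rw [Equiv.swap_apply_of_ne_of_ne (show x ≠ c by omega) h2]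
    rcases eq_or_ne (x - 1) d with h3 | h3
    · rw [h3, Equiv.swap_apply_right]
      exact key x hx (by omega)
    · rwa [Equiv.swap_apply_of_ne_of_ne (by omega) h3]

end RCGraph
namespace RCGraph
variable {n : ℕ} {R V W U : Finset (ℤ × ℤ)} {w : Equiv.Perm ℤ}

/-! ### Strands with nonpositive labels do not intersect -/

/-- Such strands end in the order of their labels, and in a reduced set strands which have crossed
stay crossed. -/
theorem Red.col_lt_of_nonpos (h : Red n R) (hw : HasPerm n R w) (hinc : IncNonpos w) {k x y : ℤ}
    (hk : k ≤ n + 1) (hxy : x < y) (hy : y ≤ 0) : col n R k x < col n R k y := by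
  refine h.persist' hxy hk ?_
  rw [(hasPerm_iff h.inTable).1 hw, (hasPerm_iff h.inTable).1 hw]
  exact hinc.lt hxy hy

theorem Red.col_le_of_nonpos (h : Red n R) (hw : HasPerm n R w) (hinc : IncNonpos w) {k x y : ℤ}
    (hk : k ≤ n + 1) (hxy : x ≤ y) (hy : y ≤ 0) : col n R k x ≤ col n R k y := by
  rcases hxy.lt_or_eq with h1 | rfl
  · exact (h.col_lt_of_nonpos hw hinc hk h1 hy).le
  · exact le_rfl

/-- A nonpositive strand coming from the left would cross one with a smaller, hence also
nonpositive, label. -/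
theorem Red.posAt_of_mem (h : Red n R) (hw : HasPerm n R w) (hinc : IncNonpos w) {k b : ℤ}
    (hm : (col n R k b, k) ∈ R) : PosAt n R k (col n R k b) := by
  obtain ⟨a, h1, h2⟩ := exists_left h.inTable k (col n R k b)
  rw [posAt_iff h.inTable h1 h2]
  by_contra ha
  have hc := (crosses_iff h.inTable).2 ⟨hm, h1, h2⟩
  have h3 := h.col_lt_of_nonpos (k := k + 1) hw hinc
    (by have := (h.inTable _ hm).2; simp only at this; omega) (h.lt_of_crosses hc) (by omega)
  have := hc.2
  omega

/-- A positive strand entering from below either turns right, or is crossed by a strand with a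
larger label; in both cases it is noticed by the search along the row. -/
theorem Red.nonpos_of_not_posAt (h : Red n R) {k x : ℤ}
    (h1 : ¬ PosAt n R k (col n R k x)) (h2 : ¬ PosAt n R k (col n R k x - 1)) : x ≤ 0 := by
  by_contra! hx
  by_cases hm : (col n R k x, k) ∈ R
  · obtain ⟨a, h3, h4⟩ := exists_left h.inTable k (col n R k x)
    rw [posAt_iff h.inTable h3 h4] at h1
    have := h.lt_of_crosses ((crosses_iff h.inTable).2 ⟨hm, h3, h4⟩)
    omega
  · have h3 : col n R (k + 1) x < col n R k x := by
      rw [col_succ h.inTable]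
      exact exitCol_lt hm
    exact h2 ⟨x, hx, by omega, by omega⟩

/-- To go further right, `b` would have to cross a strand with a smaller label, and nonpositive
strands do not cross. -/
theorem Meet.col_succ_bottom (h : Red n R) (hw : HasPerm n R w) (hinc : IncNonpos w)
    {i k a b : ℤ} (hm : Meet n R i k a b) (hb : b ≤ 0) : col n R (k + 1) b = i - 1 := by
  have hT := h.inTable
  have h1 := hm.col_lt hT
  by_contra hne
  have h2 : (i - 1, k) ∈ R := by
    have h3 := hm.bottom
    exact col_between hT (a := b) (by omega) (by omega)
  obtain ⟨x, hx⟩ := (col_bijective hT k).2 (i - 1)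
  have h3 := hm.bottom
  have hc : Crosses n R k b x := (crosses_iff hT).2 ⟨by rwa [hx], by omega, by omega⟩
  have hxb := h.lt_of_crosses hc
  have := h.col_lt_of_nonpos (k := k + 1) hw hinc (by have := hm.row_le; omega) hxb hb
  have := hc.2
  omega

/-! ### One insertion -/

/-- The insertion of `k` into `R` gives `U`, and the strands labeled `c` and `d` are those which
intersect in `U` at the place put in last. -/
def Insertion (n : ℕ) (R : Finset (ℤ × ℤ)) (k : ℤ) (U : Finset (ℤ × ℤ)) (c d : ℤ) : Prop :=
  ∃ V i y, Reach n R k V i y ∧ Red n (insert (i, y) V) ∧ U = insert (i, y) V ∧ 0 < c ∧ d ≤ 0 ∧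
    Meet n V i y c d

theorem insertFrom_iff_insertion {k : ℤ} (hR : Red n R) :
    InsertFrom n R k Set.univ U ↔ ∃ c d, Insertion n R k U c d := by
  rw [insertFrom_univ_iff hR]
  constructor
  · rintro ⟨V, i, y, h1, h2, h3⟩
    obtain ⟨a, b, ha, hb, hm⟩ := (isOpenSpace_iff (h1.red hR).inTable).1 h1.isOpenSpace
    exact ⟨a, b, V, i, y, h1, h2, h3, ha, hb, hm⟩
  · rintro ⟨c, d, V, i, y, h1, h2, h3, -⟩
    exact ⟨V, i, y, h1, h2, h3⟩

theorem Insertion.spec {k c d : ℤ} (h : Insertion n R k U c d) (hR : Red n R)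
    (hw : HasPerm n R w) :
    Red n U ∧ HasPerm n U (w * Equiv.swap c d) ∧ Cover n w c d := by
  obtain ⟨V, i, y, h1, h2, rfl, hc, hd, hm⟩ := h
  exact ⟨h2, final_cover (h1.red hR) ((h1.hasPerm hR).2 hw) hc hd hm h2⟩

theorem exists_insertion {c d : ℤ} (hU : Red n U) (hw : IsFinPerm n w) (h : Cover n w c d)
    (hu : HasPerm n U (w * Equiv.swap c d)) :
    ∃ (R : Finset (ℤ × ℤ)) (k : ℤ), Red n R ∧ HasPerm n R w ∧ 0 < k ∧ k ≤ n ∧ Insertion n R k U c d := by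
  obtain ⟨V, i, y, hV, hVw, hm, rfl⟩ := exists_meet_of_cover hU hw h hu
  have hc := h.pos
  have hy : c < y + 1 := (col_le_iff hV.inTable).1 (by rw [hm.left]; exact hm.col_le)
  obtain ⟨R, k, hR, hk, hreach⟩ := exists_reach hV (show 0 < y by omega)
    ((isOpenSpace_iff hV.inTable).2 ⟨c, d, hc, h.nonpos, hm⟩)
  exact ⟨R, k, hR, (hreach.hasPerm hR).1 hVw, hk, hreach.le.trans hm.row_le,
    V, i, y, hreach, hU, rfl, hc, h.nonpos, hm⟩

/-- In the result the strands `c` and `d` cross only once, so the place put in last is determined,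
and from there the insertion can be run backwards. -/
theorem Insertion.unique {R' : Finset (ℤ × ℤ)} {k k' c d : ℤ} (hR : Red n R) (hR' : Red n R')
    (h : Insertion n R k U c d) (h' : Insertion n R' k' U c d) : R = R' ∧ k = k' := by
  obtain ⟨V, i, y, h1, h2, rfl, -, -, hm⟩ := h
  obtain ⟨V', i', y', h1', -, heq, -, -, hm'⟩ := h'
  have key : ∀ {V i y}, InTable n V → Meet n V i y c d →
      Crosses n (insert (i, y) V) y c d ∧ col n (insert (i, y) V) y d = i := by
    intro V i y hT hm
    have ht := hm.toggle hT
    rw [crosses_iff ht.right, ht.col_le le_rfl, ht.col_le le_rfl, ht.col_gt (by omega),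
      Equiv.swap_apply_left, hm.bottom]
    exact ⟨⟨ht.mem, (hm.col_lt hT).le, hm.lt_col hT⟩, rfl⟩
  have hc := key (h1.red hR).inTable hm
  have hc' := key (h1'.red hR').inTable hm'
  rw [← heq] at hc'
  obtain rfl := h2.crosses_row_unique hc.1 hc'.1
  obtain rfl := hc.2.symm.trans hc'.2
  obtain rfl : V = V' := by
    rw [← Finset.erase_insert hm.notMem, heq, Finset.erase_insert hm'.notMem]
  exact h1.unique hR hR' h1'

/-! ### The trail of an insertion -/

/-- A description of the part below row `y` of the trail left in `V` by an insertion which began in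
row `k₀`: in row `z` it moves along the strands labeled `α z` and `β z`. -/
structure Trail (n : ℕ) (V : Finset (ℤ × ℤ)) (k₀ y : ℤ) (α β : ℤ → ℤ) : Prop where
  pos : ∀ z, k₀ ≤ z → z < y → 0 < α z
  nonpos : ∀ z, k₀ ≤ z → z < y → β z ≤ 0
  lt : ∀ z, k₀ ≤ z → z < y → col n V (z + 1) (α z) < col n V (z + 1) (β z)
  gt : ∀ z, k₀ ≤ z → z < y → ∀ x < β z, col n V (z + 1) x < col n V (z + 1) (α z)
  mem : ∀ z, k₀ ≤ z → z < y → (col n V z (β z), z) ∈ V ∨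
    (k₀ < z ∧ α z = α (z - 1) ∧ β z = β (z - 1))
  gap : ∀ z, k₀ ≤ z → z < y → (k₀ < z ∧ β z = β (z - 1)) ∨
    ∀ x, 0 < x → col n V z x < col n V z (β z) →
      k₀ < z ∧ col n V z x < col n V z (β (z - 1))
  mono : ∀ z, k₀ < z → z < y → β (z - 1) ≤ β z

/-- The trail grows from row `y` to row `y'` when `(i, y)` is put in. The exchanged strands `a` and
`b` are followed until row `y'`, where the crossing is removed, or up to the top row in the last
step. -/
theorem Trail.extend {k₀ y y' i a b : ℤ} {α β : ℤ → ℤ} (h : Trail n V k₀ y α β) (hk : k₀ ≤ y)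
    (hy : y < y') (ha : 0 < a) (hb : b ≤ 0)
    (hgap : ∀ x, 0 < x → col n V y x < col n V y b →
      k₀ < y ∧ col n V y x < col n V y (β (y - 1)))
    (hmono : k₀ < y → β (y - 1) ≤ b)
    (hlow : ∀ z ≤ y, ∀ x, col n W z x = col n V z x)
    (hhigh : ∀ z, y < z → z ≤ y' → ∀ x, col n W z x = col n V z (Equiv.swap a b x))
    (hmemlow : ∀ c z, z < y → (c, z) ∈ V → (c, z) ∈ W) (hmem : (i, y) ∈ W)
    (hi : col n V y b = i)
    (hab : ∀ z, y < z → z ≤ y' → col n V z b < col n V z a)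
    (hlt : ∀ z, y < z → z ≤ y' → ∀ x < b, col n V z x < col n V z b) :
    Trail n W k₀ y' (fun z => if z < y then α z else a) (fun z => if z < y then β z else b) where
  pos z h1 h2 := by
    split_ifs with hz
    · exact h.pos z h1 hz
    · exact ha
  nonpos z h1 h2 := by
    split_ifs with hz
    · exact h.nonpos z h1 hz
    · exact hb
  lt z h1 h2 := by
    split_ifs with hz
    · rw [hlow _ (by omega), hlow _ (by omega)]
      exact h.lt z h1 hz
    · rw [hhigh _ (by omega) (by omega), hhigh _ (by omega) (by omega), Equiv.swap_apply_left,
        Equiv.swap_apply_right]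
      exact hab _ (by omega) (by omega)
  gt z h1 h2 x hx := by
    split_ifs at hx ⊢ with hz
    · rw [hlow _ (by omega), hlow _ (by omega)]
      exact h.gt z h1 hz x hx
    · rw [hhigh _ (by omega) (by omega), hhigh _ (by omega) (by omega), Equiv.swap_apply_left,
        Equiv.swap_apply_of_ne_of_ne (by omega) (by omega)]
      exact hlt _ (by omega) (by omega) x hx
  mem z h1 h2 := by
    rcases lt_trichotomy z y with hz | rfl | hz
    · rw [if_pos hz, if_pos hz, if_pos (show z - 1 < y by omega),
        if_pos (show z - 1 < y by omega), hlow _ (by omega)]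
      exact (h.mem z h1 hz).imp_left (hmemlow _ _ hz)
    · rw [if_neg (lt_irrefl _), hlow _ le_rfl, hi]
      exact Or.inl hmem
    · rw [if_neg (by omega), if_neg (by omega), if_neg (by omega), if_neg (by omega)]
      exact Or.inr ⟨by omega, rfl, rfl⟩
  gap z h1 h2 := by
    rcases lt_trichotomy z y with hz | rfl | hz
    · simp only [if_pos hz, if_pos (show z - 1 < y by omega), hlow _ hz.le]
      exact h.gap z h1 hz
    · simp only [if_neg (lt_irrefl z), if_pos (show z - 1 < z by omega), hlow _ le_rfl]
      exact Or.inr hgap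
    · rw [if_neg (by omega), if_neg (by omega)]
      exact Or.inl ⟨by omega, rfl⟩
  mono z h1 h2 := by
    rcases lt_trichotomy z y with hz | rfl | hz
    · rw [if_pos hz, if_pos (by omega)]
      exact h.mono z h1 hz
    · rw [if_neg (lt_irrefl z), if_pos (by omega)]
      exact hmono h1
    · rw [if_neg (by omega), if_neg (by omega)]

theorem Trail.monotone {k₀ y : ℤ} {α β : ℤ → ℤ} (h : Trail n V k₀ y α β) {z z' : ℤ} (hz : k₀ ≤ z)
    (hzz : z ≤ z') (hz' : z' < y) : β z ≤ β z' := by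
  induction z', hzz using Int.leInduction with
  | base => exact le_rfl
  | succ x hx ih =>
    have := h.mono (x + 1) (by omega) hz'
    rw [add_sub_cancel_right] at this
    exact (ih (by omega)).trans this

/-- The nonpositive labels increase along an insertion. -/
theorem Bump.label_le (hR : Red n R) (hw : HasPerm n R w) (hinc : IncNonpos w)
    {i k l k' a b i' a' b' : ℤ} (h : Bump n R V i k l k' a b) (hb : b ≤ 0)
    (hm : Meet n V i' k' a' b') (ha' : 0 < a') (hl : l < i') : b ≤ b' := by
  have hT := hR.inTable
  have hV := (h.red_iff hT).2 hR
  by_contra! hlt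
  have h1 := hV.col_lt_of_nonpos (k := k') ((h.hasPerm hT).2 hw) hinc
    (by have := hm.row_le; omega) hlt hb
  rw [hm.bottom] at h1
  -- The nonpositive strand `b` then passes the column `i'` from the left, where an open space has a
  -- positive strand.
  have h2 := (h.meet_right hT).left
  have h3 := (posAt_iff hV.inTable (by omega) h1).1 ((hm.posAt hV.inTable).2 ha')
  omega

theorem Reach.exists_trail {k₀ i y a b : ℤ} (hR : Red n R) (hw : HasPerm n R w)
    (hinc : IncNonpos w) (h : Reach n R k₀ V i y) (hm : Meet n V i y a b) (ha : 0 < a) :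
    ∃ α β, Trail n V k₀ y α β ∧ (∀ x, 0 < x → col n V y x < col n V y b →
      k₀ < y ∧ col n V y x < col n V y (β (y - 1))) ∧ (k₀ < y → β (y - 1) ≤ b) := by
  induction h generalizing a b with
  | start h1 h2 =>
    -- No row lies below the start, so the labels chosen here are irrelevant.
    refine ⟨fun _ => 0, fun _ => 0, ⟨?_, ?_, ?_, ?_, ?_, ?_, ?_⟩, fun x hx hlt => ?_, ?_⟩
    any_goals intros; omega
    rw [hm.bottom] at hlt
    have := hR.nonpos_of_not_posAt (h2 _ hlt) (h2 _ (by omega))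
    omega
  | @step V W i k l k' a₁ b₁ i' h ha₁ hb₁ hbump h4 h5 h6 ih =>
    obtain ⟨α, β, h7, h8, h9⟩ := ih hbump.meet ha₁
    have hV := h.red hR
    have hT := hV.inTable
    have hVw := (h.hasPerm hR).2 hw
    have hW := (hbump.red_iff hT).2 hV
    have hlt := hbump.lt
    have hle := hbump.row_le hT
    refine ⟨_, _, h7.extend (y' := k') (i := i) h.le hlt ha₁ hb₁ h8 h9
      (fun z hz x => hbump.col_low hT hz x) (fun z hz hz' x => hbump.col_mid hT hz hz' x)
      ?_ ?_ hbump.meet.bottom ?_ ?_, ?_, ?_⟩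
    · intro c z hz hcz
      rw [hbump.eq, Finset.mem_erase, Ne, Prod.mk.injEq]
      exact ⟨by omega, Finset.mem_insert_of_mem hcz⟩
    · rw [hbump.eq, Finset.mem_erase, Ne, Prod.mk.injEq]
      exact ⟨by omega, Finset.mem_insert_self _ _⟩
    · exact fun z hz hz' => hV.persist' (by omega) hz' hbump.crosses.1
    · exact fun z hz hz' x hx => hV.col_lt_of_nonpos hVw hinc (by omega) hx hb₁
    · intro x hx hlt'
      rw [hm.bottom] at hlt'
      refine ⟨by have := h.le; omega, ?_⟩
      rw [if_neg (by omega)]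
      by_contra! hcon
      have hl := (hbump.meet_right hT).lt_col hW.inTable
      have := hW.nonpos_of_not_posAt (h6 _ (by omega) hlt') (h6 _ (by omega) (by omega))
      omega
    · intro _
      rw [if_neg (by omega)]
      exact hbump.label_le hV hVw hinc hb₁ hm ha h5

theorem Meet.not_crossed (hR : Red n R) {i y a b : ℤ} (hm : Meet n R i y a b) (hab : b < a)
    (hred : Red n (insert (i, y) R)) {z : ℤ} (hz : z ≤ n + 1) : col n R z b < col n R z a := by
  refine hR.persist' hab hz ?_
  by_contra! h
  have h1 : col n R (n + 1) a ≠ col n R (n + 1) b := by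
    rw [Ne, col_inj hR.inTable]
    exact hab.ne'
  exact hm.not_red_insert hR hab (by omega) hred

theorem Insertion.exists_trail {k c d : ℤ} (h : Insertion n R k U c d) (hR : Red n R)
    (hw : HasPerm n R w) (hinc : IncNonpos w) :
    k ≤ n ∧ ∃ α β, Trail n U k (n + 1) α β ∧ β n = d := by
  obtain ⟨V, i, y, h1, h2, rfl, hc, hd, hm⟩ := h
  have hV := h1.red hR
  have hVw := (h1.hasPerm hR).2 hw
  have hle := hm.row_le
  obtain ⟨α, β, h3, h4, h5⟩ := h1.exists_trail hR hw hinc hm hc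
  have ht := hm.toggle hV.inTable
  refine ⟨h1.le.trans hle, _, _, h3.extend (y' := n + 1) (i := i) h1.le (by omega) hc hd h4 h5
    (fun z hz x => ht.col_le hz x) (fun z hz _ x => ht.col_gt hz x)
    (fun _ _ _ h => Finset.mem_insert_of_mem h) (Finset.mem_insert_self _ _) hm.bottom
    (fun z _ hz => hm.not_crossed hV (by omega) h2 hz)
    (fun z _ hz x hx => hV.col_lt_of_nonpos hVw hinc hz hx hd), ?_⟩
  rw [if_neg (by omega)]

/-! ### Two successive insertions -/

/-- Above the current row nothing has changed yet. This lets the trail in `U` be compared with the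
later states of a second insertion into `U`. -/
theorem Reach.above {k₀ i k : ℤ} (hR : Red n R) (h : Reach n R k₀ V i k) :
    (∀ z, k < z → ∀ x, col n V z x = col n R z x) ∧
      ∀ c z, k < z → ((c, z) ∈ V ↔ (c, z) ∈ R) := by
  induction h with
  | start => exact ⟨fun _ _ _ => rfl, fun _ _ _ => Iff.rfl⟩
  | step h _ _ hbump _ _ _ ih =>
    have hlt := hbump.lt
    exact ⟨fun z hz x => by rw [hbump.col_high (h.red hR).inTable hz, ih.1 z (by omega)],
      fun c z hz => by rw [hbump.mem_iff (by exact hz), ih.2 c z (by omega)]⟩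

/-- If the second insertion got to or past the strand `β r` of the first, its search would have
passed a positive strand: either the one crossing `β r` from the left in this row, or `α r`, which
has crossed `β r` lower down. -/
theorem Reach.label_lt {k₀ k i r f e : ℤ} {α β : ℤ → ℤ} (hU : Red n U) (hw : HasPerm n U w)
    (hinc : IncNonpos w) (htr : Trail n U k (n + 1) α β) (hk : k ≤ k₀)
    (h : Reach n U k₀ V i r) (hm : Meet n V i r f e) (he : e ≤ 0) : e < β r := by
  induction h generalizing f e with
  | start h1 h2 =>
    have hle := hm.row_le
    by_contra! hcon
    have hle' := hU.col_le_of_nonpos (k := k₀) hw hinc (by omega) hcon he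
    rw [hm.bottom] at hle'
    rcases htr.mem k₀ hk (by omega) with h3 | ⟨h3, h4, h5⟩
    · refine h2 _ (lt_of_le_of_ne hle' fun h => ?_)
        (hU.posAt_of_mem hw hinc h3)
      rw [h] at h3
      exact hm.notMem h3
    · have h6 := htr.lt (k₀ - 1) (by omega) (by omega)
      rw [sub_add_cancel, ← h4, ← h5] at h6
      have := hU.nonpos_of_not_posAt (h2 (col n U k₀ (α k₀)) (by omega)) (h2 _ (by omega))
      have := htr.pos k₀ hk (by omega)
      omega
  | @step V W i r l r' f₁ e₁ i' h hf₁ he₁ hbump h4 h5 h6 ih =>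
    have hlt₁ := ih hbump.meet he₁
    have hV := h.red hU
    have hT := hV.inTable
    have hW := (hbump.red_iff hT).2 hV
    have hWw := (hbump.hasPerm hT).2 ((h.hasPerm hU).2 hw)
    have hlt := hbump.lt
    have hle := hm.row_le
    have hkr := h.le
    have habove := h.above hU
    have hbe := hlt₁.trans_le (htr.monotone (by omega) hlt.le (by omega))
    have hl := hbump.col_eq
    rw [habove.1 _ hlt] at hl
    have hβ := htr.nonpos r' (by omega) (by omega)
    have hcolβ : col n W r' (β r') = col n U r' (β r') := by
      rw [hbump.col_mid hT hlt le_rfl, habove.1 _ hlt,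
        Equiv.swap_apply_of_ne_of_ne (by omega) (by omega)]
    by_contra! hcon
    have hle' := hW.col_le_of_nonpos (k := r') hWw hinc (by omega) hcon he
    rw [hm.bottom, hcolβ] at hle'
    have hlβ := hU.col_lt_of_nonpos (k := r') hw hinc (by omega) hbe hβ
    rcases htr.mem r' (by omega) (by omega) with h7 | ⟨h7, h8, h9⟩
    · have h10 : (col n U r' (β r'), r') ∈ W := by
        rw [hbump.eq, Finset.mem_erase, Ne, Prod.mk.injEq]
        exact ⟨by omega, Finset.mem_insert_of_mem ((habove.2 _ _ hlt).2 h7)⟩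
      have hne : col n U r' (β r') ≠ i' := fun h => hm.notMem (h ▸ h10)
      rw [← hcolβ] at h10
      have h11 := hW.posAt_of_mem hWw hinc h10
      rw [hcolβ] at h11
      exact h6 _ (by omega) (by omega) h11
    -- The strand `α r'` enters between `e₁`, whose column is `l`, and `β r'`, a range which the
    -- search found free of positive strands. It is not `f₁`, because `f₁` ends up to the right of
    -- `e₁` and `α r'` does not.
    · have h10 := htr.lt (r' - 1) (by omega) (by omega)
      have h11 := htr.gt (r' - 1) (by omega) (by omega) e₁ (by omega)
      have h12 := htr.gt r' (by omega) (by omega) e₁ hbe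
      rw [sub_add_cancel, ← h8] at h11
      rw [sub_add_cancel, ← h8, ← h9] at h10
      have hα := htr.pos r' (by omega) (by omega)
      have hfα : α r' ≠ f₁ := by
        rintro h13
        have := hbump.crosses.2
        rw [habove.1 _ (by omega), habove.1 _ (by omega), ← h13] at this
        omega
      have hcolα : col n W r' (α r') = col n U r' (α r') := by
        rw [hbump.col_mid hT hlt le_rfl, habove.1 _ hlt,
          Equiv.swap_apply_of_ne_of_ne hfα (by omega)]
      have := hW.nonpos_of_not_posAt (k := r') (x := α r')
        (by rw [hcolα]; exact h6 _ (by omega) (by omega))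
        (by rw [hcolα]; exact h6 _ (by omega) (by omega))
      omega

/-- Suppose `β` jumps above `e` in some row. Just above row `r` the strand `f` is next to `e`, so it
is to the right of the new `β` and remains there. By the gap property it is then to the right of the
previous `β`, hence of `e`, although `e` and `f` have not crossed. In row `k` the gap property
leaves no such `f` at all. -/
theorem Reach.le_label_up {k₀ k i r f e : ℤ} {α β : ℤ → ℤ} (hU : Red n U) (hw : HasPerm n U w)
    (hinc : IncNonpos w) (htr : Trail n U k (n + 1) α β)
    (h : Reach n U k₀ V i r) (hm : Meet n V i r f e) (hf : 0 < f) (he : e ≤ 0)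
    (hr : k ≤ r → β r ≤ e) {z : ℤ} (hrz : r ≤ z) (hzn : z ≤ n)
    (hz : ∀ y, r < y → y ≤ z → col n V y e < col n V y f) (hkz : k ≤ z) : β z ≤ e := by
  have hV := h.red hU
  have hVw := (h.hasPerm hU).2 hw
  have habove := h.above hU
  induction z, hrz using Int.leInduction with
  | base => exact hr hkz
  | succ z hrz ih =>
    by_contra! hcon
    have hβ := htr.nonpos (z + 1) hkz (by omega)
    rcases htr.gap (z + 1) hkz (by omega) with ⟨h1, h2⟩ | h1
    · rw [add_sub_cancel_right] at h2
      have := ih (by omega) (fun y hy hy' => hz y hy (by omega)) (by omega)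
      omega
    · have h2 : col n V (z + 1) f < col n V (z + 1) (β (z + 1)) := by
        refine hV.persist (by omega) (show r + 1 ≤ z + 1 by omega) ?_
        have h3 := hV.col_lt_of_nonpos (k := r + 1) hVw hinc (by omega) hcon hβ
        rw [hm.col_succ_bottom hV hVw hinc he] at h3
        have h4 : col n V (r + 1) (β (z + 1)) ≠ col n V (r + 1) f := by
          rw [Ne, col_inj hV.inTable]
          omega
        rw [hm.left] at h4 ⊢
        omega
      rw [habove.1 _ (by omega), habove.1 _ (by omega)] at h2
      obtain ⟨h3, h4⟩ := h1 f hf h2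
      rw [add_sub_cancel_right] at h4
      have h5 := ih (by omega) (fun y hy hy' => hz y hy (by omega)) (by omega)
      have h6 := hU.col_le_of_nonpos (k := z + 1) hw hinc (by omega) h5 he
      have h7 := hz (z + 1) (by omega) le_rfl
      rw [habove.1 _ (by omega), habove.1 _ (by omega)] at h7
      omega

/-- For an insertion starting below the trail, `Reach.le_label_up` carries the bound from one state
to the row of the next, where the nonpositive label can only grow. -/
theorem Reach.le_label {k₀ k i r f e : ℤ} {α β : ℤ → ℤ} (hU : Red n U) (hw : HasPerm n U w)
    (hinc : IncNonpos w) (htr : Trail n U k (n + 1) α β) (hk : k₀ < k)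
    (h : Reach n U k₀ V i r) (hm : Meet n V i r f e) (hf : 0 < f) (hkr : k ≤ r) : β r ≤ e := by
  induction h generalizing f e with
  | start => omega
  | @step V W i r l r' f₁ e₁ i' h hf₁ he₁ hbump h4 h5 h6 ih =>
    have hV := h.red hU
    have h7 := h.le_label_up hU hw hinc htr hbump.meet hf₁ he₁ (fun h => ih hbump.meet hf₁ h)
      hbump.lt.le hm.row_le (fun y _ hy => hV.persist' (by omega) hy hbump.crosses.1) hkr
    exact h7.trans (hbump.label_le hV ((h.hasPerm hU).2 hw) hinc he₁ hm hf h5)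

/-- The row bumping lemma. -/
theorem Insertion.le_iff {k k' c d c' d' : ℤ} {U' : Finset (ℤ × ℤ)} (hR : Red n R)
    (hw : HasPerm n R w) (hinc : IncNonpos w) (h : Insertion n R k U c d)
    (h' : Insertion n U k' U' c' d') : k ≤ k' ↔ d' < d := by
  obtain ⟨hU, hUw, hcov⟩ := h.spec hR hw
  have hUinc := hcov.incNonpos (hw.isFinPerm hR.inTable) hinc
  obtain ⟨hkn, α, β, htr, rfl⟩ := h.exists_trail hR hw hinc
  obtain ⟨V, i, r, h1, h2, rfl, hc, hd, hm⟩ := h'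
  have hV := h1.red hU
  have hle := hm.row_le
  constructor
  · intro hk
    have h3 := h1.label_lt hU hUw hUinc htr hk hm hd
    exact h3.trans_le (htr.monotone (hk.trans h1.le) hle (by omega))
  · intro hlt
    by_contra! hk
    have := h1.le_label_up hU hUw hUinc htr hm hc hd
      (fun hkr => h1.le_label hU hUw hUinc htr hk hm hc hkr) hle le_rfl
      (fun y _ hy => hm.not_crossed hV (by omega) h2 (by omega)) hkn
    omega

end RCGraph
namespace RCGraph
variable {n : ℕ} {R : Finset (ℤ × ℤ)} {w : Equiv.Perm ℤ}

/-! ### Monomials of Schubert polynomials -/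

/-- The exponent of the monomial of `R`. -/
noncomputable def rowExp (R : Finset (ℤ × ℤ)) : ℤ →₀ ℕ :=
  ∑ p ∈ R, Finsupp.single p.2 1

theorem prod_X_eq (R : Finset (ℤ × ℤ)) :
    ∏ p ∈ R, (MvPolynomial.X p.2 : MvPolynomial ℤ ℤ) = MvPolynomial.monomial (rowExp R) 1 := by
  rw [rowExp, MvPolynomial.monomial_sum_one]
  rfl

theorem schubert_eq_sum (hw : IsFinPerm n w) :
    schubert n w = ∑ R ∈ (graphs_finite hw).toFinset, MvPolynomial.monomial (rowExp R) 1 := by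
  rw [schubert, finsum_mem_eq_finite_toFinset_sum _ (graphs_finite hw)]
  exact Finset.sum_congr rfl fun R _ => prod_X_eq R

theorem coeff_schubert (hw : IsFinPerm n w) (e : ℤ →₀ ℕ) :
    MvPolynomial.coeff e (schubert n w) =
      (((graphs_finite hw).toFinset.filter fun R => rowExp R = e).card : ℤ) := by
  classical
  rw [schubert_eq_sum hw, MvPolynomial.coeff_sum]
  simp only [MvPolynomial.coeff_monomial]
  rw [Finset.sum_boole]

/-! ### Linear independence of the Schubert polynomials -/

/-- The number of places of `R` in the rows up to `K`. -/
def lowCount (R : Finset (ℤ × ℤ)) (K : ℤ) : ℕ := (R.filter fun p => p.2 ≤ K).card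

theorem lowCount_eq (R : Finset (ℤ × ℤ)) (K : ℤ) :
    lowCount R K = (rowExp R).sum fun k m => if k ≤ K then m else 0 := by
  rw [rowExp, ← Finsupp.sum_finsetSum_index (by simp) (by intros; split_ifs <;> simp)]
  rw [lowCount, Finset.card_filter]
  refine Finset.sum_congr rfl fun p _ => ?_
  rw [Finsupp.sum_single_index (by simp)]

/-- The number of inversions of `w` among the labels up to `K`. -/
noncomputable def invLow (w : Equiv.Perm ℤ) (K : ℤ) : ℕ := {p ∈ invSet w | p.1 ≤ K}.ncard

theorem invLow_finite (hw : IsFinPerm n w) (K : ℤ) : {p ∈ invSet w | p.1 ≤ K}.Finite :=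
  (invSet_finite hw).subset fun _ h => h.1

/-- A crossing in a row up to `K` belongs to an inversion whose larger label is at most `K`, and
each inversion has only one crossing. -/
theorem Red.lowCount_le (h : Red n R) (hw : HasPerm n R w) (K : ℤ) :
    lowCount R K ≤ invLow w K := by
  have hf := invLow_finite (hw.isFinPerm h.inTable) K
  rw [lowCount, invLow, Set.ncard_eq_toFinset_card _ hf]
  refine Finset.card_le_card_of_forall_subsingleton
    (fun p q => Crosses n R p.2 q.1 q.2 ∧ col n R p.2 q.2 = p.1) ?_ ?_
  · intro p hp
    rw [Finset.mem_filter] at hp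
    obtain ⟨a, b, h1, h2⟩ := exists_crosses_of_mem h.inTable hp.1
    obtain ⟨h3, h4⟩ := h.inv_of_crosses hw h1
    exact ⟨(a, b), hf.mem_toFinset.2 ⟨h3, h4.trans hp.2⟩, h1, h2⟩
  · rintro q - p ⟨-, h1, h2⟩ p' ⟨-, h3, h4⟩
    have h5 := h.crosses_row_unique h1 h3
    exact Prod.ext (by rw [← h2, ← h4, h5]) h5

/-- In the left-justified rc-graph a strand crosses the smaller labels inverted with it in its own
starting row, as low as possible. -/
theorem IsBottom.le_lowCount (hw : IsFinPerm n w) (h : IsBottom n w R) (K : ℤ) :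
    invLow w K ≤ lowCount R K := by
  have hT := h.inTable hw
  rw [lowCount, invLow, ← Set.ncard_coe_finset]
  refine Set.ncard_le_ncard_of_injOn (fun p => (col n R p.1 p.2, p.1)) ?_ ?_
    (Finset.finite_toSet _)
  · rintro ⟨a, b⟩ ⟨⟨h1, h2⟩, h3⟩
    simp only at h1 h2 h3
    rw [Finset.mem_coe, Finset.mem_filter]
    refine ⟨((crosses_iff hT).1 (show Crosses n R a a b from ⟨?_, ?_⟩)).1, h3⟩
    · rw [col_of_le le_rfl]
      have := (col_le_iff hT).2 h1
      omega
    · rwa [h.col_lt_iff hw h1 (by omega)]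
  · rintro ⟨a, b⟩ - ⟨a', b'⟩ - heq
    simp only [Prod.mk.injEq] at heq
    obtain ⟨h1, rfl⟩ := heq
    rw [col_inj hT] at h1
    rw [h1]

theorem invLow_eq_add (hw : IsFinPerm n w) (k : ℤ) :
    invLow w k = invLow w (k - 1) + rank w k k := by
  have h1 : {p ∈ invSet w | p.1 ≤ k} =
      {p ∈ invSet w | p.1 ≤ k - 1} ∪ (fun b => (k, b)) '' {b | b < k ∧ w k < w b} := by
    ext ⟨a, b⟩
    simp only [Set.mem_union, Set.mem_image, Set.mem_ofPred_eq, Prod.mk.injEq, invSet]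
    constructor
    · rintro ⟨h1, h2⟩
      rcases h2.lt_or_eq with h2 | rfl
      · exact Or.inl ⟨h1, by omega⟩
      · exact Or.inr ⟨b, h1, rfl, rfl⟩
    · rintro (⟨h1, h2⟩ | ⟨b', h1, rfl, rfl⟩)
      · exact ⟨h1, by omega⟩
      · exact ⟨h1, le_rfl⟩
  rw [invLow, h1, Set.ncard_union_eq _ (invLow_finite hw _) ((rank_finite hw k k).image _),
    Set.ncard_image_of_injective _ (Prod.mk_right_injective k)]
  · rfl
  · rw [Set.disjoint_left]
    rintro _ ⟨-, h2⟩ ⟨b, -, rfl⟩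
    simp only at h2
    omega

/-- Differences of consecutive values give the row lengths of the left-justified rc-graph, which
determines the permutation. -/
theorem invLow_injective {u v : Equiv.Perm ℤ} (hu : IsFinPerm n u) (hv : IsFinPerm n v)
    (h : invLow u = invLow v) : u = v := by
  have hrank : ∀ k, rank u k k = rank v k k := fun k => by
    have h1 := invLow_eq_add hu k
    have h2 := invLow_eq_add hv k
    rw [h] at h1
    omega
  obtain ⟨R, hR⟩ := exists_isBottom hu
  have hR' : IsBottom n v R := fun i k => by rw [hR i k, hrank]
  exact (hR.hasPerm hu).unique (hR.inTable hu) (hR'.hasPerm hv)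

/-- The Schubert polynomials are linearly independent. -/
theorem schubert_independent (c : FinPerm n →₀ ℤ)
    (hc : (c.sum fun u a => MvPolynomial.C a * schubert n u.1) = 0) : c = 0 := by
  by_contra hne
  -- For this `u`, maximal in the pointwise order, the monomial of its left-justified rc-graph
  -- occurs in no other Schubert polynomial of the combination.
  obtain ⟨u, hu, hmax⟩ := c.support.exists_maximalFor (fun u => invLow u.1)
    (Finsupp.support_nonempty_iff.2 hne)
  have hu' : IsFinPerm n u.1 := u.2
  obtain ⟨R, hR⟩ := exists_isBottom hu'
  have h1 := congrArg (MvPolynomial.coeff (rowExp R)) hc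
  rw [Finsupp.sum, MvPolynomial.coeff_sum, Finset.sum_eq_single u] at h1
  · rw [MvPolynomial.coeff_C_mul, coeff_schubert hu', MvPolynomial.coeff_zero,
      mul_eq_zero] at h1
    rcases h1 with h1 | h1
    · exact (Finsupp.mem_support_iff.1 hu) h1
    · rw [Nat.cast_eq_zero, Finset.card_eq_zero] at h1
      have : R ∈ (∅ : Finset (Finset (ℤ × ℤ))) := by
        rw [← h1, Finset.mem_filter, Set.Finite.mem_toFinset, mem_graphs_iff]
        exact ⟨⟨hR.red hu', hR.hasPerm hu'⟩, rfl⟩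
      simp at this
  · intro v hv hvu
    have hv' : IsFinPerm n v.1 := v.2
    rw [MvPolynomial.coeff_C_mul, coeff_schubert hv', mul_eq_zero]
    right
    rw [Nat.cast_eq_zero, Finset.card_eq_zero, Finset.filter_eq_empty_iff]
    intro V hV hVR
    rw [Set.Finite.mem_toFinset, mem_graphs_iff] at hV
    have hle : invLow u.1 ≤ invLow v.1 := fun K =>
      calc invLow u.1 K ≤ lowCount R K := hR.le_lowCount hu' K
        _ = lowCount V K := by rw [lowCount_eq, lowCount_eq, hVR]
        _ ≤ invLow v.1 K := hV.1.lowCount_le hV.2 K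
    exact hvu (Subtype.ext (invLow_injective hv' hu' (le_antisymm (hmax hv hle) hle)))
  · exact fun h => absurd hu h

end RCGraph
namespace RCGraph
variable {n : ℕ} {R U : Finset (ℤ × ℤ)} {w : Equiv.Perm ℤ}

/-! ### Inserting words -/

/-- A step puts a place into row `k` and removes one from row `k'`, so the set together with the row
of the pending place keeps its monomial. -/
theorem Reach.prod_eq {k i y : ℤ} {V : Finset (ℤ × ℤ)} (hR : Red n R) (h : Reach n R k V i y) :
    (∏ p ∈ V, (MvPolynomial.X p.2 : MvPolynomial ℤ ℤ)) * MvPolynomial.X y =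
      (∏ p ∈ R, MvPolynomial.X p.2) * MvPolynomial.X k := by
  induction h with
  | start => rfl
  | @step V W i k l k' a b i' h _ _ hbump _ _ _ ih =>
    rw [← ih, hbump.eq, Finset.prod_erase_mul _ (fun p : ℤ × ℤ => MvPolynomial.X p.2)
      (Finset.mem_insert_of_mem (hbump.mem (h.red hR).inTable)),
      Finset.prod_insert hbump.meet.notMem, mul_comm]

theorem Insertion.prod_eq {k c d : ℤ} (hR : Red n R) (h : Insertion n R k U c d) :
    ∏ p ∈ U, (MvPolynomial.X p.2 : MvPolynomial ℤ ℤ) =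
      (∏ p ∈ R, MvPolynomial.X p.2) * MvPolynomial.X k := by
  obtain ⟨V, i, y, h1, -, rfl, -, -, hm⟩ := h
  rw [Finset.prod_insert hm.notMem, mul_comm, h1.prod_eq hR]

theorem Insertion.det {k c d c' d' : ℤ} {U' : Finset (ℤ × ℤ)} (hR : Red n R)
    (h : Insertion n R k U c d) (h' : Insertion n R k U' c' d') : U = U' ∧ c = c' ∧ d = d' := by
  have hU : U = U' := ((insertFrom_iff_insertion hR).2 ⟨c, d, h⟩).unique hR
    ((insertFrom_iff_insertion hR).2 ⟨c', d', h'⟩)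
  subst hU
  obtain ⟨w, hw⟩ := exists_hasPerm hR.inTable
  obtain ⟨h1, h2, h3⟩ := h.spec hR hw
  obtain ⟨-, h4, h5⟩ := h'.spec hR hw
  exact ⟨rfl, swap_eq_swap (mul_left_cancel (h2.unique h1.inTable h4)) h3.pos h3.nonpos h5.nonpos⟩

/-- The insertion of the word `v` into `R` gives `U`, where `s` lists the transpositions which
arise from the insertions of the letters. -/
def WordInsertion (n : ℕ) : Finset (ℤ × ℤ) → List ℕ → List (ℤ × ℤ) → Finset (ℤ × ℤ) → Prop
  | R, [], [], U => R = U
  | R, k :: v, p :: s, U => ∃ R', Insertion n R k R' p.1 p.2 ∧ WordInsertion n R' v s U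
  | _, [], _ :: _, _ => False
  | _, _ :: _, [], _ => False

/-- Each of the transpositions increases the length by one. -/
def CoverChain (n : ℕ) : Equiv.Perm ℤ → List (ℤ × ℤ) → Prop
  | _, [] => True
  | w, p :: s => Cover n w p.1 p.2 ∧ CoverChain n (w * Equiv.swap p.1 p.2) s

/-- The product of transpositions. -/
def swapProd (s : List (ℤ × ℤ)) : Equiv.Perm ℤ := (s.map fun p => Equiv.swap p.1 p.2).prod

theorem swapProd_cons (p : ℤ × ℤ) (s : List (ℤ × ℤ)) :
    swapProd (p :: s) = Equiv.swap p.1 p.2 * swapProd s := rfl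

theorem coverChain_iff {s : List (ℤ × ℤ)} : CoverChain n w s ↔
    (∀ p ∈ s, 0 < p.1 ∧ p.1 ≤ n ∧ p.2 ≤ 0) ∧
      ∀ r ≤ s.length, length n (w * swapProd (s.take r)) = length n w + r := by
  induction s generalizing w with
  | nil => simp [CoverChain, swapProd]
  | cons p s ih =>
    simp only [CoverChain, ih, List.forall_mem_cons, List.length_cons]
    constructor
    · rintro ⟨h1, h2, h3⟩
      refine ⟨⟨⟨h1.pos, h1.le, h1.nonpos⟩, h2⟩, fun r hr => ?_⟩
      cases r with
      | zero => simp [swapProd]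
      | succ r =>
        have := h3 r (by omega)
        rw [List.take_succ_cons, swapProd_cons, ← mul_assoc, this, h1.length_eq]
        omega
    · rintro ⟨⟨h1, h2⟩, h3⟩
      have h4 : length n (w * Equiv.swap p.1 p.2) = length n w + 1 := by
        simpa [swapProd] using h3 1 (by omega)
      refine ⟨⟨h1.1, h1.2.1, h1.2.2, h4⟩, h2, fun r hr => ?_⟩
      have := h3 (r + 1) (by omega)
      rw [List.take_succ_cons, swapProd_cons, ← mul_assoc] at this
      rw [this, h4]
      omega

theorem CoverChain.isFinPerm {s : List (ℤ × ℤ)} (hw : IsFinPerm n w) (h : CoverChain n w s) :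
    IsFinPerm n (w * swapProd s) := by
  induction s generalizing w with
  | nil => simpa [swapProd] using hw
  | cons p s ih =>
    rw [swapProd_cons, ← mul_assoc]
    exact ih (h.1.isFinPerm hw) h.2

namespace WordInsertion

theorem length_eq {v : List ℕ} {s : List (ℤ × ℤ)} (h : WordInsertion n R v s U) :
    v.length = s.length := by
  induction v generalizing R s with
  | nil => cases s with
    | nil => rfl
    | cons => exact h.elim
  | cons k v ih => cases s with
    | nil => exact h.elim
    | cons p s =>
      obtain ⟨R', -, h2⟩ := h
      simp [ih h2]

theorem spec {v : List ℕ} {s : List (ℤ × ℤ)} (hR : Red n R) (hw : HasPerm n R w)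
    (h : WordInsertion n R v s U) :
    Red n U ∧ HasPerm n U (w * swapProd s) ∧ CoverChain n w s := by
  induction v generalizing R s w with
  | nil => cases s with
    | nil =>
      obtain rfl : R = U := h
      exact ⟨hR, by simpa [swapProd] using hw, trivial⟩
    | cons => exact h.elim
  | cons k v ih => cases s with
    | nil => exact h.elim
    | cons p s =>
      obtain ⟨R', h1, h2⟩ := h
      obtain ⟨h3, h4, h5⟩ := h1.spec hR hw
      obtain ⟨h6, h7, h8⟩ := ih h3 h4 h2
      rw [swapProd_cons, ← mul_assoc]
      exact ⟨h6, h7, h5, h8⟩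

/-- The row bumping lemma is applied to each pair of successive letters; covers preserve the
monotonicity on nonpositive integers that it requires. -/
theorem isChain_iff {v : List ℕ} {s : List (ℤ × ℤ)} (hR : Red n R) (hw : HasPerm n R w)
    (hinc : IncNonpos w) (h : WordInsertion n R v s U) :
    v.IsChain (· ≤ ·) ↔ s.IsChain fun p q => q.2 < p.2 := by
  induction v generalizing R s w with
  | nil => cases s with
    | nil => simp
    | cons => exact h.elim
  | cons k v ih => cases s with
    | nil => exact h.elim
    | cons p s =>
      obtain ⟨R', h1, h2⟩ := h
      obtain ⟨h3, h4, h5⟩ := h1.spec hR hw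
      have h6 := ih h3 h4 (h5.incNonpos (hw.isFinPerm hR.inTable) hinc) h2
      cases v with
      | nil => cases s with
        | nil => simp
        | cons => exact h2.elim
      | cons k' v => cases s with
        | nil => exact h2.elim
        | cons p' s =>
          rw [List.isChain_cons_cons, List.isChain_cons_cons, h6]
          obtain ⟨R'', h7, -⟩ := h2
          rw [← h1.le_iff hR hw hinc h7, Nat.cast_le]

theorem prod_eq {v : List ℕ} {s : List (ℤ × ℤ)} (hR : Red n R) (h : WordInsertion n R v s U) :
    ∏ p ∈ U, (MvPolynomial.X p.2 : MvPolynomial ℤ ℤ) =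
      (∏ p ∈ R, MvPolynomial.X p.2) * (v.map fun k : ℕ => MvPolynomial.X (k : ℤ)).prod := by
  induction v generalizing R s with
  | nil => cases s with
    | nil =>
      obtain rfl : R = U := h
      simp
    | cons => exact h.elim
  | cons k v ih => cases s with
    | nil => exact h.elim
    | cons p s =>
      obtain ⟨w, hw⟩ := exists_hasPerm hR.inTable
      obtain ⟨R', h1, h2⟩ := h
      rw [ih (h1.spec hR hw).1 h2, h1.prod_eq hR, List.map_cons, List.prod_cons, mul_assoc]

theorem det {v : List ℕ} {s s' : List (ℤ × ℤ)} {U' : Finset (ℤ × ℤ)} (hR : Red n R)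
    (h : WordInsertion n R v s U) (h' : WordInsertion n R v s' U') : s = s' ∧ U = U' := by
  induction v generalizing R s s' with
  | nil => cases s with
    | nil => cases s' with
      | nil => exact ⟨rfl, Eq.trans (Eq.symm h) h'⟩
      | cons => exact h'.elim
    | cons => exact h.elim
  | cons k v ih => cases s with
    | nil => exact h.elim
    | cons p s => cases s' with
      | nil => exact h'.elim
      | cons p' s' =>
        obtain ⟨w, hw⟩ := exists_hasPerm hR.inTable
        obtain ⟨R', h1, h2⟩ := h
        obtain ⟨R'', h3, h4⟩ := h'
        obtain ⟨rfl, h5, h6⟩ := h1.det hR h3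
        obtain ⟨h7, h8⟩ := ih (h1.spec hR hw).1 h2 h4
        exact ⟨by rw [h7, Prod.ext h5 h6], h8⟩

theorem unique {v v' : List ℕ} {s : List (ℤ × ℤ)} {R' : Finset (ℤ × ℤ)} (hR : Red n R)
    (hR' : Red n R') (h : WordInsertion n R v s U)
    (h' : WordInsertion n R' v' s U) : R = R' ∧ v = v' := by
  induction s generalizing R R' v v' with
  | nil => cases v with
    | nil => cases v' with
      | nil => exact ⟨Eq.trans h (Eq.symm h'), rfl⟩
      | cons => exact h'.elim
    | cons => exact h.elim
  | cons p s ih => cases v with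
    | nil => exact h.elim
    | cons k v => cases v' with
      | nil => exact h'.elim
      | cons k' v' =>
        obtain ⟨w, hw⟩ := exists_hasPerm hR.inTable
        obtain ⟨w', hw'⟩ := exists_hasPerm hR'.inTable
        obtain ⟨V, h1, h2⟩ := h
        obtain ⟨V', h3, h4⟩ := h'
        obtain ⟨rfl, rfl⟩ := ih (h1.spec hR hw).1 (h3.spec hR' hw').1 h2 h4
        obtain ⟨rfl, h5⟩ := h1.unique hR hR' h3
        exact ⟨rfl, by rw [Nat.cast_inj.1 h5]⟩

theorem exists_of_word {v : List ℕ} (hR : Red n R) (hv : ∀ k ∈ v, 1 ≤ k ∧ k ≤ n) :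
    ∃ s U, WordInsertion n R v s U := by
  induction v generalizing R with
  | nil => exact ⟨[], R, rfl⟩
  | cons k v ih =>
    have hk := hv k (by simp)
    obtain ⟨w, hw⟩ := exists_hasPerm hR.inTable
    obtain ⟨R', hR'⟩ := exists_insertFrom hR (k := k) (by omega) (by omega)
    obtain ⟨c, d, h⟩ := (insertFrom_iff_insertion hR).1 hR'
    obtain ⟨s, U, h1⟩ := ih (h.spec hR hw).1 fun k hk => hv k (by simp [hk])
    exact ⟨(c, d) :: s, U, R', h, h1⟩

/-- The word is recovered from its last letter: each cover of the chain, taken from the end, undoes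
one insertion. -/
theorem exists_of_chain {s : List (ℤ × ℤ)} (hU : Red n U) (hw : IsFinPerm n w)
    (h : CoverChain n w s) (hu : HasPerm n U (w * swapProd s)) :
    ∃ R v, Red n R ∧ HasPerm n R w ∧ (∀ k ∈ v, 1 ≤ k ∧ k ≤ n) ∧ WordInsertion n R v s U := by
  induction s generalizing w with
  | nil => exact ⟨U, [], hU, by simpa [swapProd] using hu, by simp, rfl⟩
  | cons p s ih =>
    rw [swapProd_cons, ← mul_assoc] at hu
    obtain ⟨R', v, h1, h2, h3, h4⟩ := ih (h.1.isFinPerm hw) h.2 hu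
    obtain ⟨R, k, h5, h6, h7, h8, h9⟩ := exists_insertion h1 hw h.1 h2
    lift k to ℕ using h7.le
    refine ⟨R, k :: v, h5, h6, ?_, R', h9, h4⟩
    intro x hx
    rcases List.mem_cons.1 hx with rfl | hx
    · omega
    · exact h3 x hx

end WordInsertion

theorem insertWord_iff {v : List ℕ} (hR : Red n R) :
    InsertWord n R v U ↔ ∃ s, WordInsertion n R v s U := by
  induction v generalizing R with
  | nil =>
    constructor
    · exact fun h => ⟨[], h⟩
    · rintro ⟨_ | ⟨p, s⟩, h⟩
      · exact h
      · exact h.elim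
  | cons k v ih =>
    obtain ⟨w, hw⟩ := exists_hasPerm hR.inTable
    constructor
    · rintro ⟨R', h1, h2⟩
      obtain ⟨c, d, h3⟩ := (insertFrom_iff_insertion hR).1 h1
      obtain ⟨s, h4⟩ := (ih (h3.spec hR hw).1).1 h2
      exact ⟨(c, d) :: s, R', h3, h4⟩
    · rintro ⟨_ | ⟨p, s⟩, h⟩
      · exact h.elim
      · obtain ⟨R', h1, h2⟩ := h
        exact ⟨R', (insertFrom_iff_insertion hR).2 ⟨_, _, h1⟩,
          (ih (h1.spec hR hw).1).2 ⟨s, h2⟩⟩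

/-! ### Tableaux with one row -/

theorem mem_oneRow {m i j : ℕ} : (i, j) ∈ oneRow m ↔ i = 0 ∧ j < m := by
  rw [oneRow, YoungDiagram.mem_ofRowLens]
  constructor
  · rintro ⟨h1, h2⟩
    simp only [List.length_cons, List.length_nil] at h1
    obtain rfl : i = 0 := by omega
    exact ⟨rfl, by simpa using h2⟩
  · rintro ⟨rfl, h⟩
    exact ⟨by simp, by simpa using h⟩

theorem rowLen_oneRow (m : ℕ) : (oneRow m).rowLen 0 = m := by
  apply le_antisymm <;> by_contra! h
  · have := (mem_oneRow.1 (YoungDiagram.mem_iff_lt_rowLen.2 h)).2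
    omega
  · have := YoungDiagram.mem_iff_lt_rowLen.1 (mem_oneRow.2 ⟨rfl, h⟩)
    omega

theorem word_oneRow {m : ℕ} (Y : SemistandardYoungTableau (oneRow m)) :
    word Y = (List.range m).map fun j => Y 0 j := by
  rcases Nat.eq_zero_or_pos m with rfl | hm
  · have : (oneRow 0).colLen 0 = 0 := by
      by_contra h
      have := mem_oneRow.1 (YoungDiagram.mem_iff_lt_colLen.2 (Nat.pos_of_ne_zero h))
      omega
    simp [word, this]
  · have : (oneRow m).colLen 0 = 1 := by
      have h1 := YoungDiagram.mem_iff_lt_colLen.1 (mem_oneRow.2 ⟨rfl, hm⟩)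
      by_contra h
      have := mem_oneRow.1 (YoungDiagram.mem_iff_lt_colLen.2
        (show 1 < (oneRow m).colLen 0 by omega))
      omega
    simp [word, this, rowLen_oneRow]

theorem length_word {m : ℕ} (Y : SemistandardYoungTableau (oneRow m)) : (word Y).length = m := by
  simp [word_oneRow]

theorem word_injective {m : ℕ} :
    Function.Injective (word : SemistandardYoungTableau (oneRow m) → List ℕ) := by
  intro Y Y' h
  rw [word_oneRow, word_oneRow, List.map_inj_left] at h
  ext i j
  by_cases hij : (i, j) ∈ oneRow m
  · obtain ⟨rfl, hj⟩ := mem_oneRow.1 hij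
    exact h j (List.mem_range.2 hj)
  · rw [Y.zeros hij, Y'.zeros hij]

theorem isChain_word {m : ℕ} (Y : SemistandardYoungTableau (oneRow m)) :
    (word Y).IsChain (· ≤ ·) := by
  rw [List.isChain_iff_pairwise, word_oneRow, List.pairwise_map]
  refine List.Pairwise.imp_of_mem ?_ List.pairwise_lt_range
  intro a b _ hb hab
  exact Y.row_weak hab (mem_oneRow.2 ⟨rfl, List.mem_range.1 hb⟩)

theorem mem_tableaux_oneRow {m : ℕ} {Y : SemistandardYoungTableau (oneRow m)} :
    Y ∈ tableaux n (oneRow m) ↔ ∀ k ∈ word Y, 1 ≤ k ∧ k ≤ n := by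
  rw [word_oneRow, List.forall_mem_map]
  constructor
  · intro h j hj
    exact h (0, j) (by
      rw [YoungDiagram.mem_cells, mem_oneRow]
      exact ⟨rfl, List.mem_range.1 hj⟩)
  · rintro h ⟨i, j⟩ hc
    obtain ⟨rfl, hj⟩ := mem_oneRow.1 ((YoungDiagram.mem_cells _).1 hc)
    exact h j (List.mem_range.2 hj)

theorem exists_word_eq {v : List ℕ} (hv : v.IsChain (· ≤ ·)) :
    ∃ Y : SemistandardYoungTableau (oneRow v.length), word Y = v := by
  rw [List.isChain_iff_pairwise, List.pairwise_iff_getElem] at hv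
  refine ⟨⟨fun i j => if i = 0 then v.getD j 0 else 0, ?_, ?_, ?_⟩, ?_⟩
  · intro i j₁ j₂ hj hm
    obtain ⟨rfl, h2⟩ := mem_oneRow.1 hm
    rw [if_pos rfl, if_pos rfl, List.getD_eq_getElem _ _ h2,
      List.getD_eq_getElem _ _ (hj.trans h2)]
    exact hv _ _ _ _ hj
  · intro i₁ i₂ j hi hm
    obtain ⟨rfl, h2⟩ := mem_oneRow.1 hm
    omega
  · intro i j hm
    rw [mem_oneRow] at hm
    split_ifs with h
    · rw [List.getD_eq_default]
      by_contra! h1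
      exact hm ⟨h, h1⟩
    · rfl
  · rw [word_oneRow]
    apply List.ext_getElem
    · simp
    · intro j h1 h2
      rw [List.getElem_map, List.getElem_range]
      exact List.getD_eq_getElem _ _ h2

theorem prod_cells_eq {m : ℕ} (Y : SemistandardYoungTableau (oneRow m)) :
    ∏ c ∈ (oneRow m).cells, (MvPolynomial.X (Y c.1 c.2 : ℤ) : MvPolynomial ℤ ℤ) =
      ((word Y).map fun k : ℕ => MvPolynomial.X (k : ℤ)).prod := by
  have : (oneRow m).cells = (Finset.range m).image fun j => (0, j) := by
    ext ⟨i, j⟩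
    rw [YoungDiagram.mem_cells, mem_oneRow]
    simp only [Finset.mem_image, Finset.mem_range, Prod.mk.injEq]
    constructor
    · rintro ⟨rfl, h⟩
      exact ⟨j, h, rfl, rfl⟩
    · rintro ⟨j, h, rfl, rfl⟩
      exact ⟨rfl, h⟩
  rw [this, Finset.prod_image (by simp), word_oneRow, List.map_map]
  rfl

theorem tableaux_finite (m : ℕ) : (tableaux n (oneRow m)).Finite := by
  refine Set.Finite.of_finite_image (f := word) ?_ word_injective.injOn
  refine (List.finite_length_eq (Fin (n + 1)) m).image (List.map Fin.val) |>.subset ?_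
  rintro _ ⟨Y, hY, rfl⟩
  rw [mem_tableaux_oneRow] at hY
  refine ⟨(word Y).map (Fin.ofNat (n + 1)), by simp [length_word], ?_⟩
  rw [List.map_map]
  conv_rhs => rw [← List.map_id (word Y)]
  refine List.map_congr_left fun k hk => Nat.mod_eq_of_lt ?_
  have := hY k hk
  omega

end RCGraph
namespace RCGraph
variable {n m : ℕ} {w : Equiv.Perm ℤ}

/-! ### Sequences of transpositions -/

/-- The list of a sequence of pairs. -/
def chainList (s : (Fin m → ℤ) × (Fin m → ℤ)) : List (ℤ × ℤ) :=
  List.ofFn fun j => (s.1 j, s.2 j)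

theorem chainList_injective :
    Function.Injective (chainList : (Fin m → ℤ) × (Fin m → ℤ) → List (ℤ × ℤ)) := by
  intro s t h
  have h1 := List.ofFn_injective h
  refine Prod.ext (funext fun j => ?_) (funext fun j => ?_)
  · exact congrArg Prod.fst (congrFun h1 j)
  · exact congrArg Prod.snd (congrFun h1 j)

theorem exists_chainList_eq {l : List (ℤ × ℤ)} (hl : l.length = m) :
    ∃ s : (Fin m → ℤ) × (Fin m → ℤ), chainList s = l := by
  subst hl
  exact ⟨(fun j => (l.get j).1, fun j => (l.get j).2), List.ofFn_get l⟩

theorem length_chainList (s : (Fin m → ℤ) × (Fin m → ℤ)) : (chainList s).length = m := by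
  simp [chainList]

theorem chainPerm_eq (s : (Fin m → ℤ) × (Fin m → ℤ)) (r : ℕ) :
    chainPerm w s.1 s.2 r = w * swapProd ((chainList s).take r) := by
  rw [chainPerm, swapProd, chainList, List.map_take, List.map_ofFn]
  rfl

theorem chainPerm_eq_top (s : (Fin m → ℤ) × (Fin m → ℤ)) :
    chainPerm w s.1 s.2 m = w * swapProd (chainList s) := by
  rw [chainPerm_eq, List.take_of_length_le (length_chainList s).le]

theorem mem_chains_iff {s : (Fin m → ℤ) × (Fin m → ℤ)} : s ∈ chains n m w ↔
    CoverChain n w (chainList s) ∧ (chainList s).IsChain fun p q => q.2 < p.2 := by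
  have htrans : IsTrans (ℤ × ℤ) fun p q => q.2 < p.2 := ⟨fun _ _ _ h1 h2 => h2.trans h1⟩
  rw [coverChain_iff, List.isChain_iff_pairwise, length_chainList]
  simp only [chains, Set.mem_ofPred_eq, chainPerm_eq]
  rw [chainList, List.forall_mem_ofFn_iff, List.pairwise_ofFn]
  constructor
  · rintro ⟨h1, h2, h3⟩
    exact ⟨⟨h1, h3⟩, fun i j hij => h2 hij⟩
  · rintro ⟨⟨h1, h3⟩, h2⟩
    exact ⟨h1, fun i j hij => h2 hij, h3⟩

/-! ### The bijection -/

/-- The pairs of an rc-graph and a tableau with one row. -/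
def insertionSource (n m : ℕ) (w : Equiv.Perm ℤ) :
    Set (Finset (ℤ × ℤ) × SemistandardYoungTableau (oneRow m)) :=
  graphs n w ×ˢ tableaux n (oneRow m)

/-- The pairs of a chain and an rc-graph of its last permutation. -/
def insertionTarget (n m : ℕ) (w : Equiv.Perm ℤ) :
    Set (((Fin m → ℤ) × (Fin m → ℤ)) × Finset (ℤ × ℤ)) :=
  {Q | Q.1 ∈ chains n m w ∧ Q.2 ∈ graphs n (chainPerm w Q.1.1 Q.1.2 m)}

theorem insertionSource_finite (hw : IsFinPerm n w) : (insertionSource n m w).Finite :=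
  (graphs_finite hw).prod (tableaux_finite m)

theorem exists_bijOn (hw : IsFinPerm n w) (hinc : IncNonpos w) :
    ∃ Φ : Finset (ℤ × ℤ) × SemistandardYoungTableau (oneRow m) →
        ((Fin m → ℤ) × (Fin m → ℤ)) × Finset (ℤ × ℤ),
      Set.BijOn Φ (insertionSource n m w) (insertionTarget n m w) ∧
        ∀ P ∈ insertionSource n m w,
          WordInsertion n P.1 (word P.2) (chainList (Φ P).1) (Φ P).2 := by
  have hex : ∀ P : Finset (ℤ × ℤ) × SemistandardYoungTableau (oneRow m),
      ∃ Q : ((Fin m → ℤ) × (Fin m → ℤ)) × Finset (ℤ × ℤ), P ∈ insertionSource n m w →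
        WordInsertion n P.1 (word P.2) (chainList Q.1) Q.2 := by
    intro P
    by_cases hP : P ∈ insertionSource n m w
    · obtain ⟨s, U, h⟩ := WordInsertion.exists_of_word (mem_graphs_iff.1 hP.1).1
        (mem_tableaux_oneRow.1 hP.2)
      obtain ⟨t, rfl⟩ := exists_chainList_eq (h.length_eq.symm.trans (length_word P.2))
      exact ⟨(t, U), fun _ => h⟩
    · exact ⟨((fun _ => 0, fun _ => 0), ∅), fun h => absurd h hP⟩
  choose Φ hΦ using hex
  refine ⟨Φ, ⟨?_, ?_, ?_⟩, hΦ⟩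
  · intro P hP
    obtain ⟨hR, hRw⟩ := mem_graphs_iff.1 hP.1
    obtain ⟨h1, h2, h3⟩ := (hΦ P hP).spec hR hRw
    refine ⟨mem_chains_iff.2 ⟨h3, ?_⟩, ?_⟩
    · exact ((hΦ P hP).isChain_iff hR hRw hinc).1 (isChain_word P.2)
    · rw [chainPerm_eq_top, mem_graphs_iff]
      exact ⟨h1, h2⟩
  · intro P hP P' hP' heq
    have h1 := hΦ P hP
    have h2 := hΦ P' hP'
    rw [← heq] at h2
    obtain ⟨h3, h4⟩ := h1.unique (mem_graphs_iff.1 hP.1).1 (mem_graphs_iff.1 hP'.1).1 h2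
    exact Prod.ext h3 (word_injective h4)
  · rintro ⟨t, U⟩ ⟨h1, h2⟩
    rw [mem_chains_iff] at h1
    rw [chainPerm_eq_top, mem_graphs_iff] at h2
    obtain ⟨R, v, h3, h4, h5, h6⟩ := WordInsertion.exists_of_chain h2.1 hw h1.1 h2.2
    have h7 := (h6.isChain_iff h3 h4 hinc).2 h1.2
    have h8 := h6.length_eq.trans (length_chainList t)
    subst h8
    obtain ⟨Y, hY⟩ := exists_word_eq h7
    have hP : (R, Y) ∈ insertionSource n v.length w :=
      ⟨mem_graphs_iff.2 ⟨h3, h4⟩, mem_tableaux_oneRow.2 (by rwa [hY])⟩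
    have h9 := hΦ _ hP
    rw [hY] at h9
    obtain ⟨h10, h11⟩ := h9.det h3 h6
    exact ⟨_, hP, Prod.ext (chainList_injective h10) h11⟩

theorem isFinPerm_chainPerm (hw : IsFinPerm n w) {s : (Fin m → ℤ) × (Fin m → ℤ)}
    (hs : s ∈ chains n m w) : IsFinPerm n (chainPerm w s.1 s.2 m) := by
  rw [chainPerm_eq_top]
  exact (mem_chains_iff.1 hs).1.isFinPerm hw

/-- A chain is the first component of a pair in `insertionTarget`, since its last permutation has an
rc-graph, and that set is the image of a finite one. -/
theorem chains_finite (hw : IsFinPerm n w) (hinc : IncNonpos w) : (chains n m w).Finite := by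
  obtain ⟨Φ, hΦ, -⟩ := exists_bijOn (m := m) hw hinc
  have h1 : (insertionTarget n m w).Finite := by
    rw [← hΦ.image_eq]
    exact (insertionSource_finite hw).image _
  refine (h1.image Prod.fst).subset fun s hs => ?_
  obtain ⟨U, hU⟩ := graphs_nonempty (isFinPerm_chainPerm hw hs)
  exact ⟨(s, U), ⟨hs, hU⟩, rfl⟩

/-- Pieri's formula. -/
theorem schubert_mul_schur (hw : IsFinPerm n w) (hinc : IncNonpos w) :
    schubert n w * schur n (oneRow m) =
      ∑ s ∈ (chains_finite (m := m) hw hinc).toFinset, schubert n (chainPerm w s.1 s.2 m) := by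
  classical
  obtain ⟨Φ, hΦ, hΦ'⟩ := exists_bijOn (m := m) hw hinc
  have hB : (insertionTarget n m w).Finite := by
    rw [← hΦ.image_eq]
    exact (insertionSource_finite hw).image _
  have h1 : ∑ Q ∈ hB.toFinset, ∏ p ∈ Q.2, (MvPolynomial.X p.2 : MvPolynomial ℤ ℤ) =
      ∑ s ∈ (chains_finite (m := m) hw hinc).toFinset, schubert n (chainPerm w s.1 s.2 m) := by
    rw [Finset.sum_finset_product hB.toFinset (chains_finite hw hinc).toFinset
      (fun s => if h : s ∈ chains n m w then (graphs_finite (isFinPerm_chainPerm hw h)).toFinset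
        else ∅)]
    · refine Finset.sum_congr rfl fun s hs => ?_
      rw [Set.Finite.mem_toFinset] at hs
      rw [dif_pos hs, schubert, finsum_mem_eq_finite_toFinset_sum]
    · rintro ⟨s, U⟩
      rw [Set.Finite.mem_toFinset, Set.Finite.mem_toFinset]
      constructor
      · rintro ⟨h1, h2⟩
        refine ⟨h1, ?_⟩
        rw [dif_pos h1, Set.Finite.mem_toFinset]
        exact h2
      · rintro ⟨h1, h2⟩
        rw [dif_pos h1, Set.Finite.mem_toFinset] at h2
        exact ⟨h1, h2⟩
  rw [← h1, schubert, schur, finsum_mem_eq_finite_toFinset_sum _ (graphs_finite hw),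
    finsum_mem_eq_finite_toFinset_sum _ (tableaux_finite m), Finset.sum_mul_sum,
    ← Finset.sum_product']
  refine Finset.sum_nbij Φ ?_ ?_ ?_ ?_
  · intro P hP
    rw [Finset.mem_product, Set.Finite.mem_toFinset, Set.Finite.mem_toFinset] at hP
    rw [Set.Finite.mem_toFinset]
    exact hΦ.mapsTo hP
  · intro P hP P' hP' h
    rw [Finset.mem_coe, Finset.mem_product, Set.Finite.mem_toFinset,
      Set.Finite.mem_toFinset] at hP hP'
    exact hΦ.injOn hP hP' h
  · intro Q hQ
    rw [Finset.mem_coe, Set.Finite.mem_toFinset] at hQ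
    obtain ⟨P, hP, rfl⟩ := hΦ.surjOn hQ
    refine ⟨P, ?_, rfl⟩
    rw [Finset.mem_coe, Finset.mem_product, Set.Finite.mem_toFinset, Set.Finite.mem_toFinset]
    exact hP
  · intro P hP
    rw [Finset.mem_product, Set.Finite.mem_toFinset, Set.Finite.mem_toFinset] at hP
    rw [(hΦ' P hP).prod_eq (mem_graphs_iff.1 hP.1).1, prod_cells_eq]

/-! ### Coefficients of the expansion -/

theorem insertionPairs_finite (hw : IsFinPerm n w) (U : Finset (ℤ × ℤ)) :
    (insertionPairs n w (oneRow m) U).Finite :=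
  (insertionSource_finite hw).subset fun _ h => ⟨h.1, h.2.1⟩

/-- The bijection is restricted to the pairs whose insertion gives `U`. Their chains are exactly
those ending in `u`, a condition which depends on `U` only through its permutation. -/
theorem ncard_insertionPairs (hw : IsFinPerm n w) (hinc : IncNonpos w) {U : Finset (ℤ × ℤ)}
    (hU : Red n U) {u : Equiv.Perm ℤ} (hu : HasPerm n U u) :
    (insertionPairs n w (oneRow m) U).ncard =
      {s ∈ chains n m w | chainPerm w s.1 s.2 m = u}.ncard := by
  obtain ⟨Φ, hΦ, hΦ'⟩ := exists_bijOn (m := m) hw hinc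
  have key : ∀ P ∈ insertionPairs n w (oneRow m) U, P ∈ insertionSource n m w ∧ (Φ P).2 = U := by
    rintro P ⟨h1, h2, h3⟩
    have hP : P ∈ insertionSource n m w := ⟨h1, h2⟩
    have hR := (mem_graphs_iff.1 h1).1
    obtain ⟨s, hs⟩ := (insertWord_iff hR).1 h3
    exact ⟨hP, ((hΦ' P hP).det hR hs).2⟩
  refine Set.ncard_congr (fun P _ => (Φ P).1) ?_ ?_ ?_
  · intro P hP
    obtain ⟨h1, h2⟩ := key P hP
    obtain ⟨h3, h4⟩ := hΦ.mapsTo h1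
    rw [h2, mem_graphs_iff] at h4
    exact ⟨h3, h4.2.unique hU.inTable hu⟩
  · intro P P' hP hP' heq
    obtain ⟨h1, h2⟩ := key P hP
    obtain ⟨h3, h4⟩ := key P' hP'
    exact hΦ.injOn h1 h3 (Prod.ext heq (h2.trans h4.symm))
  · rintro s ⟨h1, h2⟩
    obtain ⟨P, hP, h3⟩ := hΦ.surjOn (show (s, U) ∈ insertionTarget n m w from
      ⟨h1, by rw [h2]; exact mem_graphs_iff.2 ⟨hU, hu⟩⟩)
    have h4 := hΦ' P hP
    rw [h3] at h4
    exact ⟨P, ⟨hP.1, hP.2, (insertWord_iff (mem_graphs_iff.1 hP.1).1).2 ⟨_, h4⟩⟩, by rw [h3]⟩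

theorem IsExpansion.unique {μ : YoungDiagram} {c c' : FinPerm n →₀ ℤ}
    (h : IsExpansion n w μ c) (h' : IsExpansion n w μ c') : c = c' := by
  rw [← sub_eq_zero]
  apply schubert_independent
  rw [Finsupp.sum_sub_index, ← h, ← h', sub_self]
  intro u a b
  rw [MvPolynomial.C_sub, sub_mul]

/-- The permutation `w` as an element of `FinPerm n`. -/
def IsFinPerm.toFinPerm (hw : IsFinPerm n w) : FinPerm n := ⟨w, hw⟩

theorem IsFinPerm.toFinPerm_val (hw : IsFinPerm n w) : hw.toFinPerm.1 = w := rfl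

/-- Equal last permutations are collected in Pieri's formula, so the coefficient of `u` counts the
chains that end in it. -/
theorem exists_isExpansion (hw : IsFinPerm n w) (hinc : IncNonpos w) :
    ∃ c : FinPerm n →₀ ℤ, IsExpansion n w (oneRow m) c ∧
      ∀ u : FinPerm n, c u = {s ∈ chains n m w | chainPerm w s.1 s.2 m = u.1}.ncard := by
  classical
  have hfin := chains_finite (m := m) hw hinc
  refine ⟨∑ s ∈ hfin.toFinset.attach, Finsupp.single
    (isFinPerm_chainPerm hw (hfin.mem_toFinset.1 s.2)).toFinPerm 1, ?_, ?_⟩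
  · rw [IsExpansion, schubert_mul_schur hw hinc, ← Finsupp.sum_finsetSum_index (by simp)
      (by intros; rw [MvPolynomial.C_add, add_mul]),
      ← Finset.sum_attach hfin.toFinset]
    refine Finset.sum_congr rfl fun s _ => ?_
    rw [Finsupp.sum_single_index (by simp), IsFinPerm.toFinPerm_val, MvPolynomial.C_1, one_mul]
  · intro u
    rw [Finsupp.finsetSum_apply]
    have h1 : {s ∈ chains n m w | chainPerm w s.1 s.2 m = u.1} =
        (hfin.toFinset.filter fun s => chainPerm w s.1 s.2 m = u.1 : Set _) := by
      ext s
      simp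
    rw [h1, Set.ncard_coe_finset, Finset.card_filter, ← Finset.sum_attach hfin.toFinset,
      Nat.cast_sum]
    refine Finset.sum_congr rfl fun s _ => ?_
    rw [Finsupp.single_apply, Nat.cast_ite, Nat.cast_one, Nat.cast_zero]
    congr 1
    exact propext ⟨fun h => congrArg Subtype.val h, fun h => Subtype.ext h⟩

end RCGraph

theorem lemma4p2 (n m : ℕ) (w : RCGraph.FinPerm n)
    (hw : ∀ i : ℤ, i ≤ 0 → w.1 (i - 1) < w.1 i) :
    (∃! c : RCGraph.FinPerm n →₀ ℤ, RCGraph.IsExpansion n w.1 (RCGraph.oneRow m) c) ∧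
    (∀ c : RCGraph.FinPerm n →₀ ℤ, RCGraph.IsExpansion n w.1 (RCGraph.oneRow m) c →
      ∀ U : Finset (ℤ × ℤ), RCGraph.IsRC n U →
        ∃ u : RCGraph.FinPerm n, RCGraph.HasPerm n U u.1 ∧
          (RCGraph.insertionPairs n w.1 (RCGraph.oneRow m) U).Finite ∧
          c u = (RCGraph.insertionPairs n w.1 (RCGraph.oneRow m) U).ncard) ∧
    (RCGraph.chains n m w.1).Finite ∧
    RCGraph.schubert n w.1 * RCGraph.schur n (RCGraph.oneRow m) =
      ∑ᶠ s ∈ RCGraph.chains n m w.1,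
        RCGraph.schubert n (RCGraph.chainPerm w.1 s.1 s.2 m) := by
  have hw' : RCGraph.IsFinPerm n w.1 := w.2
  obtain ⟨c, hc, hcoeff⟩ := RCGraph.exists_isExpansion (m := m) hw' hw
  refine ⟨⟨c, hc, fun c' hc' => hc'.unique hc⟩, ?_, RCGraph.chains_finite hw' hw, ?_⟩
  · intro c' hc' U hU
    rw [RCGraph.isRC_iff] at hU
    obtain ⟨u, hu⟩ := RCGraph.exists_hasPerm hU.inTable
    refine ⟨(hu.isFinPerm hU.inTable).toFinPerm, hu, RCGraph.insertionPairs_finite hw' U, ?_⟩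
    rw [hc'.unique hc, hcoeff, RCGraph.IsFinPerm.toFinPerm_val,
      RCGraph.ncard_insertionPairs hw' hw hU hu]
  · rw [RCGraph.schubert_mul_schur hw' hw,
      finsum_mem_eq_finite_toFinset_sum _ (RCGraph.chains_finite hw' hw)]
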